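/- Let $G(s)$ and $\bar G(s)$ be $m\times m$ matrices of real rational functions with minimal (least-order) state-space realizations $(A,B,C,D)$ and $(\bar A,\bar B,\bar C,\bar D)$, so that $G(s)=C(sI-A)^{-1}B+D$ and $\bar G(s)=\bar C(sI-\bar A)^{-1}\bar B+\bar D$. For Hermitian matrices, $X>0$, $X\ge 0$, $X<0$, $X\le 0$ mean positive definite, positive semidefinite, negative definite, negative semidefinite. **Definitions.** $G$ is *strictly proper* if $G(\infty)=0$. $G$ is *negative imaginary (NI)* if: (1) $G$ has no pole in $\mathrm{Re}\,s>0$; (2) $j(G(j\omega)-G(j\omega)^*)\ge 0$ for all $\omega>0$ such that $j\omega$ is not a pole of $G$; (3) every pole $j\omega_0$ with $\omega_0>0$ is simple and $\lim_{s\to j\omega_0}(s-j\omega_0)jG(s)$ is Hermitian positive semidefinite; (4) if $0$ is a pole of $G$, then $\lim_{s\to0}s^kG(s)=0$ for all $k\ge3$ and $\lim_{s\to0}s^2G(s)$ is Hermitian positive semidefinite. $\bar G$ is *strictly negative imaginary (SNI)* if it has no pole in $\mathrm{Re}\,s\ge0$ and $j(\bar G(j\omega)-\bar G(j\omega)^*)>0$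 for all $\omega>0$. The positive-feedback interconnection of $G$ and $\bar G$ is *internally stable* if $I-D\bar D$ is nonsingular and $$\begin{bmatrix} A+B\bar D(I-D\bar D)^{-1}C & B\bar C+B\bar D(I-D\bar D)^{-1}D\bar C\\ \bar B(I-D\bar D)^{-1}C & \bar A+\bar B(I-D\bar D)^{-1}D\bar C\end{bmatrix}$$ is Hurwitz (all its eigenvalues have negative real part). **Data.** Put $G_2=\lim_{s\to0}s^2G(s)$, $G_1=\lim_{s\to0}s\,(G(s)-G_2/s^2)$, $G_0=\lim_{s\to0}(G(s)-G_2/s^2-G_1/s)$. If $G$ is NI with $G_2\ne0$, write $G_2=JJ^T$ with $J$ real of full column rank. Take a singular value decomposition $$\Gamma=\begin{bmatrix}G_1&G_2\\G_2&0\end{bmatrix}=\begin{bmatrix}H_1&H_2\end{bmatrix}\begin{bmatrix}S&0\\0&0\end{bmatrix}\begin{bmatrix}V_1^T\\V_2^T\end{bmatrix},$$ with $\begin{bmatrix}H_1&H_2\end{bmatrix}$ and $\begin{bmatrix}V_1&V_2\end{bmatrix}$ real orthogonal and $S$ diagonal with positive diagonal entries. Let $U=H_1S=\begin{bmatrix}U_1\\U_2\end{bmatrix}$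 with $U_1,U_2$ having $m$ rows each, take a singular value decomposition $$U_1^TU_2=\hat U\begin{bmatrix}S_1&0\\0&0\end{bmatrix}\begin{bmatrix}\hat V_1^T\\\hat V_2^T\end{bmatrix}$$ with $\hat U$ and $\begin{bmatrix}\hat V_1&\hat V_2\end{bmatrix}$ real orthogonal and $S_1$ diagonal with positive diagonal entries, and let $F=U_1\hat V_2$. If $F^T\bar G(0)F$ is nonsingular, let $$N_f=\bar G(0)-\bar G(0)F\,(F^T\bar G(0)F)^{-1}F^T\bar G(0).$$ **Theorem.** Suppose that $G$ is strictly proper and NI with $G_2\neq0$, that $\bar G$ is SNI, and that $F^T\bar G(0)F$ is nonsingular. (a) If $N_f$ is positive semidefinite, with positive semidefinite square root $N_f^{1/2}$, then the positive-feedback interconnection of $G$ and $\bar G$ is internally stable if and only if $$F^T\bar G(0)F<0\quad\text{and}\quad I-N_f^{1/2}G_0N_f^{1/2}-N_f^{1/2}G_1J(J^TJ)^{-2}J^TG_1^TN_f^{1/2}>0 .$$ (b) If $N_f$ is negative semidefinite, with $\tilde N_f=(-N_f)^{1/2}$, then the positive-feedback interconnection of $G$ and $\bar G$ is internally stable if and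 only if $$F^T\bar G(0)F<0\quad\text{and}\quad \det\bigl(I+\tilde N_fG_0\tilde N_f+\tilde N_fG_1J(J^TJ)^{-2}J^TG_1^T\tilde N_f\bigr)\neq0 .$$ -/

import Mathlib

open Matrix Filter Topology
open scoped ComplexOrder

namespace NegImag

noncomputable section

/-! ### Real rational transfer function matrices -/

/-- A square transfer function matrix: an `m × m` matrix of real rational functions of `s`. -/
abbrev TransferMatrix (m : ℕ) := Matrix (Fin m) (Fin m) (RatFunc ℝ)

/-- The complex matrix `G(s)`, meaningful at every `s` that is not a pole of `G`. -/
def TransferMatrix.at {m : ℕ} (G : TransferMatrix m) (s : ℂ) : Matrix (Fin m) (Fin m) ℂ :=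
  G.map (RatFunc.eval (algebraMap ℝ ℂ) s)

/-- `s` is a pole of `G`: the reduced denominator of some entry vanishes at `s`. -/
def IsPole {m : ℕ} (G : TransferMatrix m) (s : ℂ) : Prop :=
  ∃ i j, Polynomial.aeval s (G i j).denom = 0

/-- `s` is a simple pole of `G`: it is a pole, and of order at most one in every entry. -/
def IsSimplePole {m : ℕ} (G : TransferMatrix m) (s : ℂ) : Prop :=
  IsPole G s ∧ ∀ i j, ((G i j).denom.map (algebraMap ℝ ℂ)).rootMultiplicity s ≤ 1

/-- `G` is strictly proper: `G(∞) = 0`. -/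
def IsStrictlyProper {m : ℕ} (G : TransferMatrix m) : Prop :=
  Tendsto (fun s : ℂ => G.at s) (Bornology.cobounded ℂ) (𝓝 0)

/-- The real DC gain matrix `G(0)`. -/
def dcGain {m : ℕ} (G : TransferMatrix m) : Matrix (Fin m) (Fin m) ℝ :=
  G.map (RatFunc.eval (RingHom.id ℝ) 0)

/-- Negative imaginary (NI) transfer function matrices, poles at the origin being allowed. -/
structure IsNI {m : ℕ} (G : TransferMatrix m) : Prop where
  no_pole : ∀ s : ℂ, 0 < s.re → ¬ IsPole G s
  freq : ∀ ω : ℝ, 0 < ω → ¬ IsPole G (Complex.I * ω) →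
    (Complex.I • (G.at (Complex.I * ω) - (G.at (Complex.I * ω))ᴴ)).PosSemidef
  imag_pole : ∀ ω : ℝ, 0 < ω → IsPole G (Complex.I * ω) →
    IsSimplePole G (Complex.I * ω) ∧
    ∃ K : Matrix (Fin m) (Fin m) ℂ,
      Tendsto (fun s : ℂ => ((s - Complex.I * ω) * Complex.I) • G.at s)
        (𝓝[≠] (Complex.I * ω)) (𝓝 K) ∧ K.PosSemidef
  zero_pole : IsPole G 0 →
    (∀ k : ℕ, 3 ≤ k → Tendsto (fun s : ℂ => s ^ k • G.at s) (𝓝[≠] 0) (𝓝 0)) ∧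
    ∃ K : Matrix (Fin m) (Fin m) ℂ,
      Tendsto (fun s : ℂ => s ^ 2 • G.at s) (𝓝[≠] 0) (𝓝 K) ∧ K.PosSemidef

/-- Strictly negative imaginary (SNI) transfer function matrices. -/
structure IsSNI {m : ℕ} (G : TransferMatrix m) : Prop where
  no_pole : ∀ s : ℂ, 0 ≤ s.re → ¬ IsPole G s
  freq : ∀ ω : ℝ, 0 < ω →
    (Complex.I • (G.at (Complex.I * ω) - (G.at (Complex.I * ω))ᴴ)).PosDef

/-- `G₀`, `G₁`, `G₂` are the successive limits at the origin
`G₂ = lim s² G(s)`, `G₁ = lim s (G(s) - G₂/s²)`, `G₀ = lim (G(s) - G₂/s² - G₁/s)`. -/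
structure IsOriginExpansion {m : ℕ} (G : TransferMatrix m)
    (G₀ G₁ G₂ : Matrix (Fin m) (Fin m) ℝ) : Prop where
  two : Tendsto (fun s : ℂ => s ^ 2 • G.at s) (𝓝[≠] 0) (𝓝 (G₂.map (algebraMap ℝ ℂ)))
  one : Tendsto (fun s : ℂ => s • (G.at s - (s ^ 2)⁻¹ • G₂.map (algebraMap ℝ ℂ)))
    (𝓝[≠] 0) (𝓝 (G₁.map (algebraMap ℝ ℂ)))
  zero : Tendsto (fun s : ℂ => G.at s - (s ^ 2)⁻¹ • G₂.map (algebraMap ℝ ℂ)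
      - s⁻¹ • G₁.map (algebraMap ℝ ℂ))
    (𝓝[≠] 0) (𝓝 (G₀.map (algebraMap ℝ ℂ)))

/-! ### State-space realizations and internal stability -/

/-- A linear time-invariant system `ẋ = A x + B u`, `y = C x + D u`
with `n` states, `m` inputs and `m` outputs. -/
structure StateSpace (n m : ℕ) where
  A : Matrix (Fin n) (Fin n) ℝ
  B : Matrix (Fin n) (Fin m) ℝ
  C : Matrix (Fin m) (Fin n) ℝ
  D : Matrix (Fin m) (Fin m) ℝ

/-- The transfer function matrix `C (sI - A)⁻¹ B + D`. -/
def StateSpace.transfer {n m : ℕ} (S : StateSpace n m) : TransferMatrix m :=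
  S.C.map RatFunc.C *
    ((RatFunc.X : RatFunc ℝ) • (1 : Matrix (Fin n) (Fin n) (RatFunc ℝ)) - S.A.map RatFunc.C)⁻¹ *
    S.B.map RatFunc.C + S.D.map RatFunc.C

/-- `S` is a minimal realization of `G`: its transfer function matrix is `G`,
and no realization of `G` has fewer states. -/
def IsMinimalRealization {n m : ℕ} (S : StateSpace n m) (G : TransferMatrix m) : Prop :=
  S.transfer = G ∧ ∀ (n' : ℕ) (S' : StateSpace n' m), S'.transfer = G → n ≤ n'

/-- The system matrix of the positive feedback interconnection of `S` and `T`. -/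
def closedLoop {n n' m : ℕ} (S : StateSpace n m) (T : StateSpace n' m) :
    Matrix (Fin n ⊕ Fin n') (Fin n ⊕ Fin n') ℝ :=
  fromBlocks
    (S.A + S.B * T.D * (1 - S.D * T.D)⁻¹ * S.C)
    (S.B * T.C + S.B * T.D * (1 - S.D * T.D)⁻¹ * S.D * T.C)
    (T.B * (1 - S.D * T.D)⁻¹ * S.C)
    (T.A + T.B * (1 - S.D * T.D)⁻¹ * S.D * T.C)

/-- A real square matrix is Hurwitz: all its complex eigenvalues have negative real part. -/
def IsHurwitz {ι : Type*} [Fintype ι] [DecidableEq ι] (A : Matrix ι ι ℝ) : Prop :=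
  ∀ z ∈ spectrum ℂ (A.map (algebraMap ℝ ℂ)), z.re < 0

/-- Internal stability of the positive feedback interconnection of `S` and `T`:
the loop is well posed and the closed-loop system matrix is Hurwitz. -/
def InternallyStable {n n' m : ℕ} (S : StateSpace n m) (T : StateSpace n' m) : Prop :=
  IsUnit (1 - S.D * T.D) ∧ IsHurwitz (closedLoop S T)

/-! ### Matrix notions -/

/-- A singular value decomposition
`M = [H₁ H₂] [[diag σ, 0], [0, 0]] [V₁ V₂]ᵀ` with `[H₁ H₂]`, `[V₁ V₂]` orthogonal and `σ > 0`. -/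
structure IsSVD {a b : Type*} [Fintype a] [DecidableEq a] [Fintype b] [DecidableEq b]
    {p q r : ℕ} (M : Matrix a b ℝ) (H₁ : Matrix a (Fin p) ℝ) (H₂ : Matrix a (Fin q) ℝ)
    (σ : Fin p → ℝ) (V₁ : Matrix b (Fin p) ℝ) (V₂ : Matrix b (Fin r) ℝ) : Prop where
  pos : ∀ i, 0 < σ i
  left_orth : (fromCols H₁ H₂)ᵀ * fromCols H₁ H₂ = 1
  left_orth' : fromCols H₁ H₂ * (fromCols H₁ H₂)ᵀ = 1
  right_orth : (fromCols V₁ V₂)ᵀ * fromCols V₁ V₂ = 1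
  right_orth' : fromCols V₁ V₂ * (fromCols V₁ V₂)ᵀ = 1
  eq : M = fromCols H₁ H₂ *
    (fromBlocks (diagonal σ) 0 0 0 : Matrix (Fin p ⊕ Fin q) (Fin p ⊕ Fin r) ℝ) *
    (fromCols V₁ V₂)ᵀ

/-- The Hankel matrix `[[G₁, G₂], [G₂, 0]]`. -/
def hankel {m : ℕ} (G₁ G₂ : Matrix (Fin m) (Fin m) ℝ) :
    Matrix (Fin m ⊕ Fin m) (Fin m ⊕ Fin m) ℝ :=
  fromBlocks G₁ G₂ G₂ 0

/-- `F` is a matrix obtained from `G₁`, `G₂` by the two-step construction: take a singular value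
decomposition of the Hankel matrix, split `U = H₁ S` into its upper half `U₁` and lower half `U₂`,
take a singular value decomposition of `U₁ᵀ U₂` with right null-space block `V̂₂`,
and put `F = U₁ V̂₂`. -/
def IsHankelFactor {m c : ℕ} (G₁ G₂ : Matrix (Fin m) (Fin m) ℝ)
    (F : Matrix (Fin m) (Fin c) ℝ) : Prop :=
  ∃ (p q q' : ℕ)
    (H₁ : Matrix (Fin m ⊕ Fin m) (Fin p) ℝ) (H₂ : Matrix (Fin m ⊕ Fin m) (Fin q) ℝ)
    (σ : Fin p → ℝ)
    (V₁ : Matrix (Fin m ⊕ Fin m) (Fin p) ℝ) (V₂ : Matrix (Fin m ⊕ Fin m) (Fin q') ℝ)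
    (U : Matrix (Fin m ⊕ Fin m) (Fin p) ℝ)
    (p₁ c' : ℕ)
    (K₁ : Matrix (Fin p) (Fin p₁) ℝ) (K₂ : Matrix (Fin p) (Fin c') ℝ) (τ : Fin p₁ → ℝ)
    (W₁ : Matrix (Fin p) (Fin p₁) ℝ) (W₂ : Matrix (Fin p) (Fin c) ℝ),
    IsSVD (hankel G₁ G₂) H₁ H₂ σ V₁ V₂ ∧
    U = H₁ * diagonal σ ∧
    IsSVD (U.toRows₁ᵀ * U.toRows₂) K₁ K₂ τ W₁ W₂ ∧
    F = U.toRows₁ * W₂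

/-- `𝒫(X, Y) = X - X Y (Yᵀ X Y)⁻¹ Yᵀ X`, meaningful when `Yᵀ X Y` is nonsingular. -/
def schurP {m c : ℕ} (X : Matrix (Fin m) (Fin m) ℝ) (Y : Matrix (Fin m) (Fin c) ℝ) :
    Matrix (Fin m) (Fin m) ℝ :=
  X - X * Y * (Yᵀ * X * Y)⁻¹ * Yᵀ * X

open scoped MatrixOrder in
/-- The positive semidefinite square root of a positive semidefinite real matrix. -/
def psdSqrt {m : ℕ} (N : Matrix (Fin m) (Fin m) ℝ) : Matrix (Fin m) (Fin m) ℝ :=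
  CFC.sqrt N

end

end NegImag

/-! The argument is an energy argument with supply rate `u · ẏ`. For the strictly proper `G`, the
frequency inequality of a negative imaginary system is the hypothesis of a Kalman–Yakubovich–Popov
lemma (`exists_storage`), which gives a symmetric `P` with `(P x - Cᵀ u) · (A x + B u) ≤ 0`. With
controllability and observability, `[A B]` and `[P -Cᵀ]` have the same kernel, so `A = Φ P` and `B =
-Φ Cᵀ` with `Φ` invertible and dissipative (`exists_port_hamiltonian`). Adding a small rate feedback
`-ε ẏ` makes the system stable modulo `ker P`, and a Lyapunov argument then gives `P ≥ 0`
(`storage_posSemidef`). The same factorization holds for `Ḡ`, whose state matrix is Hurwitz, so that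
its storage `P'` is positive definite.

The closed-loop matrix is `diag(Φ, Φ')` times a symmetric loop storage matrix. If the loop is
stable, Lyapunov makes that matrix positive definite; conversely, positivity pushes the eigenvalues
into the closed left half-plane, and the strict inequality for `Ḡ` together with observability
excludes the imaginary axis. A Schur complement eliminates the states of `Ḡ`, so stability is
equivalent to `P - Cᵀ Ḡ(0) C > 0` (`internallyStable_iff`).

It remains to express this through `G₀, G₁, G₂`. Dissipativity and `P ≥ 0` limit the Jordan blocks
of `A` at zero to size two. The range of the Hankel matrix is the set of pairs `(C ξ, C A ξ)` with
`A² ξ = 0`, and the second decomposition singles out `A ξ = 0`; thus `F = C K` where `K` spans `ker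
A = ker P`. Minimizing the form over `ker P` turns the criterion into `Fᵀ Ḡ(0) F < 0` together with
`(C x) · N_f (C x) < x · P x` off `ker P` (`posDef_sub_iff`). Finally, `G₀ + G₁ J (Jᵀ J)⁻² Jᵀ G₁ᵀ`
takes at `u` the value `x · P x` whenever `P x = Cᵀ u` (`origin_form_eq`). Weighted by the square
root of `N_f`, which annihilates `F`, it becomes `Xᵀ P X`, and case (a) says that this is smaller
than the identity. In case (b) the inequality off `ker P` and the determinant condition both hold
automatically. -/

namespace NegImag

set_option linter.unusedSectionVars false

/-- The complexification of a real matrix. -/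
noncomputable def cx {a b : Type*} (M : Matrix a b ℝ) : Matrix a b ℂ := M.map (algebraMap ℝ ℂ)

/-! ### Real matrices acting on complex vectors. -/

section Complexification

variable {a b c : Type*} [Fintype a] [Fintype b] [Fintype c]

theorem cx_apply (M : Matrix a b ℝ) (i : a) (j : b) : cx M i j = (M i j : ℂ) := rfl

theorem cx_mul (M : Matrix a b ℝ) (N : Matrix b c ℝ) : cx (M * N) = cx M * cx N := by
  exact Matrix.map_mul

theorem cx_add (M N : Matrix a b ℝ) : cx (M + N) = cx M + cx N := by
  ext; simp [cx_apply]

theorem cx_sub (M N : Matrix a b ℝ) : cx (M - N) = cx M - cx N := by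
  ext; simp [cx_apply]

theorem cx_neg (M : Matrix a b ℝ) : cx (-M) = -cx M := by
  ext; simp [cx_apply]

theorem cx_zero : cx (0 : Matrix a b ℝ) = 0 := by
  ext; simp [cx_apply]

theorem cx_smul (r : ℝ) (M : Matrix a b ℝ) : cx (r • M) = (r : ℂ) • cx M := by
  ext; simp [cx_apply]

theorem cx_one [DecidableEq a] : cx (1 : Matrix a a ℝ) = 1 := by
  ext i j; simp [cx_apply, Matrix.one_apply]; split_ifs <;> simp

theorem cx_transpose (M : Matrix a b ℝ) : cx Mᵀ = (cx M)ᵀ := rfl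

theorem cx_conjTranspose (M : Matrix a b ℝ) : (cx M)ᴴ = cx Mᵀ := by
  ext; simp [cx_apply, conjTranspose_apply]

theorem cx_injective : Function.Injective (cx : Matrix a b ℝ → Matrix a b ℂ) := by
  intro M N h
  ext i j
  have := congrFun (congrFun h i) j
  simpa [cx_apply] using this

theorem cx_pow [DecidableEq a] (M : Matrix a a ℝ) (k : ℕ) : cx (M ^ k) = cx M ^ k := by
  induction k with
  | zero => simp [cx_one]
  | succ k ih => rw [pow_succ, pow_succ, cx_mul, ih]

theorem det_cx [DecidableEq a] (M : Matrix a a ℝ) : (cx M).det = (M.det : ℂ) := by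
  rw [cx, ← RingHom.mapMatrix_apply, ← RingHom.map_det]; rfl

/-- Real part of a complex vector. -/
def vre (x : a → ℂ) : a → ℝ := fun i => (x i).re

/-- Imaginary part of a complex vector. -/
def vim (x : a → ℂ) : a → ℝ := fun i => (x i).im

/-- A real vector, seen as a complex one. -/
def vcx (x : a → ℝ) : a → ℂ := fun i => (x i : ℂ)

theorem dotProduct_self_nonneg_real (x : a → ℝ) : 0 ≤ x ⬝ᵥ x :=
  Finset.sum_nonneg fun i _ => mul_self_nonneg (x i)

theorem vre_mulVec (M : Matrix b a ℝ) (x : a → ℂ) : vre (cx M *ᵥ x) = M *ᵥ vre x := by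
  ext i; simp [vre, mulVec, dotProduct, cx_apply]

theorem vim_mulVec (M : Matrix b a ℝ) (x : a → ℂ) : vim (cx M *ᵥ x) = M *ᵥ vim x := by
  ext i; simp [vim, mulVec, dotProduct, cx_apply]

theorem vcx_mulVec (M : Matrix b a ℝ) (x : a → ℝ) : cx M *ᵥ vcx x = vcx (M *ᵥ x) := by
  ext i; simp [vcx, mulVec, dotProduct, cx_apply]

theorem vec_eq_zero_iff (x : a → ℂ) : x = 0 ↔ vre x = 0 ∧ vim x = 0 := by
  constructor
  · rintro rfl; constructor <;> ext <;> simp [vre, vim]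
  · rintro ⟨h1, h2⟩
    ext i
    apply Complex.ext
    · simpa [vre] using congrFun h1 i
    · simpa [vim] using congrFun h2 i

theorem re_star_dotProduct (x y : a → ℂ) :
    (star x ⬝ᵥ y).re = vre x ⬝ᵥ vre y + vim x ⬝ᵥ vim y := by
  simp [dotProduct, vre, vim, Finset.sum_add_distrib]

theorem star_dotProduct_comm (x y : a → ℂ) : star x ⬝ᵥ y = star (star y ⬝ᵥ x) := by
  simp [dotProduct, mul_comm]

theorem re_star_dotProduct_comm (x y : a → ℂ) : (star x ⬝ᵥ y).re = (star y ⬝ᵥ x).re := by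
  rw [re_star_dotProduct, re_star_dotProduct, dotProduct_comm, dotProduct_comm (vim x)]

theorem star_dotProduct_cx_mulVec (M : Matrix a b ℝ) (x : a → ℂ) (y : b → ℂ) :
    star x ⬝ᵥ (cx M *ᵥ y) = star (cx Mᵀ *ᵥ x) ⬝ᵥ y := by
  rw [star_mulVec, dotProduct_mulVec, cx_conjTranspose, transpose_transpose]

theorem star_dotProduct_self_re_nonneg (x : a → ℂ) : 0 ≤ (star x ⬝ᵥ x).re := by
  rw [re_star_dotProduct]
  exact add_nonneg (dotProduct_self_nonneg_real _) (dotProduct_self_nonneg_real _)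

theorem star_dotProduct_self_re_eq_zero {x : a → ℂ} (h : (star x ⬝ᵥ x).re = 0) : x = 0 := by
  rw [re_star_dotProduct] at h
  have h1 := dotProduct_self_nonneg_real (vre x)
  have h2 := dotProduct_self_nonneg_real (vim x)
  rw [vec_eq_zero_iff]
  exact ⟨dotProduct_self_eq_zero.1 (by linarith), dotProduct_self_eq_zero.1 (by linarith)⟩

theorem dotProduct_mulVec_transpose (M : Matrix a b ℝ) (x : a → ℝ) (y : b → ℝ) :
    x ⬝ᵥ (M *ᵥ y) = (Mᵀ *ᵥ x) ⬝ᵥ y := by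
  rw [dotProduct_mulVec, mulVec_transpose]

end Complexification

/-! ### Real quadratic forms and generalized inverses. -/

section RealForms

variable {a : Type*} [Fintype a]

theorem posSemidef_real_iff {M : Matrix a a ℝ} :
    M.PosSemidef ↔ Mᵀ = M ∧ ∀ x, 0 ≤ x ⬝ᵥ (M *ᵥ x) := by
  rw [posSemidef_iff_dotProduct_mulVec]
  simp [IsHermitian, conjTranspose_eq_transpose_of_trivial]

theorem posDef_real_iff {M : Matrix a a ℝ} :
    M.PosDef ↔ Mᵀ = M ∧ ∀ x, x ≠ 0 → 0 < x ⬝ᵥ (M *ᵥ x) := by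
  rw [posDef_iff_dotProduct_mulVec]
  simp [IsHermitian, conjTranspose_eq_transpose_of_trivial]

/-- Cauchy–Schwarz for a positive semidefinite form. -/
theorem PosSemidef_cauchy_schwarz {P : Matrix a a ℝ} (hP : P.PosSemidef) (x y : a → ℝ) :
    (x ⬝ᵥ (P *ᵥ y)) ^ 2 ≤ (x ⬝ᵥ (P *ᵥ x)) * (y ⬝ᵥ (P *ᵥ y)) := by
  obtain ⟨hs, hP⟩ := posSemidef_real_iff.1 hP
  have hxy : y ⬝ᵥ (P *ᵥ x) = x ⬝ᵥ (P *ᵥ y) := by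
    rw [dotProduct_mulVec_transpose, hs, dotProduct_comm]
  have key : ∀ t : ℝ, 0 ≤ (y ⬝ᵥ (P *ᵥ y)) * (t * t) + (2 * (x ⬝ᵥ (P *ᵥ y))) * t
      + x ⬝ᵥ (P *ᵥ x) := by
    intro t
    have := hP (x + t • y)
    simp only [mulVec_add, mulVec_smul, add_dotProduct, dotProduct_add, smul_dotProduct,
      dotProduct_smul, smul_eq_mul, hxy] at this
    linarith
  have := discrim_le_zero key
  rw [discrim] at this
  nlinarith

theorem PosSemidef_mulVec_eq_zero {P : Matrix a a ℝ} (hP : P.PosSemidef) {x : a → ℝ}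
    (h : x ⬝ᵥ (P *ᵥ x) = 0) : P *ᵥ x = 0 := by
  classical
  exact (hP.dotProduct_mulVec_zero_iff x).1 (by simpa using h)

/-- The quadratic form of a real matrix with nonpositive symmetric part has nonpositive real part
on complex vectors. -/
theorem re_form_nonpos {M : Matrix a a ℝ} (h : ∀ x : a → ℝ, x ⬝ᵥ (M *ᵥ x) ≤ 0) (x : a → ℂ) :
    (star x ⬝ᵥ (cx M *ᵥ x)).re ≤ 0 := by
  rw [re_star_dotProduct, vre_mulVec, vim_mulVec]
  linarith [h (vre x), h (vim x)]

/-- If a form vanishing nowhere positively attains zero, its symmetric part annihilates the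
vector. -/
theorem add_transpose_mulVec_eq_zero {M : Matrix a a ℝ}
    (h : ∀ x : a → ℝ, x ⬝ᵥ (M *ᵥ x) ≤ 0) {x : a → ℝ} (hx : x ⬝ᵥ (M *ᵥ x) = 0) :
    (M + Mᵀ) *ᵥ x = 0 := by
  have hpsd : (-(M + Mᵀ)).PosSemidef := by
    rw [posSemidef_real_iff]
    constructor
    · simp [add_comm]
    · intro y
      rw [neg_mulVec, add_mulVec, dotProduct_neg, dotProduct_add,
        dotProduct_mulVec_transpose Mᵀ, transpose_transpose, dotProduct_comm (M *ᵥ y)]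
      linarith [h y]
  have := PosSemidef_mulVec_eq_zero hpsd (x := x) (by
    rw [neg_mulVec, add_mulVec, dotProduct_neg, dotProduct_add,
        dotProduct_mulVec_transpose Mᵀ, transpose_transpose, dotProduct_comm (M *ᵥ x), hx]
    simp)
  rwa [neg_mulVec, neg_eq_zero] at this

/-- A real matrix has a generalized inverse. -/
theorem exists_generalized_inverse {b : Type*} [Fintype b] (P : Matrix a b ℝ) :
    ∃ Y : Matrix b a ℝ, P * Y * P = P := by
  classical
  obtain ⟨K', hK'⟩ := Submodule.exists_isCompl (LinearMap.range P.mulVecLin)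
  let r := P.mulVecLin.rangeRestrict
  obtain ⟨g, hg⟩ := r.exists_rightInverse_of_surjective (LinearMap.range_rangeRestrict _)
  let q : (a → ℝ) →ₗ[ℝ] (b → ℝ) := g ∘ₗ Submodule.projectionOnto _ _ hK'
  refine ⟨LinearMap.toMatrix' q, ?_⟩
  apply Matrix.mulVec_injective
  funext x
  rw [← mulVec_mulVec, ← mulVec_mulVec]
  have h1 : (LinearMap.toMatrix' q) *ᵥ (P *ᵥ x) = q (P *ᵥ x) := by
    rw [← Matrix.toLin'_apply, Matrix.toLin'_toMatrix']
  have h2 : q (P *ᵥ x) = g (r x) := by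
    simp only [q, LinearMap.comp_apply]
    congr 1
    have := Submodule.projectionOnto_apply_left hK' (r x)
    exact this
  rw [h1, h2]
  have := LinearMap.congr_fun hg (r x)
  exact congrArg Subtype.val this

end RealForms

/-! ### Spectra, powers of matrices and Lyapunov's theorem. -/

section Spectrum

variable {a : Type*} [Fintype a] [DecidableEq a]

theorem mem_spectrum_iff_exists_mulVec (M : Matrix a a ℂ) (z : ℂ) :
    z ∈ spectrum ℂ M ↔ ∃ x, x ≠ 0 ∧ M *ᵥ x = z • x := by
  rw [spectrum.mem_iff, Matrix.isUnit_iff_isUnit_det, isUnit_iff_ne_zero, not_not,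
    ← exists_mulVec_eq_zero_iff]
  refine exists_congr fun x => and_congr_right fun _ => ?_
  rw [sub_mulVec, Algebra.algebraMap_eq_smul_one, smul_mulVec, one_mulVec, sub_eq_zero, eq_comm]

theorem det_sub_ne_zero_of_no_eigenvector {M : Matrix a a ℂ} {z : ℂ}
    (h : ∀ x, M *ᵥ x = z • x → x = 0) : (z • (1 : Matrix a a ℂ) - M).det ≠ 0 := by
  intro h0
  obtain ⟨x, hx, h1⟩ := exists_mulVec_eq_zero_iff.2 h0
  apply hx
  apply h
  rw [sub_mulVec, smul_mulVec, one_mulVec, sub_eq_zero] at h1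
  exact h1.symm

theorem isHurwitz_iff (M : Matrix a a ℝ) :
    IsHurwitz M ↔ ∀ (z : ℂ) (x : a → ℂ), x ≠ 0 → cx M *ᵥ x = z • x → z.re < 0 := by
  unfold IsHurwitz
  constructor
  · intro h z x hx hz
    exact h z ((mem_spectrum_iff_exists_mulVec _ _).2 ⟨x, hx, hz⟩)
  · intro h z hz
    obtain ⟨x, hx, h1⟩ := (mem_spectrum_iff_exists_mulVec _ _).1 hz
    exact h z x hx h1

section Powers

attribute [local instance] Matrix.linftyOpNormedRing Matrix.linftyOpNormedAlgebra

/-- The powers of a complex matrix with spectrum in the open unit disc tend to zero. -/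
theorem tendsto_pow_zero_of_spectrum {M : Matrix a a ℂ}
    (h : ∀ z ∈ spectrum ℂ M, ‖z‖ < 1) : Tendsto (fun k => M ^ k) atTop (𝓝 0) := by
  cases isEmpty_or_nonempty a with
  | inl _ => exact tendsto_const_nhds.congr fun k => Subsingleton.elim _ _
  | inr _ =>
    have hr : spectralRadius ℂ M < ((1 : NNReal) : ENNReal) :=
      spectrum.spectralRadius_lt_of_forall_lt M (fun z hz => by
        have := h z hz
        rw [← NNReal.coe_lt_coe]; simpa using this)
    obtain ⟨r, hr1, hr2⟩ := ENNReal.lt_iff_exists_nnreal_btwn.1 hr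
    have hg := (spectrum.pow_nnnorm_pow_one_div_tendsto_nhds_spectralRadius M).eventually_lt_const hr1
    refine (tendsto_zero_iff_norm_tendsto_zero (E := Matrix a a ℂ)).2 ?_
    have hr3 : (r : ℝ) < 1 := by exact_mod_cast hr2
    refine squeeze_zero' (Eventually.of_forall fun _ => norm_nonneg _) ?_
      (tendsto_pow_atTop_nhds_zero_of_lt_one r.coe_nonneg hr3)
    filter_upwards [hg, eventually_gt_atTop 0] with k hk hk0
    have h1 : ((‖M ^ k‖₊ : ENNReal) ^ (1 / k : ℝ)) ^ k ≤ (r : ENNReal) ^ k := by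
      gcongr
    rw [← ENNReal.rpow_natCast, ← ENNReal.rpow_mul, one_div,
      inv_mul_cancel₀ (by exact_mod_cast hk0.ne'), ENNReal.rpow_one] at h1
    exact_mod_cast h1

end Powers

/-- Lyapunov: if `A` is Hurwitz and the symmetric form `P` does not increase along `A`,
then `P` is positive semidefinite. -/
theorem posSemidef_of_lyapunov {A P : Matrix a a ℝ} (hA : IsHurwitz A) (hP : Pᵀ = P)
    (h : ∀ x, (P *ᵥ x) ⬝ᵥ (A *ᵥ x) ≤ 0) : P.PosSemidef := by
  rw [isHurwitz_iff] at hA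
  have hdet : (1 - A).det ≠ 0 := by
    intro h0
    obtain ⟨x, hx, h1⟩ := exists_mulVec_eq_zero_iff.2 h0
    have h2 : cx A *ᵥ vcx x = (1 : ℂ) • vcx x := by
      rw [vcx_mulVec, one_smul]
      rw [sub_mulVec, one_mulVec, sub_eq_zero] at h1
      rw [← h1]
    have := hA 1 (vcx x) (fun hz => hx (by
      have := ((vec_eq_zero_iff _).1 hz).1
      ext i; simpa [vre, vcx] using congrFun this i)) h2
    norm_num at this
  set R : Matrix a a ℝ := (1 - A)⁻¹ with hR
  have hRl : (1 - A) * R = 1 := mul_nonsing_inv _ (isUnit_iff_ne_zero.2 hdet)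
  have hRr : R * (1 - A) = 1 := nonsing_inv_mul _ (isUnit_iff_ne_zero.2 hdet)
  -- The Cayley transform replaces the flow of `A` by a discrete iteration. With `x = (1 - A) y`,
  -- the form of `P` changes in one step by exactly `4 (P y) · (A y) ≤ 0`.
  set Z : Matrix a a ℝ := (1 + A) * R with hZ
  have hstep : ∀ x, (Z *ᵥ x) ⬝ᵥ (P *ᵥ (Z *ᵥ x)) ≤ x ⬝ᵥ (P *ᵥ x) := by
    intro x
    obtain ⟨y, rfl⟩ : ∃ y, x = (1 - A) *ᵥ y := ⟨R *ᵥ x, by rw [mulVec_mulVec, hRl, one_mulVec]⟩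
    have h1 : Z *ᵥ ((1 - A) *ᵥ y) = y + A *ᵥ y := by
      rw [mulVec_mulVec, hZ, Matrix.mul_assoc, hRr, Matrix.mul_one, add_mulVec, one_mulVec]
    rw [h1, sub_mulVec, one_mulVec]
    have h2 := h y
    have h3 : y ⬝ᵥ (P *ᵥ (A *ᵥ y)) = (P *ᵥ y) ⬝ᵥ (A *ᵥ y) := by
      rw [dotProduct_mulVec_transpose, hP]
    have h4 : (A *ᵥ y) ⬝ᵥ (P *ᵥ y) = (P *ᵥ y) ⬝ᵥ (A *ᵥ y) := dotProduct_comm _ _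
    simp only [mulVec_add, mulVec_sub, add_dotProduct, dotProduct_add, sub_dotProduct,
      dotProduct_sub, h3, h4]
    linarith
  have hpow : ∀ (k : ℕ) x, ((Z ^ k) *ᵥ x) ⬝ᵥ (P *ᵥ ((Z ^ k) *ᵥ x)) ≤ x ⬝ᵥ (P *ᵥ x) := by
    intro k
    induction k with
    | zero => intro x; simp
    | succ k ih =>
      intro x
      refine le_trans ?_ (ih x)
      have := hstep ((Z ^ k) *ᵥ x)
      rwa [mulVec_mulVec, ← pow_succ'] at this
  have hlim : Tendsto (fun k => cx Z ^ k) atTop (𝓝 0) := by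
    apply tendsto_pow_zero_of_spectrum
    intro z hz
    obtain ⟨x, hx, h1⟩ := (mem_spectrum_iff_exists_mulVec _ _).1 hz
    set y := cx R *ᵥ x with hy
    have hxy : x = y - cx A *ᵥ y := by
      have : x = cx (1 - A) *ᵥ y := by
        rw [hy, mulVec_mulVec, ← cx_mul, hRl, cx_one, one_mulVec]
      rw [this, cx_sub, cx_one, sub_mulVec, one_mulVec]
    have hzx : cx Z *ᵥ x = y + cx A *ᵥ y := by
      rw [hZ, cx_mul, ← mulVec_mulVec, ← hy, cx_add, cx_one, add_mulVec, one_mulVec]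
    have hy0 : y ≠ 0 := by
      rintro h0
      rw [h0] at hxy
      apply hx; rw [hxy]; simp
    have e1 : y + cx A *ᵥ y = z • (y - cx A *ᵥ y) := by rw [← hzx, h1, ← hxy]
    have e2 : (1 + z) • (cx A *ᵥ y) = (z - 1) • y := by
      rw [smul_sub] at e1
      rw [add_smul, sub_smul, one_smul, one_smul]
      linear_combination (exp := 1) e1
    have hz1 : 1 + z ≠ 0 := by
      intro h0
      have hz : z = -1 := by linear_combination h0
      rw [h0, zero_smul, hz] at e2
      have := smul_eq_zero.1 e2.symm
      rcases this with h | h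
      · norm_num at h
      · exact hy0 h
    -- The real part of `(z - 1) / (1 + z)` has the sign of `‖z‖² - 1`, so a Hurwitz `A` gives a `Z`
    -- with spectrum in the open unit disc.
    have e3 : cx A *ᵥ y = ((z - 1) / (1 + z)) • y := by
      rw [div_eq_inv_mul, mul_smul, ← e2, smul_smul, inv_mul_cancel₀ hz1, one_smul]
    have hre := hA _ _ hy0 e3
    rw [Complex.div_re, ← add_div, div_neg_iff] at hre
    rcases hre with hre | hre
    · exact absurd hre.2 (not_lt.2 (Complex.normSq_nonneg _))
    · have := hre.1
      have h2 : ‖z‖ ^ 2 < 1 := by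
        rw [Complex.sq_norm, Complex.normSq_apply]
        simp only [Complex.sub_re, Complex.one_re, Complex.add_re, Complex.sub_im, Complex.one_im,
          Complex.add_im] at this
        nlinarith
      nlinarith [norm_nonneg z]
  have hlimR : ∀ x, Tendsto (fun k => (Z ^ k) *ᵥ x) atTop (𝓝 0) := by
    intro x
    have hZk : Tendsto (fun k => Z ^ k) atTop (𝓝 0) := by
      refine tendsto_pi_nhds.2 fun i => tendsto_pi_nhds.2 fun j => ?_
      have := (tendsto_pi_nhds.1 (tendsto_pi_nhds.1 hlim i)) j
      have h2 := (Complex.continuous_re.tendsto _).comp this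
      refine h2.congr fun k => ?_
      rw [Function.comp, ← cx_pow, cx_apply, Complex.ofReal_re]
    have hc : Continuous fun W : Matrix a a ℝ => W *ᵥ x := by fun_prop
    have := (hc.tendsto 0).comp hZk
    rwa [zero_mulVec] at this
  rw [posSemidef_real_iff]
  refine ⟨hP, fun x => ?_⟩
  have hc : Continuous fun y : a → ℝ => y ⬝ᵥ (P *ᵥ y) := by fun_prop
  have := (hc.tendsto 0).comp (hlimR x)
  simp only [zero_dotProduct] at this
  exact le_of_tendsto this (Eventually.of_forall fun k => hpow k x)

end Spectrum

/-! ### Controllability and observability. -/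

section Controllability

variable {a b : Type*} [Fintype a] [DecidableEq a] [Fintype b]

/-- Kalman controllability of a real pair `(A, B)`. -/
def Controllable (A : Matrix a a ℝ) (B : Matrix a b ℝ) : Prop :=
  ∀ ξ : a → ℝ, (∀ k : ℕ, ξ ᵥ* (A ^ k * B) = 0) → ξ = 0

/-- Kalman observability of a real pair `(A, C)`. -/
def Observable (A : Matrix a a ℝ) (C : Matrix b a ℝ) : Prop :=
  ∀ x : a → ℝ, (∀ k : ℕ, (C * A ^ k) *ᵥ x = 0) → x = 0

theorem Observable.controllable_transpose {A : Matrix a a ℝ} {C : Matrix b a ℝ}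
    (h : Observable A C) : Controllable Aᵀ Cᵀ := by
  intro ξ hξ
  refine h ξ fun k => ?_
  rw [← hξ k, ← transpose_pow, ← transpose_mul, vecMul_transpose]

theorem Controllable.observable_of_transpose {A : Matrix a a ℝ} {C : Matrix b a ℝ}
    (h : Controllable Aᵀ Cᵀ) : Observable A C := by
  intro x hx
  refine h x fun k => ?_
  rw [← hx k, ← transpose_pow, ← transpose_mul, vecMul_transpose]

theorem Observable.eq_zero_of_eigenvector {A : Matrix a a ℝ} {C : Matrix b a ℝ}
    (h : Observable A C) {x : a → ℂ} {z : ℂ} (h1 : cx A *ᵥ x = z • x) (h2 : cx C *ᵥ x = 0) :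
    x = 0 := by
  have h3 : ∀ k : ℕ, cx (C * A ^ k) *ᵥ x = 0 := by
    intro k
    have : cx (A ^ k) *ᵥ x = z ^ k • x := by
      induction k with
      | zero => simp [cx_one]
      | succ k ih => rw [pow_succ, cx_mul, ← mulVec_mulVec, h1, mulVec_smul, ih, smul_smul, pow_succ']
    rw [cx_mul, ← mulVec_mulVec, this, mulVec_smul, h2, smul_zero]
  rw [vec_eq_zero_iff]
  refine ⟨h _ fun k => ?_, h _ fun k => ?_⟩
  · rw [← vre_mulVec, h3]; ext; simp [vre]
  · rw [← vim_mulVec, h3]; ext; simp [vim]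

/-- A real vector in the kernel of `C` whose image under `A` vanishes is zero. -/
theorem Observable.eq_zero_of_kernel {A : Matrix a a ℝ} {C : Matrix b a ℝ}
    (h : Observable A C) {x : a → ℝ} (h1 : A *ᵥ x = 0) (h2 : C *ᵥ x = 0) : x = 0 := by
  refine h x fun k => ?_
  rw [← mulVec_mulVec]
  cases k with
  | zero => simpa using h2
  | succ k => rw [pow_succ, ← mulVec_mulVec, h1]; simp

theorem Controllable.eq_zero_of_vecMul {A : Matrix a a ℝ} {B : Matrix a b ℝ}
    (h : Controllable A B) {ξ : a → ℝ} (h1 : ξ ᵥ* A = 0) (h2 : ξ ᵥ* B = 0) : ξ = 0 := by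
  refine h ξ fun k => ?_
  rw [← vecMul_vecMul]
  cases k with
  | zero => simpa using h2
  | succ k => rw [pow_succ', ← vecMul_vecMul, h1]; simp

/-- Every state is of the form `A z + B u`. -/
theorem Controllable.exists_eq_add {A : Matrix a a ℝ} {B : Matrix a b ℝ}
    (h : Controllable A B) (x : a → ℝ) : ∃ z u, x = A *ᵥ z + B *ᵥ u := by
  classical
  let V : Submodule ℝ (a → ℝ) := LinearMap.range A.mulVecLin ⊔ LinearMap.range B.mulVecLin
  have hV : V = ⊤ := by
    by_contra hne
    obtain ⟨f, hf0, hf⟩ := Submodule.exists_le_ker_of_lt_top V (lt_top_iff_ne_top.2 hne)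
    apply hf0
    let ξ : a → ℝ := fun i => f (Pi.single i 1)
    have hfξ : ∀ x, f x = ξ ⬝ᵥ x := by
      intro x
      conv_lhs => rw [pi_eq_sum_univ' x]
      simp [dotProduct, ξ, mul_comm]
    have hξ : ξ = 0 := by
      refine h.eq_zero_of_vecMul ?_ ?_
      · apply dotProduct_eq_zero_iff.1; intro w
        rw [← dotProduct_mulVec, ← hfξ]
        exact hf (Submodule.mem_sup_left ⟨w, rfl⟩)
      · apply dotProduct_eq_zero_iff.1; intro w
        rw [← dotProduct_mulVec, ← hfξ]
        exact hf (Submodule.mem_sup_right ⟨w, rfl⟩)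
    ext x
    simp [hfξ, hξ]
  have hx : x ∈ V := by rw [hV]; trivial
  obtain ⟨y, ⟨z, rfl⟩, w, ⟨u, rfl⟩, rfl⟩ := Submodule.mem_sup.1 hx
  exact ⟨z, u, rfl⟩

/-- An invariant subspace containing the range of `B` is everything. -/
theorem Controllable.eq_top {A : Matrix a a ℝ} {B : Matrix a b ℝ} (h : Controllable A B)
    {V : Submodule ℂ (a → ℂ)} (hB : ∀ u, cx B *ᵥ u ∈ V) (hA : ∀ x ∈ V, cx A *ᵥ x ∈ V) :
    V = ⊤ := by
  by_contra hne
  obtain ⟨f, hf0, hf⟩ := Submodule.exists_le_ker_of_lt_top V (lt_top_iff_ne_top.2 hne)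
  apply hf0
  let ξ : a → ℂ := fun i => f (Pi.single i 1)
  have hfξ : ∀ x, f x = ξ ⬝ᵥ x := by
    intro x
    conv_lhs => rw [pi_eq_sum_univ' x]
    simp [dotProduct, ξ, mul_comm]
  have hk : ∀ (k : ℕ) u, cx (A ^ k * B) *ᵥ u ∈ V := by
    intro k
    induction k with
    | zero => simpa using hB
    | succ k ih =>
      intro u
      rw [pow_succ', Matrix.mul_assoc, cx_mul, ← mulVec_mulVec]
      exact hA _ (ih u)
  have hz : ∀ k, ξ ᵥ* cx (A ^ k * B) = 0 := by
    intro k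
    apply dotProduct_eq_zero_iff.1; intro w
    rw [← dotProduct_mulVec, ← hfξ]
    exact hf (hk k w)
  have hξ : ξ = 0 := by
    rw [vec_eq_zero_iff]
    have hz' : ∀ k, cx (A ^ k * B)ᵀ *ᵥ ξ = 0 := fun k => by
      rw [cx_transpose, mulVec_transpose, hz]
    refine ⟨h _ fun k => ?_, h _ fun k => ?_⟩
    · rw [← mulVec_transpose, ← vre_mulVec, hz']; ext; simp [vre]
    · rw [← mulVec_transpose, ← vim_mulVec, hz']; ext; simp [vim]
  ext x
  simp [hfξ, hξ]

end Controllability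

/-! ### Minimal realizations and evaluation of transfer functions. -/

section Transfer

open Polynomial

variable {n m : ℕ}

theorem smul_one_sub_map_eq_charmatrix (A : Matrix (Fin n) (Fin n) ℝ) :
    (RatFunc.X : RatFunc ℝ) • (1 : Matrix (Fin n) (Fin n) (RatFunc ℝ)) - A.map RatFunc.C
      = (algebraMap ℝ[X] (RatFunc ℝ)).mapMatrix A.charmatrix := by
  ext i j
  simp only [RingHom.mapMatrix_apply, Matrix.map_apply, Matrix.sub_apply, Matrix.smul_apply,
    charmatrix_apply, map_sub, smul_eq_mul, RatFunc.algebraMap_C]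
  by_cases h : i = j
  · subst h; simp
  · simp [h]

theorem isUnit_det_smul_one_sub_map (A : Matrix (Fin n) (Fin n) ℝ) :
    IsUnit ((RatFunc.X : RatFunc ℝ) • (1 : Matrix (Fin n) (Fin n) (RatFunc ℝ))
      - A.map RatFunc.C).det := by
  rw [smul_one_sub_map_eq_charmatrix, ← RingHom.map_det, isUnit_iff_ne_zero]
  have : A.charmatrix.det = A.charpoly := rfl
  rw [this]
  exact (map_ne_zero_iff _ (RatFunc.algebraMap_injective ℝ)).2 A.charpoly_monic.ne_zero

/-- An intertwiner of the state matrices also intertwines the resolvents. It serves to compress a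
system to its reachable subspace. -/
theorem transfer_eq_of_intertwine {r : ℕ} (S : StateSpace n m) (S' : StateSpace r m)
    (T : Matrix (Fin n) (Fin r) ℝ) (hA : S.A * T = T * S'.A) (hB : S.B = T * S'.B)
    (hC : S'.C = S.C * T) (hD : S'.D = S.D) : S'.transfer = S.transfer := by
  have hu := isUnit_det_smul_one_sub_map S.A
  have hu' := isUnit_det_smul_one_sub_map S'.A
  unfold StateSpace.transfer
  rw [hD, hB, hC]
  congr 1
  set X1 := (RatFunc.X : RatFunc ℝ) • (1 : Matrix (Fin n) (Fin n) (RatFunc ℝ)) - S.A.map RatFunc.C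
    with hX1
  set X2 := (RatFunc.X : RatFunc ℝ) • (1 : Matrix (Fin r) (Fin r) (RatFunc ℝ)) - S'.A.map RatFunc.C
    with hX2
  have hcomm : X1 * T.map RatFunc.C = T.map RatFunc.C * X2 := by
    rw [hX1, hX2, Matrix.sub_mul, Matrix.mul_sub, ← Matrix.map_mul, ← Matrix.map_mul, hA]
    simp
  have hinv : T.map RatFunc.C * X2⁻¹ = X1⁻¹ * T.map RatFunc.C := by
    calc T.map RatFunc.C * X2⁻¹ = X1⁻¹ * (X1 * T.map RatFunc.C) * X2⁻¹ := by
          rw [← Matrix.mul_assoc, nonsing_inv_mul _ hu, Matrix.one_mul]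
      _ = X1⁻¹ * T.map RatFunc.C := by
          rw [hcomm, Matrix.mul_assoc, Matrix.mul_assoc, mul_nonsing_inv _ hu', Matrix.mul_one]
  rw [Matrix.map_mul, Matrix.map_mul, Matrix.mul_assoc (S.C.map _), hinv]
  simp only [Matrix.mul_assoc]

/-- The system with transposed data. -/
def StateSpace.transpose (S : StateSpace n m) : StateSpace n m :=
  ⟨S.Aᵀ, S.Cᵀ, S.Bᵀ, S.Dᵀ⟩

theorem transfer_transpose (S : StateSpace n m) : S.transpose.transfer = S.transferᵀ := by
  unfold StateSpace.transfer StateSpace.transpose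
  simp only [transpose_add, transpose_mul, transpose_nonsing_inv, transpose_sub, transpose_smul,
    transpose_one, transpose_map, Matrix.mul_assoc]

theorem IsMinimalRealization.transpose {S : StateSpace n m} {G : TransferMatrix m}
    (h : IsMinimalRealization S G) : IsMinimalRealization S.transpose Gᵀ := by
  refine ⟨by rw [transfer_transpose, h.1], fun n' S' hS' => h.2 n' S'.transpose ?_⟩
  rw [transfer_transpose, hS', transpose_transpose]

/-- The reachable subspace is `A`-invariant and contains the range of `B`. A nonzero `ξ` orthogonal
to it makes it proper, and restricting the system to it would realize `G` with fewer states. -/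
theorem IsMinimalRealization.controllable {S : StateSpace n m} {G : TransferMatrix m}
    (h : IsMinimalRealization S G) : Controllable S.A S.B := by
  intro ξ hξ
  by_contra hne
  let R : Submodule ℝ (Fin n → ℝ) := ⨆ k : ℕ, LinearMap.range (S.A ^ k * S.B).mulVecLin
  have hRA : ∀ x ∈ R, S.A *ᵥ x ∈ R := by
    intro x hx
    have : R ≤ R.comap S.A.mulVecLin := by
      refine iSup_le fun k => ?_
      rintro _ ⟨u, rfl⟩
      refine Submodule.mem_iSup_of_mem (k + 1) ⟨u, ?_⟩
      simp [pow_succ', Matrix.mul_assoc, mulVec_mulVec]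
    exact this hx
  have hRB : ∀ u, S.B *ᵥ u ∈ R := fun u => Submodule.mem_iSup_of_mem 0 ⟨u, by simp⟩
  have hlt : R < ⊤ := by
    rw [lt_top_iff_ne_top]
    intro htop
    have hle : R ≤ LinearMap.ker (dotProductBilin ℝ ℝ ξ) := by
      refine iSup_le fun k => ?_
      rintro _ ⟨u, rfl⟩
      have := congrArg (· ⬝ᵥ u) (hξ k)
      simpa [dotProduct_mulVec] using this
    have : ξ ∈ R := by rw [htop]; trivial
    have := hle this
    exact hne (dotProduct_self_eq_zero.1 this)
  have hfr := Submodule.finrank_lt hlt.ne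
  rw [Module.finrank_fin_fun] at hfr
  let bs := Module.finBasis ℝ R
  let T : Matrix (Fin n) (Fin (Module.finrank ℝ R)) ℝ := Matrix.of fun i j => (bs j : Fin n → ℝ) i
  have hT : ∀ x ∈ R, ∃ y, x = T *ᵥ y := by
    intro x hx
    refine ⟨bs.repr ⟨x, hx⟩, ?_⟩
    have := congrArg Subtype.val (bs.sum_repr ⟨x, hx⟩)
    ext i
    have h2 := congrFun this i
    simp only [Submodule.coe_sum, Submodule.coe_smul, Finset.sum_apply, Pi.smul_apply,
      smul_eq_mul] at h2
    rw [← h2]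
    simp [mulVec, dotProduct, T, mul_comm]
  have hTR : ∀ j, T.col j ∈ R := fun j => (bs j).2
  choose A' hA' using fun j => hT _ (hRA _ (hTR j))
  choose B' hB' using fun j => hT _ (hRB (Pi.single j 1))
  let S' : StateSpace (Module.finrank ℝ R) m :=
    ⟨Matrix.of fun i j => A' j i, Matrix.of fun i j => B' j i, S.C * T, S.D⟩
  have htr : S'.transfer = S.transfer := by
    refine transfer_eq_of_intertwine S S' T ?_ ?_ rfl rfl
    · ext i j
      exact congrFun (hA' j) i
    · ext i j
      have := congrFun (hB' j) i
      rw [mulVec_single_one] at this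
      exact this
  have := h.2 _ S' (htr.trans h.1)
  omega

theorem IsMinimalRealization.observable {S : StateSpace n m} {G : TransferMatrix m}
    (h : IsMinimalRealization S G) : Observable S.A S.C :=
  h.transpose.controllable.observable_of_transpose

/-- `RatFunc.eval` uses the reduced fraction. The reduced denominator divides `q`, so any fraction
with nonvanishing denominator at `z` gives the same value. -/
theorem ratFunc_eval_div {L : Type} [Field L] (φ : ℝ →+* L) (z : L) (p q : ℝ[X])
    (hq : q.eval₂ φ z ≠ 0) :
    RatFunc.eval φ z (algebraMap ℝ[X] (RatFunc ℝ) p / algebraMap ℝ[X] (RatFunc ℝ) q)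
      = p.eval₂ φ z / q.eval₂ φ z ∧
    (algebraMap ℝ[X] (RatFunc ℝ) p / algebraMap ℝ[X] (RatFunc ℝ) q).denom.eval₂ φ z ≠ 0 := by
  set f := algebraMap ℝ[X] (RatFunc ℝ) p / algebraMap ℝ[X] (RatFunc ℝ) q with hf
  have hq0 : q ≠ 0 := by rintro rfl; simp at hq
  have hd : f.denom.eval₂ φ z ≠ 0 := fun h0 =>
    hq (eval₂_eq_zero_of_dvd_of_eval₂_eq_zero φ z (RatFunc.denom_div_dvd p q) h0)
  refine ⟨?_, hd⟩
  have h1 : f.num * q = p * f.denom := by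
    apply RatFunc.algebraMap_injective ℝ
    have := RatFunc.num_div_denom f
    rw [hf, div_eq_div_iff (by simpa using RatFunc.denom_ne_zero _) (by simpa using hq0), ← hf]
      at this
    simpa using this
  rw [RatFunc.eval, div_eq_div_iff hd hq, ← eval₂_mul, ← eval₂_mul, h1]

/-- Evaluation of a transfer function away from the eigenvalues of the state matrix. -/
theorem transfer_eval {L : Type} [Field L] (S : StateSpace n m) (φ : ℝ →+* L) (z : L)
    (hz : (z • (1 : Matrix (Fin n) (Fin n) L) - S.A.map φ).det ≠ 0) :
    S.transfer.map (RatFunc.eval φ z) =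
      S.C.map φ * (z • (1 : Matrix (Fin n) (Fin n) L) - S.A.map φ)⁻¹ * S.B.map φ + S.D.map φ ∧
    ∀ i j, (S.transfer i j).denom.eval₂ φ z ≠ 0 := by
  set χ := S.A.charpoly with hχ
  -- Cramer's rule: all entries over the common denominator `χ`, in general not in lowest terms.
  let N : Matrix (Fin m) (Fin m) ℝ[X] :=
    S.C.map C * S.A.charmatrix.adjugate * S.B.map C + χ • S.D.map C
  have hev : (eval₂RingHom φ z).mapMatrix S.A.charmatrix
      = z • (1 : Matrix (Fin n) (Fin n) L) - S.A.map φ := by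
    ext i j
    simp only [RingHom.mapMatrix_apply, Matrix.map_apply, Matrix.sub_apply, Matrix.smul_apply,
      charmatrix_apply, map_sub, smul_eq_mul]
    by_cases h : i = j
    · subst h; simp
    · simp [h]
  have hχz : χ.eval₂ φ z = (z • (1 : Matrix (Fin n) (Fin n) L) - S.A.map φ).det := by
    rw [← hev, ← RingHom.map_det]; rfl
  have htr : S.transfer = N.map fun p => algebraMap ℝ[X] (RatFunc ℝ) p / algebraMap _ _ χ := by
    have hdet : algebraMap ℝ[X] (RatFunc ℝ) χ ≠ 0 :=
      (map_ne_zero_iff _ (RatFunc.algebraMap_injective ℝ)).2 S.A.charpoly_monic.ne_zero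
    have hC : ∀ {p q : ℕ} (M : Matrix (Fin p) (Fin q) ℝ),
        M.map (RatFunc.C (K := ℝ)) = (M.map C).map (algebraMap ℝ[X] (RatFunc ℝ)) := by
      intro p q M; ext; simp [RatFunc.algebraMap_C]
    have h1 : N.map (fun p => algebraMap ℝ[X] (RatFunc ℝ) p / algebraMap _ _ χ)
        = (algebraMap ℝ[X] (RatFunc ℝ) χ)⁻¹ • N.map (algebraMap ℝ[X] (RatFunc ℝ)) := by
      ext i j; simp [div_eq_inv_mul]
    rw [h1]
    unfold StateSpace.transfer
    rw [smul_one_sub_map_eq_charmatrix, inv_def, ← RingHom.map_adjugate, ← RingHom.map_det,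
      Ring.inverse_eq_inv', hC, hC, hC]
    have h2 : N.map (algebraMap ℝ[X] (RatFunc ℝ)) =
      (S.C.map C).map (algebraMap ℝ[X] (RatFunc ℝ)) *
        S.A.charmatrix.adjugate.map (algebraMap ℝ[X] (RatFunc ℝ)) *
        (S.B.map C).map (algebraMap ℝ[X] (RatFunc ℝ))
        + algebraMap ℝ[X] (RatFunc ℝ) χ • (S.D.map C).map (algebraMap ℝ[X] (RatFunc ℝ)) := by
      rw [← Matrix.map_mul, ← Matrix.map_mul]
      ext i j; simp only [N, Matrix.map_apply, Matrix.add_apply, Matrix.smul_apply, map_add,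
        smul_eq_mul, map_mul]
    rw [h2, smul_add, smul_smul, inv_mul_cancel₀ hdet, one_smul, Matrix.mul_smul, Matrix.smul_mul]
    rfl
  have hentry : ∀ i j, S.transfer i j = algebraMap ℝ[X] (RatFunc ℝ) (N i j) / algebraMap _ _ χ :=
    fun i j => by rw [htr]; rfl
  have hq : χ.eval₂ φ z ≠ 0 := by rwa [hχz]
  refine ⟨?_, fun i j => by rw [hentry]; exact (ratFunc_eval_div φ z _ _ hq).2⟩
  have h3 : S.transfer.map (RatFunc.eval φ z)
      = (χ.eval₂ φ z)⁻¹ • N.map (eval₂RingHom φ z) := by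
    ext i j
    rw [Matrix.map_apply, hentry, (ratFunc_eval_div φ z _ _ hq).1]
    simp [div_eq_inv_mul]
  have hC : ∀ {p q : ℕ} (M : Matrix (Fin p) (Fin q) ℝ),
      (M.map C).map (eval₂RingHom φ z) = M.map φ := by
    intro p q M; ext; simp
  have h2 : N.map (eval₂RingHom φ z) =
      S.C.map φ * (z • (1 : Matrix (Fin n) (Fin n) L) - S.A.map φ).adjugate * S.B.map φ
        + χ.eval₂ φ z • S.D.map φ := by
    rw [← hev, ← RingHom.map_adjugate, ← hC, ← hC, ← hC, RingHom.mapMatrix_apply,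
      ← Matrix.map_mul, ← Matrix.map_mul]
    ext i j; simp [N]
  rw [h3, h2, smul_add, smul_smul, inv_mul_cancel₀ hq, one_smul, inv_def, Ring.inverse_eq_inv',
    hχz, Matrix.mul_smul, Matrix.smul_mul]

theorem at_eq {S : StateSpace n m} {G : TransferMatrix m} (h : S.transfer = G) {s : ℂ}
    (hs : (s • (1 : Matrix (Fin n) (Fin n) ℂ) - cx S.A).det ≠ 0) :
    G.at s = cx S.C * (s • (1 : Matrix (Fin n) (Fin n) ℂ) - cx S.A)⁻¹ * cx S.B + cx S.D := by
  subst h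
  exact (transfer_eval S (algebraMap ℝ ℂ) s hs).1

theorem not_isPole_of_det_ne_zero {S : StateSpace n m} {G : TransferMatrix m}
    (h : S.transfer = G) {s : ℂ}
    (hs : (s • (1 : Matrix (Fin n) (Fin n) ℂ) - cx S.A).det ≠ 0) : ¬ IsPole G s := by
  subst h
  rintro ⟨i, j, hij⟩
  exact (transfer_eval S (algebraMap ℝ ℂ) s hs).2 i j hij

end Transfer

/-! ### The resolvent: behaviour at infinity and order of its poles. -/

section Resolvent

open Asymptotics

variable {a b c : Type*} [Fintype a] [DecidableEq a] [Fintype b] [Fintype c]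

/-- The resolvent `(sI - A)⁻¹` of a real matrix. -/
noncomputable def res (A : Matrix a a ℝ) (s : ℂ) : Matrix a a ℂ := (s • (1 : Matrix a a ℂ) - cx A)⁻¹

/-- `s` is not an eigenvalue of `A`. -/
def IsReg (A : Matrix a a ℝ) (s : ℂ) : Prop := (s • (1 : Matrix a a ℂ) - cx A).det ≠ 0

variable {A : Matrix a a ℝ}

theorem res_mulVec_eq {s : ℂ} (hs : IsReg A s) (x : a → ℂ) :
    res A s *ᵥ (s • x - cx A *ᵥ x) = x := by
  have : s • x - cx A *ᵥ x = (s • (1 : Matrix a a ℂ) - cx A) *ᵥ x := by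
    rw [sub_mulVec, smul_mulVec, one_mulVec]
  rw [this, mulVec_mulVec, res, nonsing_inv_mul _ (isUnit_iff_ne_zero.2 hs), one_mulVec]

theorem res_mulVec_cx {s : ℂ} (hs : IsReg A s) (x : a → ℂ) :
    res A s *ᵥ (cx A *ᵥ x) = s • (res A s *ᵥ x) - x := by
  have := res_mulVec_eq hs x
  rw [mulVec_sub, mulVec_smul] at this
  rw [sub_eq_iff_eq_add] at this
  rw [this]
  abel

theorem cx_mulVec_res {s : ℂ} (hs : IsReg A s) (x : a → ℂ) :
    cx A *ᵥ (res A s *ᵥ x) = s • (res A s *ᵥ x) - x := by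
  have h : (s • (1 : Matrix a a ℂ) - cx A) *ᵥ (res A s *ᵥ x) = x := by
    rw [mulVec_mulVec, res, mul_nonsing_inv _ (isUnit_iff_ne_zero.2 hs), one_mulVec]
  rw [sub_mulVec, smul_mulVec, one_mulVec] at h
  nth_rewrite 3 [← h]
  abel

theorem eq_res_mulVec {s : ℂ} (hs : IsReg A s) {x y : a → ℂ} (h : s • x = cx A *ᵥ x + y) :
    x = res A s *ᵥ y := by
  rw [← res_mulVec_eq hs x, h, add_sub_cancel_left]

theorem isReg_of_no_eigenvector {s : ℂ} (h : ∀ x, cx A *ᵥ x = s • x → x = 0) : IsReg A s :=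
  det_sub_ne_zero_of_no_eigenvector h

theorem finite_not_isReg (A : Matrix a a ℝ) : {s : ℂ | ¬ IsReg A s}.Finite := by
  have : {s : ℂ | ¬ IsReg A s} = {s : ℂ | (cx A).charpoly.IsRoot s} := by
    ext s
    simp only [Set.mem_ofPred_eq, IsReg, not_not, Polynomial.IsRoot, Matrix.eval_charpoly]
    rw [scalar_apply, ← Matrix.smul_one_eq_diagonal]
  rw [this]
  exact Polynomial.finite_setOfPred_isRoot (cx A).charpoly_monic.ne_zero

theorem eventually_isReg_nhdsNE (A : Matrix a a ℝ) (p : ℂ) : ∀ᶠ s in 𝓝[≠] p, IsReg A s := by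
  have h : ({s : ℂ | ¬ IsReg A s} \ {p}).Finite := (finite_not_isReg A).sdiff
  have h1 : ({s : ℂ | ¬ IsReg A s} \ {p})ᶜ ∈ 𝓝 p := h.isClosed.isOpen_compl.mem_nhds (by simp)
  filter_upwards [mem_nhdsWithin_of_mem_nhds h1, self_mem_nhdsWithin] with s hs hs'
  by_contra hc
  exact hs ⟨hc, hs'⟩

theorem eventually_isReg_cobounded (A : Matrix a a ℝ) :
    ∀ᶠ s in Bornology.cobounded ℂ, IsReg A s := by
  have := (finite_not_isReg A).isBounded
  filter_upwards [Bornology.isBounded_def.1 this] with s hs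
  by_contra hc
  exact hs hc

theorem exists_mulVec_bound (M : Matrix b c ℂ) : ∃ K, 0 ≤ K ∧ ∀ x, ‖M *ᵥ x‖ ≤ K * ‖x‖ := by
  let f := LinearMap.toContinuousLinearMap M.mulVecLin
  exact ⟨‖f‖, norm_nonneg _, fun x => f.le_opNorm x⟩

/-- With `y = (s - A)⁻¹ x`, the relation `s y = A y + x` gives `‖y‖ ≤ ‖x‖ / (‖s‖ - K)`. -/
theorem tendsto_res_mulVec_cobounded (A : Matrix a a ℝ) (x : a → ℂ) :
    Tendsto (fun s => res A s *ᵥ x) (Bornology.cobounded ℂ) (𝓝 0) := by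
  obtain ⟨K, hK0, hK⟩ := exists_mulVec_bound (cx A)
  have h1 : Tendsto (fun s : ℂ => ‖x‖ / (‖s‖ - K)) (Bornology.cobounded ℂ) (𝓝 0) :=
    Tendsto.div_atTop tendsto_const_nhds
      (tendsto_atTop_add_const_right _ (-K) tendsto_norm_cobounded_atTop)
  refine squeeze_zero_norm' ?_ h1
  filter_upwards [eventually_isReg_cobounded A,
    tendsto_norm_cobounded_atTop.eventually_gt_atTop K] with s hs hsK
  set y := res A s *ᵥ x with hy
  have h2 : s • y = cx A *ᵥ y + x := by rw [hy, cx_mulVec_res hs]; abel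
  have h3 : ‖s‖ * ‖y‖ ≤ K * ‖y‖ + ‖x‖ := by
    rw [← norm_smul, h2]
    exact (norm_add_le _ _).trans (by gcongr; exact hK y)
  rw [le_div_iff₀ (by linarith)]
  linarith

theorem isBigO_mulVec {l : Filter ℂ} {f : ℂ → c → ℂ} (M : Matrix b c ℂ)
    (h : f =O[l] (1 : ℂ → ℝ)) : (fun s => M *ᵥ f s) =O[l] (1 : ℂ → ℝ) := by
  obtain ⟨K, hK0, hK⟩ := exists_mulVec_bound M
  exact (IsBigO.of_bound K (Eventually.of_forall fun s => hK (f s))).trans h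

theorem isBigO_one_of_tendsto {E : Type*} [NormedAddCommGroup E] {l : Filter ℂ} {f : ℂ → E} {y : E}
    (h : Tendsto f l (𝓝 y)) : f =O[l] (1 : ℂ → ℝ) :=
  h.isBigO_one ℝ

theorem isBigO_smul_nhdsNE {E : Type*} [NormedAddCommGroup E] [NormedSpace ℂ E] {p : ℂ}
    {f : ℂ → E} {g : ℂ → ℂ} (hg : ContinuousAt g p) (h : f =O[𝓝[≠] p] (1 : ℂ → ℝ)) :
    (fun s => g s • f s) =O[𝓝[≠] p] (1 : ℂ → ℝ) := by
  have := ((hg.tendsto.mono_left nhdsWithin_le_nhds).isBigO_one ℝ).smul h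
  exact this.congr (fun _ => rfl) (fun _ => by simp)

/-- If `f` is bounded near `p` and `g` vanishes at `p`, then `g • f → 0`. -/
theorem tendsto_smul_zero_of_isBigO {E : Type*} [NormedAddCommGroup E] [NormedSpace ℂ E] {p : ℂ}
    {f : ℂ → E} {g : ℂ → ℂ} (hg : ContinuousAt g p) (hg0 : g p = 0)
    (h : f =O[𝓝[≠] p] (1 : ℂ → ℝ)) : Tendsto (fun s => g s • f s) (𝓝[≠] p) (𝓝 0) := by
  have h1 : Tendsto g (𝓝[≠] p) (𝓝 0) := by
    have := hg.tendsto.mono_left (nhdsWithin_le_nhds (s := {p}ᶜ)); rwa [hg0] at this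
  have h2 : g =o[𝓝[≠] p] (1 : ℂ → ℝ) := (isLittleO_one_iff ℝ).2 h1
  have := h2.smul_isBigO h
  rw [← isLittleO_one_iff ℝ]
  simpa using this

/-- For a controllable and observable system, the resolvent has at `p` a pole of order at most that
of the transfer function. -/
theorem isBigO_res_mulVec {B : Matrix a b ℝ} {C : Matrix c a ℝ} (hB : Controllable A B)
    (hC : Observable A C) (k : ℕ) (p : ℂ)
    (h : ∀ u, (fun s : ℂ => (s - p) ^ k • (cx C *ᵥ (res A s *ᵥ (cx B *ᵥ u))))
      =O[𝓝[≠] p] (1 : ℂ → ℝ)) (x : a → ℂ) :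
    (fun s : ℂ => (s - p) ^ k • (res A s *ᵥ x)) =O[𝓝[≠] p] (1 : ℂ → ℝ) := by
  have hconst : ∀ {d : Type _} [Fintype d] (v : d → ℂ),
      (fun s : ℂ => (s - p) ^ k • v) =O[𝓝[≠] p] (1 : ℂ → ℝ) := fun v =>
    isBigO_smul_nhdsNE (by fun_prop) (isBigO_one_of_tendsto tendsto_const_nhds)
  -- The states whose output response has a pole of order at most `k`. They contain the range of
  -- `B`, and `(s - A)⁻¹ A x = s (s - A)⁻¹ x - x` makes them `A`-invariant, so by controllability
  -- they are all states.
  let V : Submodule ℂ (a → ℂ) :=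
    { carrier := {x | (fun s : ℂ => (s - p) ^ k • (cx C *ᵥ (res A s *ᵥ x)))
        =O[𝓝[≠] p] (1 : ℂ → ℝ)}
      add_mem' := fun {x y} hx hy => by
        simp only [Set.mem_ofPred_eq, mulVec_add, smul_add] at *
        exact hx.add hy
      zero_mem' := by
        simp only [Set.mem_ofPred_eq, mulVec_zero, smul_zero]
        exact isBigO_zero _ _
      smul_mem' := fun r x hx => by
        simp only [Set.mem_ofPred_eq, mulVec_smul] at *
        simp_rw [smul_comm _ r]
        exact hx.const_smul_left r }
  have hV : V = ⊤ := by
    refine hB.eq_top (fun u => h u) fun x hx => ?_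
    have h1 : (fun s : ℂ => s • ((s - p) ^ k • (cx C *ᵥ (res A s *ᵥ x))) - (s - p) ^ k • (cx C *ᵥ x))
        =O[𝓝[≠] p] (1 : ℂ → ℝ) :=
      (isBigO_smul_nhdsNE (g := fun s => s) (by fun_prop) hx).sub (hconst _)
    refine h1.congr' ?_ EventuallyEq.rfl
    filter_upwards [eventually_isReg_nhdsNE A p] with s hs
    rw [res_mulVec_cx hs, mulVec_sub, mulVec_smul, smul_sub, smul_comm s]
  have hx : x ∈ V := by rw [hV]; trivial
  -- The dual step: the covectors seeing a pole of order at most `k` contain the rows of `C` and are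
  -- `Aᵀ`-invariant.
  let W : Submodule ℂ (a → ℂ) :=
    { carrier := {ξ | (fun s : ℂ => (s - p) ^ k • (ξ ⬝ᵥ (res A s *ᵥ x)))
        =O[𝓝[≠] p] (1 : ℂ → ℝ)}
      add_mem' := fun {ξ η} hx hy => by
        simp only [Set.mem_ofPred_eq, add_dotProduct, smul_add] at *
        exact hx.add hy
      zero_mem' := by
        simp only [Set.mem_ofPred_eq, zero_dotProduct, smul_zero]
        exact isBigO_zero _ _
      smul_mem' := fun r x hx => by
        simp only [Set.mem_ofPred_eq, smul_dotProduct] at *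
        simp_rw [smul_comm _ r]
        exact hx.const_smul_left r }
  have hW : W = ⊤ := by
    refine hC.controllable_transpose.eq_top (fun u => ?_) fun ξ hξ => ?_
    · have h1 : (fun s : ℂ => u ⬝ᵥ ((s - p) ^ k • (cx C *ᵥ (res A s *ᵥ x))))
          =O[𝓝[≠] p] (1 : ℂ → ℝ) := by
        have := isBigO_mulVec (replicateRow Unit u) hx
        refine IsBigO.trans (IsBigO.of_bound 1 (Eventually.of_forall fun s => ?_)) this
        rw [one_mul]
        exact norm_le_pi_norm (replicateRow Unit u *ᵥ _) ()
      refine h1.congr (fun s => ?_) fun _ => rfl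
      rw [dotProduct_smul, dotProduct_mulVec, cx_transpose, mulVec_transpose]
    · have h1 : (fun s : ℂ => s • ((s - p) ^ k • (ξ ⬝ᵥ (res A s *ᵥ x))) - (s - p) ^ k • (ξ ⬝ᵥ x))
        =O[𝓝[≠] p] (1 : ℂ → ℝ) :=
        (isBigO_smul_nhdsNE (g := fun s => s) (by fun_prop) hξ).sub
          (isBigO_smul_nhdsNE (by fun_prop) (isBigO_one_of_tendsto tendsto_const_nhds))
      refine h1.congr' ?_ EventuallyEq.rfl
      filter_upwards [eventually_isReg_nhdsNE A p] with s hs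
      rw [cx_transpose, mulVec_transpose, ← dotProduct_mulVec, cx_mulVec_res hs, dotProduct_sub,
        dotProduct_smul, smul_sub, smul_comm s]
  rw [isBigO_pi]
  intro i
  have hi : Pi.single i (1 : ℂ) ∈ W := by rw [hW]; trivial
  refine IsBigO.congr hi (fun s => ?_) fun _ => rfl
  simp

end Resolvent

/-! ### Poles of a minimal realization, feedthrough and DC gain. -/

section Minimal

open Asymptotics

variable {n m : ℕ} {S : StateSpace n m} {G : TransferMatrix m}

theorem at_mulVec (h : S.transfer = G) {s : ℂ} (hs : IsReg S.A s) (u : Fin m → ℂ) :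
    G.at s *ᵥ u = cx S.C *ᵥ (res S.A s *ᵥ (cx S.B *ᵥ u)) + cx S.D *ᵥ u := by
  rw [at_eq h hs, add_mulVec, ← mulVec_mulVec, ← mulVec_mulVec, res]

theorem continuousAt_at {z : ℂ} (hz : ¬ IsPole G z) : ContinuousAt (fun s => G.at s) z := by
  refine continuousAt_pi.2 fun i => continuousAt_pi.2 fun j => ?_
  have hd : (G i j).denom.eval₂ (algebraMap ℝ ℂ) z ≠ 0 := fun h0 => hz ⟨i, j, h0⟩
  change ContinuousAt (fun s => (G i j).num.eval₂ (algebraMap ℝ ℂ) s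
    / (G i j).denom.eval₂ (algebraMap ℝ ℂ) s) z
  exact ((G i j).num.continuous_eval₂ _).continuousAt.div
    ((G i j).denom.continuous_eval₂ _).continuousAt hd

theorem isBigO_res_of_isBigO_at (h : IsMinimalRealization S G) (k : ℕ) (p : ℂ)
    (hG : ∀ u, (fun s : ℂ => (s - p) ^ k • (G.at s *ᵥ u)) =O[𝓝[≠] p] (1 : ℂ → ℝ))
    (x : Fin n → ℂ) :
    (fun s : ℂ => (s - p) ^ k • (res S.A s *ᵥ x)) =O[𝓝[≠] p] (1 : ℂ → ℝ) := by
  refine isBigO_res_mulVec h.controllable h.observable k p (fun u => ?_) x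
  have h1 : (fun s : ℂ => (s - p) ^ k • (cx S.D *ᵥ u)) =O[𝓝[≠] p] (1 : ℂ → ℝ) :=
    isBigO_smul_nhdsNE (by fun_prop) (isBigO_one_of_tendsto tendsto_const_nhds)
  refine ((hG u).sub h1).congr' ?_ EventuallyEq.rfl
  filter_upwards [eventually_isReg_nhdsNE S.A p] with s hs
  rw [at_mulVec h.1 hs, ← smul_sub, add_sub_cancel_right]

/-- No pole–zero cancellation: away from poles the resolvent stays bounded. On an eigenvector `x`
for `z`, however, `(s - z) (s - A)⁻¹ x = x` for all regular `s`, and the left side would tend to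
zero. -/
theorem isReg_of_not_isPole (h : IsMinimalRealization S G) {z : ℂ} (hz : ¬ IsPole G z) :
    IsReg S.A z := by
  refine isReg_of_no_eigenvector fun x hx => ?_
  have hb : (fun s : ℂ => (s - z) ^ 0 • (res S.A s *ᵥ x)) =O[𝓝[≠] z] (1 : ℂ → ℝ) := by
    refine isBigO_res_of_isBigO_at h 0 z (fun u => ?_) x
    have h1 : ContinuousAt (fun s => G.at s *ᵥ u) z :=
      (Continuous.continuousAt (f := fun M : Matrix (Fin m) (Fin m) ℂ => M *ᵥ u)
        (by fun_prop)).comp (continuousAt_at hz)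
    simp only [pow_zero, one_smul]
    exact isBigO_one_of_tendsto (h1.tendsto.mono_left nhdsWithin_le_nhds)
  simp only [pow_zero, one_smul] at hb
  have h2 : Tendsto (fun s => (s - z) • (res S.A s *ᵥ x)) (𝓝[≠] z) (𝓝 0) :=
    tendsto_smul_zero_of_isBigO (g := fun s => s - z) (by fun_prop) (sub_self z) hb
  have h3 : Tendsto (fun s => (s - z) • (res S.A s *ᵥ x)) (𝓝[≠] z) (𝓝 x) := by
    refine tendsto_const_nhds.congr' ?_
    filter_upwards [eventually_isReg_nhdsNE S.A z] with s hs
    have := res_mulVec_eq hs x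
    rw [hx, ← sub_smul, mulVec_smul] at this
    exact this.symm
  exact tendsto_nhds_unique h3 h2

/-- A vector limit of `G(s) u` at infinity is `D u`. -/
theorem tendsto_at_mulVec_cobounded (h : S.transfer = G) (u : Fin m → ℂ) :
    Tendsto (fun s => G.at s *ᵥ u) (Bornology.cobounded ℂ) (𝓝 (cx S.D *ᵥ u)) := by
  have h1 := tendsto_res_mulVec_cobounded S.A (cx S.B *ᵥ u)
  have h2 : Tendsto (fun s => cx S.C *ᵥ (res S.A s *ᵥ (cx S.B *ᵥ u)) + cx S.D *ᵥ u)
      (Bornology.cobounded ℂ) (𝓝 (cx S.C *ᵥ 0 + cx S.D *ᵥ u)) :=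
    (((Continuous.tendsto (f := fun v => cx S.C *ᵥ v) (by fun_prop) 0).comp h1)).add_const _
  rw [mulVec_zero, zero_add] at h2
  refine h2.congr' ?_
  filter_upwards [eventually_isReg_cobounded S.A] with s hs
  rw [at_mulVec h hs]

theorem D_eq_zero (h : S.transfer = G) (hG : IsStrictlyProper G) : S.D = 0 := by
  apply cx_injective
  apply Matrix.mulVec_injective
  funext u
  have h1 := tendsto_at_mulVec_cobounded h u
  have h2 : Tendsto (fun s => G.at s *ᵥ u) (Bornology.cobounded ℂ) (𝓝 (0 *ᵥ u)) :=
    (Continuous.tendsto (f := fun M : Matrix (Fin m) (Fin m) ℂ => M *ᵥ u) (by fun_prop) 0).comp hG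
  rw [cx_zero]
  exact tendsto_nhds_unique h1 h2

theorem dcGain_eq (h : S.transfer = G) (hA : S.A.det ≠ 0) :
    dcGain G = S.D - S.C * S.A⁻¹ * S.B := by
  have hm : ∀ {p q : ℕ} (M : Matrix (Fin p) (Fin q) ℝ), M.map (RingHom.id ℝ) = M := fun M => by
    ext; simp
  have hneg : (-S.A)⁻¹ = -S.A⁻¹ := by
    apply Matrix.inv_eq_left_inv
    rw [neg_mul_neg, nonsing_inv_mul _ (isUnit_iff_ne_zero.2 hA)]
  have hz : ((0 : ℝ) • (1 : Matrix (Fin n) (Fin n) ℝ) - S.A.map (RingHom.id ℝ)).det ≠ 0 := by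
    rw [hm, zero_smul, zero_sub, det_neg]
    exact mul_ne_zero (pow_ne_zero _ (by norm_num)) hA
  have := (transfer_eval S (RingHom.id ℝ) 0 hz).1
  rw [hm, hm, hm, hm, zero_smul, zero_sub, hneg, h] at this
  rw [dcGain, this]
  simp only [Matrix.mul_neg, Matrix.neg_mul]
  abel

end Minimal

/-! ### Convex separation and diagonalization tools. -/

/-- Weak separation of the origin from a convex set in finite dimension. -/
theorem exists_nonzero_nonpos_on {E : Type*} [NormedAddCommGroup E] [NormedSpace ℝ E]
    [FiniteDimensional ℝ E] {s : Set E} (hs : Convex ℝ s) (hne : s.Nonempty) (h0 : (0 : E) ∉ s) :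
    ∃ f : E →ₗ[ℝ] ℝ, f ≠ 0 ∧ ∀ x ∈ s, f x ≤ 0 := by
  by_cases hint : (interior s).Nonempty
  · obtain ⟨f, hf, hfs⟩ := geometric_hahn_banach_of_nonempty_interior_point hs
      (fun h => h0 (interior_subset h)) hint
    refine ⟨f.toLinearMap, fun h => hf ?_, fun x hx => ?_⟩
    · ext x; exact LinearMap.congr_fun h x
    · simpa using hfs x hx
  · rw [hs.interior_nonempty_iff_affineSpan_eq_top] at hint
    obtain ⟨x0, hx0⟩ := hne
    have hdir : (affineSpan ℝ s).direction ≠ ⊤ := by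
      rwa [Ne, AffineSubspace.direction_eq_top_iff_of_nonempty ⟨x0, subset_affineSpan ℝ s hx0⟩]
    obtain ⟨f, hf0, hf⟩ := Submodule.exists_le_ker_of_lt_top _ (lt_top_iff_ne_top.2 hdir)
    have hconst : ∀ x ∈ s, f x = f x0 := by
      intro x hx
      have := hf (AffineSubspace.vsub_mem_direction (subset_affineSpan ℝ s hx)
        (subset_affineSpan ℝ s hx0))
      rw [LinearMap.mem_ker, vsub_eq_sub, map_sub] at this
      linarith
    rcases le_total (f x0) 0 with h | h
    · exact ⟨f, hf0, fun x hx => by rw [hconst x hx]; exact h⟩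
    · exact ⟨-f, neg_ne_zero.2 hf0, fun x hx => by
        rw [LinearMap.neg_apply, hconst x hx]; linarith⟩

section Diagonalization

variable {k : Type*} [Fintype k] [DecidableEq k]

theorem exists_unitary_diagonalization {𝕜 : Type*} [RCLike 𝕜] {N : Matrix k k 𝕜}
    (hN : N.IsHermitian) : ∃ (T : Matrix k k 𝕜) (d : k → ℝ),
      T * Tᴴ = 1 ∧ Tᴴ * T = 1 ∧ N * T = T * diagonal fun i => (d i : 𝕜) := by
  refine ⟨hN.eigenvectorUnitary, hN.eigenvalues, ?_, ?_, ?_⟩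
  · exact Unitary.coe_mul_star_self _
  · exact Unitary.coe_star_mul_self _
  · have h := hN.spectral_theorem
    rw [Unitary.conjStarAlgAut_apply] at h
    nth_rewrite 1 [h]
    rw [Matrix.mul_assoc, Unitary.coe_star_mul_self, Matrix.mul_one]
    rfl

open scoped MatrixOrder in
theorem sqrt_facts {N : Matrix k k ℝ} (h : N.PosSemidef) :
    CFC.sqrt N * CFC.sqrt N = N ∧ (CFC.sqrt N)ᵀ = CFC.sqrt N := by
  refine ⟨CFC.sqrt_mul_sqrt_self N h.nonneg, ?_⟩
  have := (CFC.sqrt_nonneg N).posSemidef.1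
  rwa [IsHermitian, conjTranspose_eq_transpose_of_trivial] at this

end Diagonalization

/-! ### The trace inequality behind the KYP lemma. -/

section KYP

theorem trace_conj {k R : Type*} [Fintype k] [DecidableEq k] [CommRing R] {T T' : Matrix k k R}
    (h : T * T' = 1) (M : Matrix k k R) : (T' * (M * T)).trace = M.trace := by
  rw [Matrix.trace_mul_comm T' (M * T), Matrix.mul_assoc, h, Matrix.mul_one]

variable {a b k : Type*} [Fintype a] [DecidableEq a] [Fintype b] [DecidableEq b]
  [Fintype k] [DecidableEq k]
  {A : Matrix a a ℝ} {B : Matrix a b ℝ} {C : Matrix b a ℝ}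

/-- Since `X` has independent orthogonal columns, the skew condition forces `A X + B U = X K` with
`K` skew-symmetric. In a unitary eigenbasis of `K` each pair `(X v, U v)` is a sinusoidal regime at
one real frequency, and the trace is the sum of the quantities that `hfreq` bounds below. -/
theorem trace_nonneg_of_diagonal
    (hfreq : ∀ (ω : ℝ) (x : a → ℂ) (u : b → ℂ), cx A *ᵥ x + cx B *ᵥ u = (Complex.I * ω) • x →
      0 ≤ (star u ⬝ᵥ (cx C *ᵥ ((Complex.I * ω) • x))).re)
    {X : Matrix a k ℝ} {U : Matrix b k ℝ} {d : k → ℝ} (hd : ∀ i, 0 < d i)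
    (hX : Xᵀ * X = diagonal d)
    (hskew : (A * X + B * U) * Xᵀ + X * (A * X + B * U)ᵀ = 0) :
    0 ≤ (Uᵀ * (C * (A * X + B * U))).trace := by
  set F := A * X + B * U with hF
  set E : Matrix k k ℝ := diagonal fun i => (d i)⁻¹ with hE
  have hED : E * diagonal d = 1 := by
    rw [hE, diagonal_mul_diagonal, ← diagonal_one]; congr 1; ext i; simp [(hd i).ne']
  have hDE : diagonal d * E = 1 := by
    rw [hE, diagonal_mul_diagonal, ← diagonal_one]; congr 1; ext i; simp [(hd i).ne']
  have hEt : Eᵀ = E := diagonal_transpose _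
  set K : Matrix k k ℝ := E * (Xᵀ * F) with hK
  have h1 : F * diagonal d = -(X * (Fᵀ * X)) := by
    rw [← hX, ← Matrix.mul_assoc, eq_neg_of_add_eq_zero_left hskew, Matrix.neg_mul,
      Matrix.mul_assoc]
  have h2 : Xᵀ * F * diagonal d = -(diagonal d * (Fᵀ * X)) := by
    rw [Matrix.mul_assoc, h1, ← hX, Matrix.mul_neg, Matrix.mul_assoc]
  have hKt : Kᵀ = -K := by
    have : Kᵀ = Fᵀ * X * E := by
      rw [hK, transpose_mul, transpose_mul, transpose_transpose, hEt]
    calc Kᵀ = E * (diagonal d * (Fᵀ * X)) * E := by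
          rw [this, ← Matrix.mul_assoc E, hED, Matrix.one_mul]
      _ = -(E * (Xᵀ * F * diagonal d) * E) := by rw [h2]; simp
      _ = -K := by rw [Matrix.mul_assoc, Matrix.mul_assoc, hDE, Matrix.mul_one, hK]
  have hFX : F = X * K := by
    calc F = F * diagonal d * E := by rw [Matrix.mul_assoc, hDE, Matrix.mul_one]
      _ = -(X * (Fᵀ * X * E)) := by rw [h1]; simp [Matrix.mul_assoc]
      _ = -(X * Kᵀ) := by
        rw [hK, transpose_mul, transpose_mul, transpose_transpose, hEt]
      _ = X * K := by rw [hKt]; simp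
  have hN : (Complex.I • cx K).IsHermitian := by
    rw [IsHermitian, conjTranspose_smul, cx_conjTranspose, hKt, cx_neg]
    simp
  obtain ⟨T, lam, hTT, hTT', hT⟩ := exists_unitary_diagonalization hN
  have htr : ((Uᵀ * (C * F)).trace : ℂ) = (Tᴴ * (cx (Uᵀ * (C * F)) * T)).trace := by
    rw [trace_conj hTT]
    simp [Matrix.trace, cx_apply]
  have hre : (Uᵀ * (C * F)).trace = ∑ j, ((Tᴴ * (cx (Uᵀ * (C * F)) * T)) j j).re := by
    have := congrArg Complex.re htr
    simpa [Matrix.trace] using this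
  rw [hre]
  refine Finset.sum_nonneg fun j _ => ?_
  set v : k → ℂ := fun i => T i j with hv
  have hKv : cx K *ᵥ v = (Complex.I * ((-lam j : ℝ) : ℂ)) • v := by
    have h3 : (Complex.I • cx K) *ᵥ v = (lam j : ℂ) • v := by
      ext i
      have := congrFun (congrFun hT i) j
      rw [mul_diagonal] at this
      simp only [Pi.smul_apply, smul_eq_mul, hv]
      rw [mul_comm]
      exact this
    rw [smul_mulVec] at h3
    have h4 := congrArg (fun w => (-Complex.I) • w) h3
    simp only [smul_smul] at h4
    rw [neg_mul, Complex.I_mul_I, neg_neg, one_smul] at h4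
    rw [h4]; push_cast; congr 1; ring
  have hFv : cx F *ᵥ v = (Complex.I * ((-lam j : ℝ) : ℂ)) • (cx X *ᵥ v) := by
    rw [hFX, cx_mul, ← mulVec_mulVec, hKv, mulVec_smul]
  have h5 := hfreq (-lam j) (cx X *ᵥ v) (cx U *ᵥ v) (by
    rw [← hFv, hF, cx_add, cx_mul, cx_mul, add_mulVec, mulVec_mulVec, mulVec_mulVec])
  rw [← hFv] at h5
  have h6 : (Tᴴ * (cx (Uᵀ * (C * F)) * T)) j j
      = star (cx U *ᵥ v) ⬝ᵥ (cx C *ᵥ (cx F *ᵥ v)) := by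
    have : star (cx U *ᵥ v) ⬝ᵥ (cx C *ᵥ (cx F *ᵥ v)) = star v ⬝ᵥ (cx (Uᵀ * (C * F)) *ᵥ v) := by
      rw [cx_mul, cx_mul, ← mulVec_mulVec, ← mulVec_mulVec, star_dotProduct_cx_mulVec Uᵀ,
        transpose_transpose]
    rw [this]
    simp [Matrix.mul_apply, dotProduct, mulVec, hv, conjTranspose_apply]
  rw [h6]
  exact h5

/-- An orthogonal change of columns makes `Xᵀ X` diagonal. The nonzero columns of `X` fall under
`trace_nonneg_of_diagonal`; a zero column leaves only `u · C B u`, the contribution of infinite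
frequency. -/
theorem trace_nonneg_of_skew
    (hfreq : ∀ (ω : ℝ) (x : a → ℂ) (u : b → ℂ), cx A *ᵥ x + cx B *ᵥ u = (Complex.I * ω) • x →
      0 ≤ (star u ⬝ᵥ (cx C *ᵥ ((Complex.I * ω) • x))).re)
    (hinf : ∀ u : b → ℝ, 0 ≤ u ⬝ᵥ (C *ᵥ (B *ᵥ u)))
    {X : Matrix a k ℝ} {U : Matrix b k ℝ}
    (hskew : (A * X + B * U) * Xᵀ + X * (A * X + B * U)ᵀ = 0) :
    0 ≤ (Uᵀ * (C * (A * X + B * U))).trace := by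
  have hH : (Xᵀ * X).IsHermitian := by
    rw [IsHermitian, conjTranspose_eq_transpose_of_trivial, transpose_mul, transpose_transpose]
  obtain ⟨T, d, hTT, hTT', hT⟩ := exists_unitary_diagonalization hH
  rw [conjTranspose_eq_transpose_of_trivial] at hTT hTT'
  set X' := X * T with hX'
  set U' := U * T with hU'
  set F := A * X + B * U with hF
  have hF' : A * X' + B * U' = F * T := by
    rw [hF, hX', hU', Matrix.add_mul, Matrix.mul_assoc, Matrix.mul_assoc]
  have hdiag : X'ᵀ * X' = diagonal d := by
    rw [hX', transpose_mul, Matrix.mul_assoc, ← Matrix.mul_assoc Xᵀ, hT, ← Matrix.mul_assoc, hTT',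
      Matrix.one_mul]
    simp
  have hd0 : ∀ i, d i = X'.col i ⬝ᵥ X'.col i := by
    intro i
    have := congrFun (congrFun hdiag i) i
    rw [diagonal_apply_eq] at this
    rw [← this]; rfl
  have hd : ∀ i, 0 ≤ d i := fun i => by rw [hd0]; exact dotProduct_self_nonneg_real _
  have hcol : ∀ i, d i = 0 → X'.col i = 0 := fun i hi => by
    rw [hd0] at hi; exact dotProduct_self_eq_zero.1 hi
  have htr : (Uᵀ * (C * F)).trace = ∑ i, U'.col i ⬝ᵥ (C *ᵥ (F * T).col i) := by
    have h1 : (Uᵀ * (C * F)).trace = (U'ᵀ * (C * (F * T))).trace := by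
      rw [hU', transpose_mul, Matrix.mul_assoc, ← trace_conj hTT (Uᵀ * (C * F))]
      simp only [Matrix.mul_assoc]
    rw [h1]
    rfl
  rw [htr, ← Fintype.sum_subtype_add_sum_subtype (fun i => 0 < d i)]
  refine add_nonneg ?_ (Finset.sum_nonneg fun i _ => ?_)
  · obtain ⟨X1, hX1⟩ : ∃ X1 : Matrix a {i // 0 < d i} ℝ, ∀ i j, X1 i j = X' i j :=
      ⟨Matrix.of fun i j => X' i j, fun _ _ => rfl⟩
    obtain ⟨U1, hU1⟩ : ∃ U1 : Matrix b {i // 0 < d i} ℝ, ∀ i j, U1 i j = U' i j :=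
      ⟨Matrix.of fun i j => U' i j, fun _ _ => rfl⟩
    have hF1 : ∀ i j, (A * X1 + B * U1) i j = (F * T) i j := by
      intro i j
      rw [← hF']
      simp [Matrix.mul_apply, hX1, hU1]
    have hFX : F * T * X'ᵀ = (A * X1 + B * U1) * X1ᵀ := by
      ext i j
      rw [Matrix.mul_apply, Matrix.mul_apply,
        ← Fintype.sum_subtype_add_sum_subtype (fun i => 0 < d i)]
      have h0 : ∑ r : {r // ¬ 0 < d r}, (F * T) i r * X'ᵀ r j = 0 := by
        refine Finset.sum_eq_zero fun r _ => ?_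
        have := congrFun (hcol r (le_antisymm (not_lt.1 r.2) (hd r))) j
        rw [col_apply] at this
        rw [transpose_apply, this]; simp
      rw [h0, add_zero]
      refine Finset.sum_congr rfl fun r _ => ?_
      rw [hF1, transpose_apply, transpose_apply, hX1]
    have hsk : F * T * X'ᵀ = F * Xᵀ := by
      rw [hX', transpose_mul, Matrix.mul_assoc, ← Matrix.mul_assoc T, hTT, Matrix.one_mul]
    have h2 := trace_nonneg_of_diagonal hfreq (X := X1) (U := U1) (d := fun i => d i)
      (fun i => i.2) (by
        ext i j
        have h1 := congrFun (congrFun hdiag i) j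
        rw [Matrix.mul_apply] at h1 ⊢
        simp only [transpose_apply, hX1] at h1 ⊢
        rw [h1, diagonal_apply, diagonal_apply]
        simp [Subtype.ext_iff]) (by
        have h3 : (A * X1 + B * U1) * X1ᵀ = F * Xᵀ := by rw [← hFX, hsk]
        have h4 : X1 * (A * X1 + B * U1)ᵀ = X * Fᵀ := by
          have := congrArg Matrix.transpose h3
          rwa [transpose_mul, transpose_mul, transpose_transpose, transpose_transpose] at this
        rw [h3, h4, hskew])
    have h5 : (U1ᵀ * (C * (A * X1 + B * U1))).trace
        = ∑ j, U1.col j ⬝ᵥ (C *ᵥ (A * X1 + B * U1).col j) := rfl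
    rw [h5] at h2
    refine h2.trans_eq (Finset.sum_congr rfl fun j _ => ?_)
    have e1 : U'.col j = U1.col j := by ext i; simp [hU1]
    have e2 : (F * T).col j = (A * X1 + B * U1).col j := by ext i; simp only [col_apply, hF1]
    rw [e1, e2]
  · have h0 := hcol i (le_antisymm (not_lt.1 i.2) (hd i))
    have h1 : (F * T).col i = B *ᵥ U'.col i := by
      rw [← hF']
      have : (A * X').col i = A *ᵥ X'.col i := rfl
      have h2 : (A * X' + B * U').col i = A *ᵥ X'.col i + B *ᵥ U'.col i := rfl
      rw [h2, h0, mulVec_zero, zero_add]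
    rw [h1]
    exact hinf _

end KYP

/-! ### The KYP lemma by convex separation. -/

section KYP

variable {a b : Type*} [Fintype a] [DecidableEq a] [Fintype b] [DecidableEq b]
  {A : Matrix a a ℝ} {B : Matrix a b ℝ} {C : Matrix b a ℝ}

/-- Kalman–Yakubovich–Popov lemma for the supply rate `u · C (A x + B u)`. -/
theorem exists_storage (hAB : Controllable A B)
    (hfreq : ∀ (ω : ℝ) (x : a → ℂ) (u : b → ℂ), cx A *ᵥ x + cx B *ᵥ u = (Complex.I * ω) • x →
      0 ≤ (star u ⬝ᵥ (cx C *ᵥ ((Complex.I * ω) • x))).re)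
    (hinf : ∀ u : b → ℝ, 0 ≤ u ⬝ᵥ (C *ᵥ (B *ᵥ u))) :
    ∃ P : Matrix a a ℝ, Pᵀ = P ∧
      ∀ x u, (P *ᵥ x - Cᵀ *ᵥ u) ⬝ᵥ (A *ᵥ x + B *ᵥ u) ≤ 0 := by
  let AB : Matrix a (a ⊕ b) ℝ := fromCols A B
  let E1 : Matrix a (a ⊕ b) ℝ := fromCols 1 0
  let E2 : Matrix b (a ⊕ b) ℝ := fromCols 0 1
  let σ : Matrix (a ⊕ b) (a ⊕ b) ℝ → ℝ := fun W => -(C * AB * W * E2ᵀ).trace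
  let Sm : Matrix (a ⊕ b) (a ⊕ b) ℝ → Matrix a a ℝ := fun W => AB * W * E1ᵀ
  have hσ : ∀ (r s : ℝ) W W', σ (r • W + s • W') = r * σ W + s * σ W' := by
    intro r s W W'
    simp only [σ, Matrix.mul_add, Matrix.add_mul, Matrix.mul_smul, Matrix.smul_mul, trace_add,
      trace_smul, smul_eq_mul]
    ring
  have hSm : ∀ (r s : ℝ) W W', Sm (r • W + s • W') = r • Sm W + s • Sm W' := by
    intro r s W W'
    simp only [Sm, Matrix.mul_add, Matrix.add_mul, Matrix.mul_smul, Matrix.smul_mul]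
  -- For `W = ∑ w wᵀ` with `w = (x, u)`, `σ W` is minus the total supply and `Sm W` is `∑ (A x + B
  -- u) xᵀ`. The slack `t > 0` will make the multiplier `α` of the supply nonnegative, and the skew
  -- slack `K` will make the multiplier `P` symmetric.
  let D : Set (ℝ × (a → a → ℝ)) := {p | ∃ (W : Matrix (a ⊕ b) (a ⊕ b) ℝ) (t : ℝ) (K : Matrix a a ℝ),
    W.PosSemidef ∧ 0 < t ∧ Kᵀ = -K ∧ p = (σ W - t, fun i j => Sm W i j + K i j)}
  have hconv : Convex ℝ D := by
    rintro _ ⟨W, t, K, hW, ht, hK, rfl⟩ _ ⟨W', t', K', hW', ht', hK', rfl⟩ r s hr hs hrs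
    refine ⟨r • W + s • W', r * t + s * t', r • K + s • K', (hW.smul hr).add (hW'.smul hs), ?_, ?_,
      ?_⟩
    · rcases hr.eq_or_lt with rfl | hr
      · have : s = 1 := by linarith
        subst this; linarith
      · have := mul_pos hr ht
        have := mul_nonneg hs ht'.le
        linarith
    · rw [transpose_add, transpose_smul, transpose_smul, hK, hK']; module
    · rw [hσ, hSm]
      ext
      · simp; ring
      · simp; ring
  have hne : D.Nonempty := ⟨_, 0, 1, 0, PosSemidef.zero, one_pos, by simp, rfl⟩
  have h0 : (0 : ℝ × (a → a → ℝ)) ∉ D := by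
    rintro ⟨W, t, K, hW, ht, hK, h⟩
    -- The rows of `V` split into `X` and `U`. If the origin were in `D`, `(A X + B U) Xᵀ` would be
    -- skew with total supply `-t < 0`, against `trace_nonneg_of_skew`.
    obtain ⟨V, hV⟩ : ∃ V : Matrix (a ⊕ b) (a ⊕ b) ℝ, W = V * Vᵀ := by
      have := sqrt_facts hW
      exact ⟨_, by rw [this.2, this.1]⟩
    have hσ0 : σ W = t := by
      have := congrArg Prod.fst h
      simp only [Prod.fst_zero] at this
      linarith
    have hS0 : Sm W = -K := by
      have := congrArg Prod.snd h
      ext i j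
      have := congrFun (congrFun this i) j
      simp only [Prod.snd_zero, Pi.zero_apply] at this
      change Sm W i j = -(K i j)
      linarith
    have hABV : A * (E1 * V) + B * (E2 * V) = AB * V := by
      rw [← Matrix.mul_assoc, ← Matrix.mul_assoc, ← Matrix.add_mul]
      congr 1
      simp only [E1, E2, AB, mul_fromCols, Matrix.mul_one, Matrix.mul_zero]
      ext i (j | j) <;> simp
    have h1 : (AB * V) * (E1 * V)ᵀ = -K := by
      rw [← hS0]; simp only [Sm, hV, transpose_mul, Matrix.mul_assoc]
    have h2 := trace_nonneg_of_skew hfreq hinf (X := E1 * V) (U := E2 * V) (by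
      rw [hABV, h1]
      have : (E1 * V) * (AB * V)ᵀ = (-K)ᵀ := by
        have := congrArg Matrix.transpose h1
        rwa [transpose_mul, transpose_transpose] at this
      rw [this, transpose_neg, hK]; simp)
    rw [hABV, Matrix.trace_mul_comm] at h2
    have h3 : σ W = -(C * (AB * V) * (E2 * V)ᵀ).trace := by
      simp only [σ, hV, transpose_mul, Matrix.mul_assoc]
    linarith
  obtain ⟨f, hf0, hf⟩ := exists_nonzero_nonpos_on hconv hne h0
  let α : ℝ := f (1, 0)
  let P : Matrix a a ℝ := fun i j => f (0, fun i' j' => Matrix.single i j (1 : ℝ) i' j')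
  let g : Matrix a a ℝ → ℝ := fun Y => ∑ i, ∑ j, P i j * Y i j
  have hfdec : ∀ (τ : ℝ) (Y : Matrix a a ℝ), f (τ, fun i j => Y i j) = α * τ + g Y := by
    intro τ Y
    have h1 : (τ, fun i j => Y i j) = τ • ((1, 0) : ℝ × (a → a → ℝ))
        + ∑ i, ∑ j, Y i j • ((0, fun i' j' => Matrix.single i j (1 : ℝ) i' j') : ℝ × (a → a → ℝ)) := by
      ext1
      · simp [Prod.fst_sum]
      · simp only [Prod.snd_add, Prod.smul_snd, smul_zero, zero_add, Prod.snd_sum]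
        funext i' j'
        simp only [Finset.sum_apply, Pi.smul_apply, smul_eq_mul, Matrix.single_apply]
        rw [Finset.sum_eq_single i', Finset.sum_eq_single j']
        · simp
        · intro j _ hj; simp [hj]
        · simp
        · intro i _ hi; simp [hi]
        · simp
    rw [h1, map_add, map_smul, map_sum]
    simp only [map_sum, map_smul, smul_eq_mul, g, P, α]
    rw [mul_comm]
    congr 1
    refine Finset.sum_congr rfl fun i _ => Finset.sum_congr rfl fun j _ => mul_comm _ _
  have hgadd : ∀ Y Z, g (Y + Z) = g Y + g Z := by
    intro Y Z
    simp only [g, Matrix.add_apply, mul_add, Finset.sum_add_distrib]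
  have hgsmul : ∀ (r : ℝ) Y, g (r • Y) = r * g Y := by
    intro r Y
    simp only [g, Matrix.smul_apply, smul_eq_mul, Finset.mul_sum]
    refine Finset.sum_congr rfl fun i _ => Finset.sum_congr rfl fun j _ => by ring
  have hmain : ∀ (W : Matrix (a ⊕ b) (a ⊕ b) ℝ) (t : ℝ) (K : Matrix a a ℝ), W.PosSemidef → 0 < t →
      Kᵀ = -K → α * (σ W - t) + (g (Sm W) + g K) ≤ 0 := by
    intro W t K hW ht hK
    have := hf _ ⟨W, t, K, hW, ht, hK, rfl⟩
    have h2 := hfdec (σ W - t) (Sm W + K)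
    simp only [Matrix.add_apply] at h2
    rw [h2, hgadd] at this
    exact this
  have hS0 : Sm 0 = 0 := by simp [Sm]
  have hσ0 : σ 0 = 0 := by simp [σ]
  have hg0 : g 0 = 0 := by simp [g]
  have hα : 0 ≤ α := by
    have := hmain 0 1 0 PosSemidef.zero one_pos (by simp)
    rw [hS0, hσ0, hg0] at this
    linarith
  have hgK : ∀ K : Matrix a a ℝ, Kᵀ = -K → g K = 0 := by
    intro K hK
    by_contra hne
    -- The scaling makes the left side of `hmain` equal to `-α + (α + 1) = 1`.
    have := hmain 0 1 (((α + 1) / g K) • K) PosSemidef.zero one_pos (by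
      rw [transpose_smul, hK]; simp)
    rw [hS0, hσ0, hg0, hgsmul, div_mul_cancel₀ _ hne] at this
    linarith
  have hPsymm : Pᵀ = P := by
    ext i j
    have h1 := hgK (Matrix.single j i 1 - Matrix.single i j 1) (by
      rw [transpose_sub, transpose_single, transpose_single]; simp)
    have h2 : ∀ i j, g (Matrix.single i j 1) = P i j := by
      intro i j
      simp only [g, Matrix.single_apply]
      rw [Finset.sum_eq_single i, Finset.sum_eq_single j]
      · simp
      · intro j' _ hj; simp [hj.symm]
      · simp
      · intro i' _ hi; simp [hi.symm]
      · simp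
    have h3 : g (Matrix.single j i 1 - Matrix.single i j 1)
        = g (Matrix.single j i 1) - g (Matrix.single i j 1) := by
      rw [sub_eq_add_neg, hgadd, ← neg_one_smul ℝ, hgsmul]; ring
    rw [h3, h2, h2] at h1
    rw [transpose_apply]; linarith
  have hW : ∀ W : Matrix (a ⊕ b) (a ⊕ b) ℝ, W.PosSemidef → α * σ W + g (Sm W) ≤ 0 := by
    intro W hW
    by_contra! hlt
    set q := α * σ W + g (Sm W) with hq
    have h1 : 0 < q / (2 * (α + 1)) := by positivity
    have := hmain W (q / (2 * (α + 1))) 0 hW h1 (by simp)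
    rw [hg0, add_zero, mul_sub] at this
    have h2 : α * (q / (2 * (α + 1))) ≤ q / 2 := by
      rw [mul_div_assoc', div_le_div_iff₀ (by positivity) (by norm_num)]
      nlinarith
    linarith
  have hxu : ∀ x u, (P *ᵥ x - α • (Cᵀ *ᵥ u)) ⬝ᵥ (A *ᵥ x + B *ᵥ u) ≤ 0 := by
    intro x u
    set w : a ⊕ b → ℝ := Sum.elim x u with hw
    have h1 := hW (vecMulVec w w) (by
      have := posSemidef_vecMulVec_self_star w
      rwa [star_trivial] at this)
    have e1 : E1 *ᵥ w = x := by simp [E1, hw, fromCols_mulVec]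
    have e2 : E2 *ᵥ w = u := by simp [E2, hw, fromCols_mulVec]
    have e3 : AB *ᵥ w = A *ᵥ x + B *ᵥ u := by simp [AB, hw, fromCols_mulVec]
    have hS : Sm (vecMulVec w w) = vecMulVec (A *ᵥ x + B *ᵥ u) x := by
      simp only [Sm]
      rw [mul_vecMulVec, vecMulVec_mul, vecMul_transpose, e1, e3]
    have hs : σ (vecMulVec w w) = -(u ⬝ᵥ (C *ᵥ (A *ᵥ x + B *ᵥ u))) := by
      simp only [σ]
      rw [mul_vecMulVec, vecMulVec_mul, vecMul_transpose, e2, ← mulVec_mulVec, e3, trace_vecMulVec,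
        dotProduct_comm]
    have hg : g (vecMulVec (A *ᵥ x + B *ᵥ u) x) = (A *ᵥ x + B *ᵥ u) ⬝ᵥ (P *ᵥ x) := by
      simp only [g, dotProduct, mulVec, vecMulVec_apply, Finset.mul_sum]
      refine Finset.sum_congr rfl fun i _ => Finset.sum_congr rfl fun j _ => by ring
    rw [hS, hs, hg] at h1
    rw [sub_dotProduct, smul_dotProduct, smul_eq_mul, ← dotProduct_mulVec_transpose,
      dotProduct_comm (P *ᵥ x)]
    linarith
  -- If `α = 0`, then `(P x) · (A x + B u) ≤ 0` for all `x` and `u`. Linearity in `u` gives `P B =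
  -- 0`, then `P Aᵏ B = 0` by induction, and controllability gives `P = 0`, contradicting `f ≠ 0`.
  have hαpos : 0 < α := by
    rcases hα.eq_or_lt with h | h
    · exfalso
      have hα0 : α = 0 := h.symm
      simp only [hα0, zero_smul, sub_zero] at hxu
      have hPA : ∀ x, x ⬝ᵥ ((P * A) *ᵥ x) ≤ 0 := by
        intro x
        have := hxu x 0
        rw [mulVec_zero, add_zero] at this
        rwa [← mulVec_mulVec, dotProduct_mulVec_transpose, hPsymm]
      have hPB : P * B = 0 := by
        have h1 : ∀ x u, (P *ᵥ x) ⬝ᵥ (B *ᵥ u) = 0 := by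
          intro x u
          by_contra hne
          -- With this multiple of `u` the supposedly nonpositive form equals `1`.
          have := hxu x (((1 - (P *ᵥ x) ⬝ᵥ (A *ᵥ x)) / ((P *ᵥ x) ⬝ᵥ (B *ᵥ u))) • u)
          rw [mulVec_smul, dotProduct_add, dotProduct_smul, smul_eq_mul,
            div_mul_cancel₀ _ hne] at this
          linarith
        apply Matrix.mulVec_injective
        funext u
        rw [zero_mulVec, ← mulVec_mulVec]
        apply dotProduct_eq_zero_iff.1
        intro x
        rw [dotProduct_comm, dotProduct_mulVec_transpose, hPsymm]
        exact h1 x u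
      have hk : ∀ k : ℕ, P * (A ^ k * B) = 0 := by
        intro k
        induction k with
        | zero => simpa using hPB
        | succ k ih =>
          apply Matrix.mulVec_injective
          funext u
          rw [zero_mulVec, pow_succ', Matrix.mul_assoc, ← mulVec_mulVec, ← mulVec_mulVec]
          set y := (A ^ k * B) *ᵥ u with hy
          have hPy : P *ᵥ y = 0 := by rw [hy, mulVec_mulVec, ih, zero_mulVec]
          have h1 := add_transpose_mulVec_eq_zero hPA (x := y) (by
            rw [← mulVec_mulVec, dotProduct_mulVec_transpose, hPsymm, hPy, zero_dotProduct])
          rwa [add_mulVec, transpose_mul, hPsymm, ← mulVec_mulVec, ← mulVec_mulVec, hPy,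
            mulVec_zero, add_zero] at h1
      have hP0 : P = 0 := by
        ext i j
        have := hAB (P i) fun k => by
          have := hk k
          ext j
          exact congrFun (congrFun this i) j
        exact congrFun this j
      apply hf0
      refine LinearMap.ext fun p => ?_
      have := hfdec p.1 p.2
      simp only [hα0, zero_mul, zero_add] at this
      rw [LinearMap.zero_apply]
      refine this.trans ?_
      simp [g, hP0]
    · exact h
  refine ⟨α⁻¹ • P, by rw [transpose_smul, hPsymm], fun x u => ?_⟩
  have h1 : (α⁻¹ • P) *ᵥ x - Cᵀ *ᵥ u = α⁻¹ • (P *ᵥ x - α • (Cᵀ *ᵥ u)) := by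
    rw [smul_sub, smul_smul, inv_mul_cancel₀ hαpos.ne', one_smul, smul_mulVec]
  rw [h1, smul_dotProduct, smul_eq_mul]
  exact mul_nonpos_of_nonneg_of_nonpos (inv_nonneg.2 hα) (hxu x u)

end KYP

/-! ### The frequency inequality on the whole axis and at infinity. -/

section Frequency

variable {a b : Type*} [Fintype a] [DecidableEq a] [Fintype b] [DecidableEq b]
  {A : Matrix a a ℝ} {B : Matrix a b ℝ} {C : Matrix b a ℝ}

/-- Nonnegativity of a quadratic form on the kernels of a continuous family of matrices passes to a
limit point at which the family is surjective. -/
theorem nonneg_on_kernel_of_limit {c : Type*} [Fintype c] {S : ℝ → Matrix a c ℂ}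
    {q : ℝ → (c → ℂ) → ℝ} {t₀ : ℝ} (hS : Continuous S) (hq : Continuous fun p : ℝ × (c → ℂ) => q p.1 p.2)
    (hhom : ∀ t (r : ℂ) w, q t (r • w) = ‖r‖ ^ 2 * q t w)
    (h : ∀ᶠ t in 𝓝[>] t₀, ∀ w, S t *ᵥ w = 0 → 0 ≤ q t w)
    (hinj : ∀ ξ, (S t₀)ᴴ *ᵥ ξ = 0 → ξ = 0) {w₀ : c → ℂ} (hw : S t₀ *ᵥ w₀ = 0) :
    0 ≤ q t₀ w₀ := by
  let N : ℝ → Matrix a a ℂ := fun t => S t * (S t)ᴴ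
  -- The orthogonal projection of `w₀` to the kernel of `S t`, multiplied by `det (N t)`. The
  -- adjugate keeps it polynomial, hence continuous, even where `N t` is singular.
  let w : ℝ → c → ℂ := fun t =>
    (N t).det • w₀ - (S t)ᴴ *ᵥ ((N t).adjugate *ᵥ (S t *ᵥ w₀))
  have hNc : Continuous N := hS.matrix_mul hS.matrix_conjTranspose
  have hwc : Continuous w := by
    refine (hNc.matrix_det.smul continuous_const).sub ?_
    exact hS.matrix_conjTranspose.matrix_mulVec
      (hNc.matrix_adjugate.matrix_mulVec (hS.matrix_mulVec continuous_const))
  have hker : ∀ t, S t *ᵥ w t = 0 := by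
    intro t
    simp only [w, mulVec_sub, mulVec_smul]
    have : S t *ᵥ ((S t)ᴴ *ᵥ ((N t).adjugate *ᵥ (S t *ᵥ w₀)))
        = (N t * (N t).adjugate) *ᵥ (S t *ᵥ w₀) := by
      simp only [mulVec_mulVec, N, Matrix.mul_assoc]
    rw [this, mul_adjugate, smul_mulVec, one_mulVec, sub_self]
  have hdet : (N t₀).det ≠ 0 := by
    intro h0
    obtain ⟨ξ, hξ, h1⟩ := exists_mulVec_eq_zero_iff.2 h0
    exact hξ (hinj ξ ((self_mul_conjTranspose_mulVec_eq_zero (S t₀) ξ).1 h1))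
  have hlim : Tendsto (fun t => q t (w t)) (𝓝[>] t₀) (𝓝 (q t₀ (w t₀))) :=
    ((hq.comp (continuous_id.prodMk hwc)).tendsto t₀).mono_left nhdsWithin_le_nhds
  have h1 : 0 ≤ q t₀ (w t₀) := by
    refine ge_of_tendsto hlim ?_
    filter_upwards [h] with t ht
    exact ht _ (hker t)
  have h2 : w t₀ = (N t₀).det • w₀ := by
    simp only [w, hw, mulVec_zero, sub_zero]
  rw [h2, hhom] at h1
  exact nonneg_of_mul_nonneg_right h1 (by positivity)

theorem eventually_isReg_imag (A : Matrix a a ℝ) (ω₀ : ℝ) :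
    ∀ᶠ ω : ℝ in 𝓝[>] ω₀, IsReg A (Complex.I * ω) := by
  have h1 : Tendsto (fun ω : ℝ => Complex.I * (ω : ℂ)) (𝓝[>] ω₀) (𝓝[≠] (Complex.I * ω₀)) := by
    refine tendsto_nhdsWithin_iff.2 ⟨?_, ?_⟩
    · exact (Continuous.tendsto (by fun_prop) ω₀).mono_left nhdsWithin_le_nhds
    · filter_upwards [self_mem_nhdsWithin] with ω hω
      simp only [Set.mem_compl_iff, Set.mem_singleton_iff, mul_eq_mul_left_iff,
        Complex.ofReal_inj, Complex.I_ne_zero, or_false]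
      exact hω.ne'
  exact h1.eventually (eventually_isReg_nhdsNE A _)

theorem freq_of_regular
    (hbase : ∀ ω : ℝ, 0 < ω → IsReg A (Complex.I * ω) → ∀ u : b → ℂ,
      (star u ⬝ᵥ (cx C *ᵥ (res A (Complex.I * ω) *ᵥ (cx B *ᵥ u)))).im ≤ 0)
    {ω : ℝ} (hω : 0 < ω) (hreg : IsReg A (Complex.I * ω)) {x : a → ℂ} {u : b → ℂ}
    (h : cx A *ᵥ x + cx B *ᵥ u = (Complex.I * ω) • x) :
    0 ≤ (star u ⬝ᵥ (cx C *ᵥ ((Complex.I * ω) • x))).re := by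
  have hx := eq_res_mulVec hreg h.symm
  have := hbase ω hω hreg u
  rw [← hx] at this
  rw [mulVec_smul, dotProduct_smul, smul_eq_mul]
  simp only [Complex.mul_re, Complex.I_re, Complex.I_im, Complex.ofReal_re, Complex.ofReal_im,
    Complex.mul_im]
  nlinarith

theorem star_cx_mulVec {c d : Type*} [Fintype d] (M : Matrix c d ℝ) (x : d → ℂ) :
    cx M *ᵥ star x = star (cx M *ᵥ x) := by
  ext i; simp [mulVec, dotProduct, cx_apply]

/-- The frequency-domain inequality on the positive imaginary axis away from the eigenvalues
extends to the whole imaginary axis. -/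
theorem freq_all (hAB : Controllable A B)
    (hbase : ∀ ω : ℝ, 0 < ω → IsReg A (Complex.I * ω) → ∀ u : b → ℂ,
      (star u ⬝ᵥ (cx C *ᵥ (res A (Complex.I * ω) *ᵥ (cx B *ᵥ u)))).im ≤ 0)
    (ω : ℝ) (x : a → ℂ) (u : b → ℂ) (h : cx A *ᵥ x + cx B *ᵥ u = (Complex.I * ω) • x) :
    0 ≤ (star u ⬝ᵥ (cx C *ᵥ ((Complex.I * ω) • x))).re := by
  have hpos : ∀ (ω : ℝ) (x : a → ℂ) (u : b → ℂ), 0 < ω →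
      cx A *ᵥ x + cx B *ᵥ u = (Complex.I * ω) • x →
      0 ≤ (star u ⬝ᵥ (cx C *ᵥ ((Complex.I * ω) • x))).re := by
    intro ω x u hω h
    -- The kernel of `[it - A, -B]` is the set of sinusoidal regimes at frequency `t`.
    -- Controllability makes this matrix surjective even at an eigenvalue of `A`, so the inequality
    -- passes to the limit from nearby regular frequencies.
    let S : ℝ → Matrix a (a ⊕ b) ℂ := fun t =>
      fromCols ((Complex.I * t) • (1 : Matrix a a ℂ) - cx A) (-cx B)
    let q : ℝ → (a ⊕ b → ℂ) → ℝ := fun t w =>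
      (star (fun i => w (Sum.inr i)) ⬝ᵥ (cx C *ᵥ ((Complex.I * t) • fun i => w (Sum.inl i)))).re
    have hSw : ∀ (t : ℝ) w, S t *ᵥ w = (Complex.I * t) • (fun i => w (Sum.inl i))
        - cx A *ᵥ (fun i => w (Sum.inl i)) - cx B *ᵥ (fun i => w (Sum.inr i)) := by
      intro t w
      simp only [S, fromCols_mulVec, sub_mulVec, smul_mulVec, one_mulVec, neg_mulVec,
        ← sub_eq_add_neg]
      rfl
    have := nonneg_on_kernel_of_limit (S := S) (q := q) (t₀ := ω) (w₀ := Sum.elim x u) ?_ ?_ ?_ ?_ ?_ ?_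
    · exact this
    · refine continuous_matrix fun i j => ?_
      rcases j with j | j
      · simp only [S, fromCols_apply_inl, Matrix.sub_apply, Matrix.smul_apply]; fun_prop
      · simp only [S, fromCols_apply_inr]; fun_prop
    · simp only [q, dotProduct, mulVec, Pi.star_apply, Pi.smul_apply, smul_eq_mul]
      fun_prop
    · intro t r w
      simp only [q]
      have e1 : (fun i => (r • w) (Sum.inr i)) = r • fun i : b => w (Sum.inr i) := rfl
      have e2 : (fun i => (r • w) (Sum.inl i)) = r • fun i : a => w (Sum.inl i) := rfl
      rw [e1, e2, smul_comm, mulVec_smul, star_smul, smul_dotProduct, dotProduct_smul, smul_smul]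
      have : star r * r = ((‖r‖ ^ 2 : ℝ) : ℂ) := by
        rw [Complex.star_def, Complex.conj_mul']; push_cast; rfl
      rw [this, smul_eq_mul, Complex.re_ofReal_mul]
    · filter_upwards [eventually_isReg_imag A ω, self_mem_nhdsWithin] with t ht htω w hw
      refine freq_of_regular hbase (hω.trans htω) ht ?_
      rw [hSw, sub_sub, sub_eq_zero] at hw
      exact hw.symm
    · intro ξ hξ
      have hobs : Observable Aᵀ Bᵀ := Controllable.observable_of_transpose (by simpa using hAB)
      have h1 : (S ω)ᴴ = fromRows ((star (Complex.I * (ω : ℂ))) • (1 : Matrix a a ℂ) - cx Aᵀ)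
          (-cx Bᵀ) := by
        simp only [S]
        rw [conjTranspose_fromCols_eq_fromRows_conjTranspose, conjTranspose_sub,
          conjTranspose_smul, conjTranspose_one, conjTranspose_neg, cx_conjTranspose,
          cx_conjTranspose]
      rw [h1, fromRows_mulVec] at hξ
      have h2 : ((star (Complex.I * (ω : ℂ))) • (1 : Matrix a a ℂ) - cx Aᵀ) *ᵥ ξ = 0 := by
        ext i; exact congrFun hξ (Sum.inl i)
      have h3 : (-cx Bᵀ) *ᵥ ξ = 0 := by
        ext i; exact congrFun hξ (Sum.inr i)
      rw [sub_mulVec, smul_mulVec, one_mulVec, sub_eq_zero] at h2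
      rw [neg_mulVec, neg_eq_zero] at h3
      exact hobs.eq_zero_of_eigenvector h2.symm h3
    · rw [hSw, sub_sub, sub_eq_zero]
      exact h.symm
  -- Negative frequencies follow by conjugation because the data are real; at zero the form
  -- vanishes.
  rcases lt_trichotomy ω 0 with hω | hω | hω
  · have h1 := hpos (-ω) (star x) (star u) (by linarith) (by
      rw [star_cx_mulVec, star_cx_mulVec, ← star_add, h, star_smul]; simp)
    have e : (Complex.I * ((-ω : ℝ) : ℂ)) • star x = star ((Complex.I * (ω : ℂ)) • x) := by
      rw [star_smul]; simp
    rw [e, star_cx_mulVec] at h1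
    have e2 : (star (star u) ⬝ᵥ star (cx C *ᵥ ((Complex.I * (ω : ℂ)) • x)))
        = star (star u ⬝ᵥ (cx C *ᵥ ((Complex.I * (ω : ℂ)) • x))) := by
      simp [dotProduct]
    rw [e2] at h1
    simpa using h1
  · subst hω; simp
  · exact hpos ω x u hω h

/-- With `t = 1/ω`, a regime at frequency `ω` is a solution of `x + i t (A x + B u) = 0`. At `t = 0`
the solutions are `x = 0` with `u` free, and the form becomes `u · C B u`. -/
theorem freq_infinity
    (hbase : ∀ ω : ℝ, 0 < ω → IsReg A (Complex.I * ω) → ∀ u : b → ℂ,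
      (star u ⬝ᵥ (cx C *ᵥ (res A (Complex.I * ω) *ᵥ (cx B *ᵥ u)))).im ≤ 0) (u : b → ℝ) :
    0 ≤ u ⬝ᵥ (C *ᵥ (B *ᵥ u)) := by
  let S : ℝ → Matrix a (a ⊕ b) ℂ := fun t =>
    fromCols (1 + (Complex.I * t) • cx A) ((Complex.I * t) • cx B)
  let q : ℝ → (a ⊕ b → ℂ) → ℝ := fun _ w =>
    (star (fun i => w (Sum.inr i)) ⬝ᵥ (cx C *ᵥ (cx A *ᵥ (fun i => w (Sum.inl i))
      + cx B *ᵥ fun i => w (Sum.inr i)))).re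
  have hSw : ∀ (t : ℝ) w, S t *ᵥ w = (fun i => w (Sum.inl i))
      + (Complex.I * t) • (cx A *ᵥ (fun i => w (Sum.inl i)) + cx B *ᵥ (fun i => w (Sum.inr i))) := by
    intro t w
    simp only [S, fromCols_mulVec, add_mulVec, smul_mulVec, one_mulVec, smul_add, add_assoc]
    rfl
  have := nonneg_on_kernel_of_limit (S := S) (q := q) (t₀ := 0) (w₀ := Sum.elim 0 (vcx u))
    ?_ ?_ ?_ ?_ ?_ ?_
  · have e : q 0 (Sum.elim 0 (vcx u)) = u ⬝ᵥ (C *ᵥ (B *ᵥ u)) := by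
      have e1 : (fun i : b => (Sum.elim 0 (vcx u) : a ⊕ b → ℂ) (Sum.inr i)) = vcx u := rfl
      have e2 : (fun i : a => (Sum.elim 0 (vcx u) : a ⊕ b → ℂ) (Sum.inl i)) = 0 := rfl
      simp only [q]
      rw [e1, e2, mulVec_zero, zero_add, vcx_mulVec, vcx_mulVec]
      simp [vcx, dotProduct]
    rwa [e] at this
  · refine continuous_matrix fun i j => ?_
    rcases j with j | j
    · simp only [S, fromCols_apply_inl, Matrix.add_apply, Matrix.smul_apply]; fun_prop
    · simp only [S, fromCols_apply_inr, Matrix.smul_apply]; fun_prop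
  · simp only [q, dotProduct, mulVec, Pi.star_apply, Pi.add_apply]
    fun_prop
  · intro t r w
    simp only [q]
    have e1 : (fun i => (r • w) (Sum.inr i)) = r • fun i : b => w (Sum.inr i) := rfl
    have e2 : (fun i => (r • w) (Sum.inl i)) = r • fun i : a => w (Sum.inl i) := rfl
    rw [e1, e2, mulVec_smul, mulVec_smul, ← smul_add, mulVec_smul, star_smul, smul_dotProduct,
      dotProduct_smul, smul_smul]
    have : star r * r = ((‖r‖ ^ 2 : ℝ) : ℂ) := by
      rw [Complex.star_def, Complex.conj_mul']; push_cast; rfl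
    rw [this, smul_eq_mul, Complex.re_ofReal_mul]
  · have hr : ∀ᶠ t : ℝ in 𝓝[>] 0, IsReg A (Complex.I * ((t⁻¹ : ℝ) : ℂ)) := by
      have h1 : Tendsto (fun ω : ℝ => Complex.I * (ω : ℂ)) atTop (Bornology.cobounded ℂ) := by
        rw [← tendsto_norm_atTop_iff_cobounded]
        simp only [norm_mul, Complex.norm_I, one_mul, Complex.norm_real]
        exact tendsto_norm_atTop_atTop
      exact (h1.comp tendsto_inv_nhdsGT_zero).eventually (eventually_isReg_cobounded A)
    filter_upwards [hr, self_mem_nhdsWithin] with t ht htpos w hw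
    have ht0 : (0 : ℝ) < t := htpos
    rw [hSw] at hw
    set x : a → ℂ := fun i => w (Sum.inl i)
    set v : b → ℂ := fun i => w (Sum.inr i)
    have hf : cx A *ᵥ x + cx B *ᵥ v = (Complex.I * ((t⁻¹ : ℝ) : ℂ)) • x := by
      have hx : x = -((Complex.I * (t : ℂ)) • (cx A *ᵥ x + cx B *ᵥ v)) :=
        eq_neg_of_add_eq_zero_left hw
      have h1 : Complex.I * ((t⁻¹ : ℝ) : ℂ) * (Complex.I * t) = -1 := by
        have : (t : ℂ) ≠ 0 := by exact_mod_cast ht0.ne'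
        push_cast
        field_simp
        simp
      have h2 := congrArg (fun y => (Complex.I * ((t⁻¹ : ℝ) : ℂ)) • y) hx
      simp only [smul_neg, smul_smul, h1] at h2
      rw [h2, neg_smul, one_smul, neg_neg]
    have := freq_of_regular hbase (inv_pos.2 ht0) ht hf
    rw [← hf] at this
    exact this
  · intro ξ hξ
    have h1 : (S 0)ᴴ = fromRows (1 : Matrix a a ℂ) 0 := by
      simp only [S]
      rw [conjTranspose_fromCols_eq_fromRows_conjTranspose]
      simp
    rw [h1, fromRows_mulVec] at hξ
    ext i
    have := congrFun hξ (Sum.inl i)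
    simpa using this
  · rw [hSw]; ext; simp

end Frequency

/-! ### Port-Hamiltonian factorization of the system. -/

section PortHamiltonian

variable {a b : Type*} [Fintype a] [DecidableEq a] [Fintype b] [DecidableEq b]
  {A : Matrix a a ℝ} {B : Matrix a b ℝ} {C : Matrix b a ℝ}

theorem eq_zero_of_forall_quadratic_nonpos {p r : ℝ} (h : ∀ t : ℝ, t * p + t ^ 2 * r ≤ 0) :
    p = 0 := by
  have key : ∀ t : ℝ, 0 ≤ (-r) * (t * t) + (-p) * t + 0 := fun t => by
    have := h t; nlinarith
  have := discrim_le_zero key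
  rw [discrim] at this
  nlinarith

/-- With a generalized inverse `Y` of `L₁`, the vector `w - Y L₁ w` lies in the kernel of `L₁`,
hence of `L₂`, so `Φ = L₂ Y` works. -/
theorem eq_mul_of_kernel_le {c d e : Type*} [Fintype c] [DecidableEq c] [Fintype d] [Fintype e]
    {L₁ : Matrix d c ℝ} {L₂ : Matrix e c ℝ} (h : ∀ w, L₁ *ᵥ w = 0 → L₂ *ᵥ w = 0) :
    ∃ Φ : Matrix e d ℝ, Φ * L₁ = L₂ := by
  obtain ⟨Y, hY⟩ := exists_generalized_inverse L₁
  refine ⟨L₂ * Y, ?_⟩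
  apply Matrix.mulVec_injective
  funext w
  have := h (w - (Y * L₁) *ᵥ w) (by
    rw [mulVec_sub, mulVec_mulVec, ← Matrix.mul_assoc, hY, sub_self])
  rw [mulVec_sub, sub_eq_zero, mulVec_mulVec, ← Matrix.mul_assoc] at this
  exact this.symm

/-- A controllable and observable system satisfying the negative imaginary frequency-domain
inequality is `ẋ = Φ (P x - Cᵀ u)` with `P` symmetric and `Φ` invertible and dissipative. -/
theorem exists_port_hamiltonian (hAB : Controllable A B) (hAC : Observable A C)
    (hbase : ∀ ω : ℝ, 0 < ω → IsReg A (Complex.I * ω) → ∀ u : b → ℂ,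
      (star u ⬝ᵥ (cx C *ᵥ (res A (Complex.I * ω) *ᵥ (cx B *ᵥ u)))).im ≤ 0) :
    ∃ P Φ : Matrix a a ℝ, Pᵀ = P ∧ Φ.det ≠ 0 ∧ (∀ x, x ⬝ᵥ (Φ *ᵥ x) ≤ 0) ∧
      A = Φ * P ∧ B = -(Φ * Cᵀ) := by
  obtain ⟨P, hP, hdiss⟩ := exists_storage hAB (freq_all hAB hbase) (freq_infinity hbase)
  have hker : ∀ x u, A *ᵥ x + B *ᵥ u = 0 → P *ᵥ x - Cᵀ *ᵥ u = 0 := by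
    intro x u h
    -- At `(x, u)` the nonpositive dissipation form attains its maximum zero, so its first variation
    -- in the direction `(y, v)` vanishes; the vectors `A y + B v` fill the state space.
    have h1 : ∀ y v, (P *ᵥ x - Cᵀ *ᵥ u) ⬝ᵥ (A *ᵥ y + B *ᵥ v) = 0 := by
      intro y v
      refine eq_zero_of_forall_quadratic_nonpos
        (r := (P *ᵥ y - Cᵀ *ᵥ v) ⬝ᵥ (A *ᵥ y + B *ᵥ v)) fun t => ?_
      have := hdiss (x + t • y) (u + t • v)
      have e1 : P *ᵥ (x + t • y) - Cᵀ *ᵥ (u + t • v)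
          = (P *ᵥ x - Cᵀ *ᵥ u) + t • (P *ᵥ y - Cᵀ *ᵥ v) := by
        simp only [mulVec_add, mulVec_smul]; module
      have e2 : A *ᵥ (x + t • y) + B *ᵥ (u + t • v) = t • (A *ᵥ y + B *ᵥ v) := by
        rw [mulVec_add, mulVec_add, mulVec_smul, mulVec_smul]
        have : A *ᵥ x + t • A *ᵥ y + (B *ᵥ u + t • B *ᵥ v)
          = (A *ᵥ x + B *ᵥ u) + t • (A *ᵥ y + B *ᵥ v) := by module
        rw [this, h, zero_add]
      rw [e1, e2, add_dotProduct, dotProduct_smul, smul_dotProduct, dotProduct_smul] at this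
      simp only [smul_eq_mul] at this
      linarith
    apply dotProduct_eq_zero_iff.1
    intro z
    obtain ⟨y, v, rfl⟩ := hAB.exists_eq_add z
    exact h1 y v
  have hker' : ∀ x u, P *ᵥ x - Cᵀ *ᵥ u = 0 → P *ᵥ (A *ᵥ x + B *ᵥ u) = 0 ∧
      C *ᵥ (A *ᵥ x + B *ᵥ u) = 0 := by
    intro x u h
    have h1 : ∀ y v, (P *ᵥ y - Cᵀ *ᵥ v) ⬝ᵥ (A *ᵥ x + B *ᵥ u) = 0 := by
      intro y v
      refine eq_zero_of_forall_quadratic_nonpos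
        (r := (P *ᵥ y - Cᵀ *ᵥ v) ⬝ᵥ (A *ᵥ y + B *ᵥ v)) fun t => ?_
      have := hdiss (x + t • y) (u + t • v)
      have e1 : P *ᵥ (x + t • y) - Cᵀ *ᵥ (u + t • v)
          = (P *ᵥ x - Cᵀ *ᵥ u) + t • (P *ᵥ y - Cᵀ *ᵥ v) := by
        simp only [mulVec_add, mulVec_smul]; module
      have e2 : A *ᵥ (x + t • y) + B *ᵥ (u + t • v)
          = (A *ᵥ x + B *ᵥ u) + t • (A *ᵥ y + B *ᵥ v) := by
        simp only [mulVec_add, mulVec_smul]; module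
      rw [e1, e2, h, zero_add, smul_dotProduct, dotProduct_add, dotProduct_smul] at this
      simp only [smul_eq_mul] at this
      linarith
    constructor
    · apply dotProduct_eq_zero_iff.1
      intro y
      have := h1 y 0
      rw [mulVec_zero, sub_zero] at this
      rw [dotProduct_comm, dotProduct_mulVec_transpose, hP, this]
    · apply dotProduct_eq_zero_iff.1
      intro v
      have := h1 0 v
      rw [mulVec_zero, zero_sub, neg_dotProduct, neg_eq_zero] at this
      rw [dotProduct_comm, dotProduct_mulVec_transpose, this]
  -- By `hker'` with zero input, `ker P ∩ ker C` is `A`-invariant, hence unobservable.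
  have hPC : ∀ f, P *ᵥ f = 0 → C *ᵥ f = 0 → f = 0 := by
    intro f h1 h2
    have h3 : ∀ k : ℕ, P *ᵥ ((A ^ k) *ᵥ f) = 0 ∧ C *ᵥ ((A ^ k) *ᵥ f) = 0 := by
      intro k
      induction k with
      | zero => simpa using ⟨h1, h2⟩
      | succ k ih =>
        have := hker' ((A ^ k) *ᵥ f) 0 (by rw [ih.1, mulVec_zero, sub_zero])
        have e : A *ᵥ (A ^ k *ᵥ f) = A ^ (k + 1) *ᵥ f := by rw [mulVec_mulVec, ← pow_succ']
        rwa [mulVec_zero, add_zero, e] at this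
    exact hAC f fun k => by rw [← mulVec_mulVec]; exact (h3 k).2
  let L₁ : Matrix a (a ⊕ b) ℝ := fromCols P (-Cᵀ)
  let L₂ : Matrix a (a ⊕ b) ℝ := fromCols A B
  have hL₁ : ∀ x u, L₁ *ᵥ Sum.elim x u = P *ᵥ x - Cᵀ *ᵥ u := by
    intro x u; simp [L₁, fromCols_mulVec, neg_mulVec, sub_eq_add_neg]
  have hL₂ : ∀ x u, L₂ *ᵥ Sum.elim x u = A *ᵥ x + B *ᵥ u := by
    intro x u; simp [L₂, fromCols_mulVec]
  have hsplit : ∀ w : a ⊕ b → ℝ, ∃ x u, w = Sum.elim x u := fun w =>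
    ⟨fun i => w (Sum.inl i), fun i => w (Sum.inr i), by ext (i | i) <;> rfl⟩
  obtain ⟨Φ, hΦ⟩ := eq_mul_of_kernel_le (L₁ := L₁) (L₂ := L₂) (by
    intro w hw
    obtain ⟨x, u, rfl⟩ := hsplit w
    rw [hL₁] at hw
    rw [hL₂]
    exact hPC _ (hker' x u hw).1 (hker' x u hw).2)
  obtain ⟨R, hR⟩ := eq_mul_of_kernel_le (L₁ := L₂) (L₂ := L₁) (by
    intro w hw
    obtain ⟨x, u, rfl⟩ := hsplit w
    rw [hL₂] at hw
    rw [hL₁]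
    exact hker x u hw)
  have hΦR : Φ * R = 1 := by
    apply Matrix.mulVec_injective
    funext z
    obtain ⟨y, v, rfl⟩ := hAB.exists_eq_add z
    rw [one_mulVec, ← hL₂, mulVec_mulVec, Matrix.mul_assoc, hR, hΦ]
  have hRΦ : R * Φ = 1 := mul_eq_one_comm.1 hΦR
  refine ⟨P, Φ, hP, ?_, ?_, ?_, ?_⟩
  · exact (isUnit_iff_ne_zero.1 ((Matrix.isUnit_iff_isUnit_det _).1 (.of_mul_eq_one _ hΦR)))
  · intro e
    obtain ⟨y, v, hyv⟩ := hAB.exists_eq_add (Φ *ᵥ e)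
    have he : e = P *ᵥ y - Cᵀ *ᵥ v := by
      rw [← hL₁, ← hR, ← mulVec_mulVec, hL₂, ← hyv, mulVec_mulVec, hRΦ, one_mulVec]
    have := hdiss y v
    rwa [← he, ← hyv] at this
  · ext i j
    have := congrFun (congrFun hΦ i) (Sum.inl j)
    simp only [L₁, L₂, mul_fromCols, fromCols_apply_inl] at this
    exact this.symm
  · ext i j
    have := congrFun (congrFun hΦ i) (Sum.inr j)
    simp only [L₁, L₂, mul_fromCols, fromCols_apply_inr, Matrix.mul_neg] at this
    exact this.symm

end PortHamiltonian

/-! ### Imaginary parts of forms, and the frequency inequality in state space. -/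

section ImaginaryPart

variable {b : Type*} [Fintype b]

theorem form_smul_sub_conjTranspose (M : Matrix b b ℂ) (u : b → ℂ) :
    star u ⬝ᵥ ((Complex.I • (M - Mᴴ)) *ᵥ u) = ((-2 * (star u ⬝ᵥ (M *ᵥ u)).im : ℝ) : ℂ) := by
  have h : star u ⬝ᵥ (Mᴴ *ᵥ u) = star (star u ⬝ᵥ (M *ᵥ u)) := by
    rw [star_dotProduct_comm u, star_mulVec, conjTranspose_conjTranspose, ← dotProduct_mulVec]
  rw [smul_mulVec, dotProduct_smul, sub_mulVec, dotProduct_sub, h]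
  apply Complex.ext <;> simp
  ring

theorem im_form_nonpos {M : Matrix b b ℂ} (h : (Complex.I • (M - Mᴴ)).PosSemidef) (u : b → ℂ) :
    (star u ⬝ᵥ (M *ᵥ u)).im ≤ 0 := by
  have := h.dotProduct_mulVec_nonneg u
  rw [form_smul_sub_conjTranspose, Complex.zero_le_real] at this
  linarith

theorem im_form_neg {M : Matrix b b ℂ} (h : (Complex.I • (M - Mᴴ)).PosDef) {u : b → ℂ}
    (hu : u ≠ 0) : (star u ⬝ᵥ (M *ᵥ u)).im < 0 := by
  have := h.dotProduct_mulVec_pos hu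
  rw [form_smul_sub_conjTranspose, Complex.zero_lt_real] at this
  linarith

theorem im_form_cx_eq_zero {M : Matrix b b ℝ} (h : Mᵀ = M) (u : b → ℂ) :
    (star u ⬝ᵥ (cx M *ᵥ u)).im = 0 := by
  have h1 : star u ⬝ᵥ (cx M *ᵥ u) = star (star u ⬝ᵥ (cx M *ᵥ u)) := by
    nth_rewrite 1 [star_dotProduct_cx_mulVec]
    rw [h]; exact star_dotProduct_comm _ _
  have h2 := congrArg Complex.im h1
  rw [Complex.star_def, Complex.conj_im] at h2
  linarith

/-- On `x + i y` the imaginary part is `x · M y - y · M x`, which is odd in `y`; being nonpositive,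
it vanishes. -/
theorem isSymm_of_im_form_nonpos [DecidableEq b] {M : Matrix b b ℝ}
    (h : ∀ u : b → ℂ, (star u ⬝ᵥ (cx M *ᵥ u)).im ≤ 0) : Mᵀ = M := by
  have him : ∀ x y : b → ℝ, (star (vcx x + Complex.I • vcx y) ⬝ᵥ
      (cx M *ᵥ (vcx x + Complex.I • vcx y))).im = x ⬝ᵥ (M *ᵥ y) - y ⬝ᵥ (M *ᵥ x) := by
    intro x y
    rw [mulVec_add, mulVec_smul, vcx_mulVec, vcx_mulVec]
    simp [dotProduct, vcx, sub_eq_add_neg, Finset.sum_add_distrib, add_comm]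
  have h0 : ∀ x y : b → ℝ, x ⬝ᵥ (M *ᵥ y) = y ⬝ᵥ (M *ᵥ x) := by
    intro x y
    have h1 := h (vcx x + Complex.I • vcx y)
    have h2 := h (vcx x + Complex.I • vcx (-y))
    rw [him] at h1 h2
    rw [mulVec_neg, dotProduct_neg, neg_dotProduct] at h2
    linarith
  ext i j
  have := h0 (Pi.single i 1) (Pi.single j 1)
  simp only [mulVec_single_one, single_one_dotProduct, col_apply] at this
  exact this.symm

end ImaginaryPart

section Base

variable {n m : ℕ} {S : StateSpace n m} {G : TransferMatrix m}

theorem im_form_state (h : S.transfer = G) (hD : S.Dᵀ = S.D) {s : ℂ} (hs : IsReg S.A s)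
    (u : Fin m → ℂ) : (star u ⬝ᵥ (cx S.C *ᵥ (res S.A s *ᵥ (cx S.B *ᵥ u)))).im
      = (star u ⬝ᵥ (G.at s *ᵥ u)).im := by
  rw [at_mulVec h hs, dotProduct_add, Complex.add_im, im_form_cx_eq_zero hD, add_zero]

theorem IsNI.im_form_nonpos (hNI : IsNI G) (h : S.transfer = G) (hD : S.Dᵀ = S.D) (ω : ℝ)
    (hω : 0 < ω) (hreg : IsReg S.A (Complex.I * ω)) (u : Fin m → ℂ) :
    (star u ⬝ᵥ (cx S.C *ᵥ (res S.A (Complex.I * ω) *ᵥ (cx S.B *ᵥ u)))).im ≤ 0 := by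
  rw [im_form_state h hD hreg]
  exact NegImag.im_form_nonpos (hNI.freq ω hω (not_isPole_of_det_ne_zero h hreg)) u

theorem IsSNI.im_form_nonpos (hSNI : IsSNI G) (h : S.transfer = G) (hD : S.Dᵀ = S.D) (ω : ℝ)
    (hω : 0 < ω) (hreg : IsReg S.A (Complex.I * ω)) (u : Fin m → ℂ) :
    (star u ⬝ᵥ (cx S.C *ᵥ (res S.A (Complex.I * ω) *ᵥ (cx S.B *ᵥ u)))).im ≤ 0 := by
  rw [im_form_state h hD hreg]
  exact NegImag.im_form_nonpos (hSNI.freq ω hω).posSemidef u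

/-- The frequency inequality passes to the limit `ω → ∞`, where `G(iω)` tends to `D`. -/
theorem IsSNI.D_symm (hSNI : IsSNI G) (h : S.transfer = G) : S.Dᵀ = S.D := by
  refine isSymm_of_im_form_nonpos fun u => ?_
  have h1 : Tendsto (fun ω : ℝ => Complex.I * (ω : ℂ)) atTop (Bornology.cobounded ℂ) := by
    rw [← tendsto_norm_atTop_iff_cobounded]
    simp only [norm_mul, Complex.norm_I, one_mul, Complex.norm_real]
    exact tendsto_norm_atTop_atTop
  have h2 := (tendsto_at_mulVec_cobounded h u).comp h1
  have hc : Continuous fun v : Fin m → ℂ => (star u ⬝ᵥ v).im := by fun_prop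
  have h3 := (hc.tendsto _).comp h2
  refine le_of_tendsto h3 ?_
  filter_upwards [eventually_gt_atTop 0] with ω hω
  exact NegImag.im_form_nonpos (hSNI.freq ω hω).posSemidef u

end Base

/-! ### Lower bound for the Hermitian part of `s G(s)` in the right half-plane. -/

section LowerBound

open Asymptotics

/-- The singularity is removable, and the difference quotient of the extension has a finite limit at
`p`. -/
theorem isBigO_sub_div_of_tendsto {h : ℂ → ℂ} {p r : ℂ}
    (hd : ∀ᶠ s in 𝓝[≠] p, DifferentiableAt ℂ h s) (hr : Tendsto h (𝓝[≠] p) (𝓝 r)) :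
    (fun s => (s - p)⁻¹ * (h s - r)) =O[𝓝[≠] p] (1 : ℂ → ℝ) := by
  set f := Function.update h p r with hf
  have hfs : ∀ s, s ≠ p → f s = h s := fun s hs => Function.update_of_ne hs _ _
  have hc : ContinuousAt f p := continuousAt_update_same.2 hr
  have hdf : ∀ᶠ s in 𝓝[≠] p, DifferentiableAt ℂ f s := by
    filter_upwards [hd, self_mem_nhdsWithin] with s hs hsp
    refine hs.congr_of_eventuallyEq ?_
    filter_upwards [isOpen_ne.mem_nhds hsp] with t ht
    exact hfs t ht
  have han := Complex.analyticAt_of_differentiable_on_punctured_nhds_of_continuousAt hdf hc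
  have hslope := han.differentiableAt.hasDerivAt.tendsto_slope
  refine (hslope.isBigO_one ℝ).congr' ?_ EventuallyEq.rfl
  filter_upwards [self_mem_nhdsWithin] with s hs
  rw [slope_def_field, hfs s hs, hf, Function.update_self, div_eq_inv_mul]

theorem eventually_differentiableAt_eval (f : RatFunc ℝ) (p : ℂ) :
    ∀ᶠ s in 𝓝[≠] p, DifferentiableAt ℂ (fun s => RatFunc.eval (algebraMap ℝ ℂ) s f) s := by
  set q := f.denom.map (algebraMap ℝ ℂ) with hq
  have hq0 : q ≠ 0 := by
    rw [hq, Polynomial.map_ne_zero_iff (algebraMap ℝ ℂ).injective]; exact f.denom_ne_zero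
  have hfin : ({s : ℂ | q.IsRoot s} \ {p}).Finite := (Polynomial.finite_setOfPred_isRoot hq0).sdiff
  have h1 : ({s : ℂ | q.IsRoot s} \ {p})ᶜ ∈ 𝓝 p := hfin.isClosed.isOpen_compl.mem_nhds (by simp)
  filter_upwards [mem_nhdsWithin_of_mem_nhds h1, self_mem_nhdsWithin] with s hs hs'
  have hqs : q.eval s ≠ 0 := fun h0 => hs ⟨h0, hs'⟩
  have he : (fun s => RatFunc.eval (algebraMap ℝ ℂ) s f)
      = fun s => (f.num.map (algebraMap ℝ ℂ)).eval s / q.eval s := by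
    funext s
    rw [RatFunc.eval, hq, Polynomial.eval_map, Polynomial.eval_map]
  rw [he]
  exact (Polynomial.differentiable _).differentiableAt.div
    (Polynomial.differentiable _).differentiableAt hqs

theorem abs_re_form_le {b : Type*} [Fintype b] {E : Matrix b b ℂ} {K : ℝ}
    (h : ∀ i j, ‖E i j‖ ≤ K) (u : b → ℂ) :
    |(star u ⬝ᵥ (E *ᵥ u)).re| ≤ K * Fintype.card b * (star u ⬝ᵥ u).re := by
  have huu : (star u ⬝ᵥ u).re = ∑ i, ‖u i‖ ^ 2 := by
    rw [dotProduct, Complex.re_sum]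
    refine Finset.sum_congr rfl fun i _ => ?_
    rw [Pi.star_apply, Complex.star_def, Complex.conj_mul']
    norm_cast
  have h1 : ‖star u ⬝ᵥ (E *ᵥ u)‖ ≤ ∑ i, ∑ j, K * ((‖u i‖ ^ 2 + ‖u j‖ ^ 2) / 2) := by
    simp only [dotProduct, mulVec, Finset.mul_sum]
    refine (norm_sum_le _ _).trans (Finset.sum_le_sum fun i _ => ?_)
    refine (norm_sum_le _ _).trans (Finset.sum_le_sum fun j _ => ?_)
    rw [norm_mul, norm_mul, Pi.star_apply, norm_star]
    have hK : 0 ≤ K := (norm_nonneg _).trans (h i j)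
    have e1 : ‖u i‖ * (‖E i j‖ * ‖u j‖) ≤ K * (‖u i‖ * ‖u j‖) := by
      have := mul_le_mul_of_nonneg_right (h i j) (mul_nonneg (norm_nonneg (u i)) (norm_nonneg (u j)))
      linarith
    refine e1.trans (mul_le_mul_of_nonneg_left ?_ hK)
    nlinarith [sq_nonneg (‖u i‖ - ‖u j‖)]
  refine (Complex.abs_re_le_norm _).trans (h1.trans_eq ?_)
  rw [huu]
  simp only [← Finset.mul_sum, ← Finset.sum_div, Finset.sum_add_distrib, Finset.sum_const,
    Finset.card_univ, nsmul_eq_mul]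
  ring

variable {m : ℕ} {G : TransferMatrix m}

/-- Near a simple pole of `s G(s)` with positive semidefinite residue, the Hermitian part of
`s G(s)` is bounded below in the right half-plane. -/
theorem eventually_lower_bound {p : ℂ} {R : Matrix (Fin m) (Fin m) ℂ} (hR : R.PosSemidef)
    (hp : p.re = 0 ∨ R = 0)
    (hlim : Tendsto (fun s : ℂ => ((s - p) * s) • G.at s) (𝓝[≠] p) (𝓝 R)) :
    ∃ M : ℝ, ∀ᶠ s in 𝓝[≠] p, 0 < s.re → ∀ u : Fin m → ℂ,
      -(M * (star u ⬝ᵥ u).re) ≤ (star u ⬝ᵥ (s • (G.at s *ᵥ u))).re := by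
  -- Thus `s G(s) = R / (s - p)` plus a bounded remainder.
  have hij : ∀ i j, (fun s => (s - p)⁻¹ * (((s - p) * s) * G.at s i j - R i j))
      =O[𝓝[≠] p] (1 : ℂ → ℝ) := by
    intro i j
    refine isBigO_sub_div_of_tendsto ?_ ?_
    · filter_upwards [eventually_differentiableAt_eval (G i j) p] with s hs
      exact DifferentiableAt.mul (by fun_prop) hs
    · exact tendsto_pi_nhds.1 (tendsto_pi_nhds.1 hlim i) j
  choose c hc using fun i j => (hij i j).bound
  let K : ℝ := ∑ i, ∑ j, |c i j|
  have hcK : ∀ i j, c i j ≤ K := fun i j =>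
    (le_abs_self _).trans ((Finset.single_le_sum (f := fun j => |c i j|)
      (fun _ _ => abs_nonneg _) (Finset.mem_univ j)).trans
      (Finset.single_le_sum (f := fun i => ∑ j, |c i j|)
        (fun _ _ => Finset.sum_nonneg fun _ _ => abs_nonneg _) (Finset.mem_univ i)))
  refine ⟨K * Fintype.card (Fin m), ?_⟩
  have hall : ∀ᶠ s in 𝓝[≠] p, ∀ i j, ‖(s - p)⁻¹ * (((s - p) * s) * G.at s i j - R i j)‖ ≤ K := by
    rw [eventually_all]; intro i
    rw [eventually_all]; intro j
    filter_upwards [hc i j] with s hs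
    refine hs.trans ?_
    simpa using hcK i j
  filter_upwards [hall, self_mem_nhdsWithin] with s hs hsp hre u
  have hsp' : s - p ≠ 0 := sub_ne_zero.2 hsp
  have hE := abs_re_form_le (E := (s - p)⁻¹ • (((s - p) * s) • G.at s - R)) (K := K)
    (fun i j => by simpa [Matrix.smul_apply, Matrix.sub_apply] using hs i j) u
  have hsum : star u ⬝ᵥ (s • (G.at s *ᵥ u))
      = star u ⬝ᵥ (((s - p)⁻¹ • (((s - p) * s) • G.at s - R)) *ᵥ u)
        + (s - p)⁻¹ * (star u ⬝ᵥ (R *ᵥ u)) := by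
    rw [smul_mulVec, sub_mulVec, smul_mulVec, smul_sub, smul_smul, ← mul_assoc,
      inv_mul_cancel₀ hsp', one_mul, dotProduct_sub, dotProduct_smul, dotProduct_smul]
    simp
  -- For `p` on the imaginary axis, `1 / (s - p)` has nonnegative real part in the right half-plane,
  -- so the polar part only helps.
  have hres : 0 ≤ ((s - p)⁻¹ * (star u ⬝ᵥ (R *ᵥ u))).re := by
    rcases hp with hp | hp
    · have h1 := hR.dotProduct_mulVec_nonneg u
      have h2 : ((s - p)⁻¹ * (star u ⬝ᵥ (R *ᵥ u))).re
          = (s - p)⁻¹.re * (star u ⬝ᵥ (R *ᵥ u)).re := by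
        rw [Complex.mul_re, ← (Complex.le_def.1 h1).2]; simp
      rw [h2]
      refine mul_nonneg ?_ (Complex.le_def.1 h1).1
      rw [Complex.inv_re, Complex.sub_re, hp, sub_zero]
      exact div_nonneg hre.le (Complex.normSq_nonneg _)
    · simp [hp]
  rw [hsum, Complex.add_re]
  have := (abs_le.1 hE).1
  linarith

/-- The factor `s` puts every case in one form: a double pole of `G` at zero becomes a simple pole
of `s G(s)` with residue `lim s² G(s)`, and at `iω` the residue is `ω` times the matrix in the
definition. -/
theorem exists_residue (hNI : IsNI G) {p : ℂ} (hre : 0 ≤ p.re) (him : 0 ≤ p.im) :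
    ∃ R : Matrix (Fin m) (Fin m) ℂ, R.PosSemidef ∧ (p.re = 0 ∨ R = 0) ∧
      Tendsto (fun s : ℂ => ((s - p) * s) • G.at s) (𝓝[≠] p) (𝓝 R) := by
  by_cases hpole : IsPole G p
  · have hre0 : p.re = 0 := by
      by_contra hne
      exact hNI.no_pole p (lt_of_le_of_ne hre (Ne.symm hne)) hpole
    have hp : p = Complex.I * (p.im : ℝ) := by
      apply Complex.ext <;> simp [hre0]
    rcases him.eq_or_lt with h0 | hpos
    · have hp0 : p = 0 := Complex.ext hre0 h0.symm
      subst hp0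
      obtain ⟨K, hK, hKpsd⟩ := (hNI.zero_pole hpole).2
      refine ⟨K, hKpsd, Or.inl rfl, hK.congr fun s => ?_⟩
      rw [sub_zero, sq]
    · rw [hp] at hpole
      obtain ⟨K, hK, hKpsd⟩ := (hNI.imag_pole p.im hpos hpole).2
      rw [← hp] at hK
      refine ⟨(p.im : ℂ) • K, hKpsd.smul (by exact_mod_cast him), Or.inl hre0, ?_⟩
      have h1 : Tendsto (fun s : ℂ => -Complex.I * s) (𝓝[≠] p) (𝓝 (p.im : ℂ)) := by
        have : (p.im : ℂ) = -Complex.I * p := by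
          nth_rewrite 2 [hp]
          rw [← mul_assoc, neg_mul, Complex.I_mul_I]; simp
        rw [this]
        exact (Continuous.tendsto (by fun_prop) p).mono_left nhdsWithin_le_nhds
      refine (h1.smul hK).congr fun s => ?_
      rw [smul_smul]
      congr 1
      linear_combination (s * p - s ^ 2) * Complex.I_sq
  · refine ⟨0, PosSemidef.zero, Or.inr rfl, ?_⟩
    have h1 : ContinuousAt (fun s : ℂ => ((s - p) * s) • G.at s) p :=
      ContinuousAt.smul (f := fun s : ℂ => (s - p) * s) (by fun_prop) (continuousAt_at hpole)
    have := h1.tendsto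
    simp only [sub_self, zero_mul, zero_smul] at this
    exact this.mono_left nhdsWithin_le_nhds

/-- Compactness of the closed quarter disc upgrades the local bounds to a uniform one. The quarter
`0 ≤ s.im` suffices because the lower half is reached by conjugation. -/
theorem exists_lower_bound (hNI : IsNI G) (r : ℝ) :
    ∃ M : ℝ, ∀ s : ℂ, 0 < s.re → 0 ≤ s.im → ‖s‖ ≤ r → ∀ u : Fin m → ℂ,
      -(M * (star u ⬝ᵥ u).re) ≤ (star u ⬝ᵥ (s • (G.at s *ᵥ u))).re := by
  let Q : Set ℂ := {s | 0 ≤ s.re} ∩ {s | 0 ≤ s.im} ∩ Metric.closedBall 0 r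
  have hQ : IsCompact Q := by
    refine (isCompact_closedBall (0 : ℂ) r).inter_left ?_
    exact (isClosed_le continuous_const Complex.continuous_re).inter
      (isClosed_le continuous_const Complex.continuous_im)
  have key := hQ.induction_on (p := fun T => ∃ M : ℝ, ∀ s ∈ T, 0 < s.re → ∀ u : Fin m → ℂ,
      -(M * (star u ⬝ᵥ u).re) ≤ (star u ⬝ᵥ (s • (G.at s *ᵥ u))).re) ?_ ?_ ?_ ?_
  · obtain ⟨M, hM⟩ := key
    exact ⟨M, fun s hre him hs => hM s ⟨⟨hre.le, him⟩, by simpa using hs⟩ hre⟩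
  · exact ⟨0, by simp⟩
  · rintro T T' hT ⟨M, hM⟩
    exact ⟨M, fun s hs => hM s (hT hs)⟩
  · rintro T T' ⟨M, hM⟩ ⟨M', hM'⟩
    refine ⟨max M M', fun s hs hre u => ?_⟩
    have hu := star_dotProduct_self_re_nonneg u
    rcases hs with hs | hs
    · have := mul_le_mul_of_nonneg_right (le_max_left M M') hu
      linarith [hM s hs hre u]
    · have := mul_le_mul_of_nonneg_right (le_max_right M M') hu
      linarith [hM' s hs hre u]
  · intro p hp
    obtain ⟨R, hR, hpR, hlim⟩ := exists_residue hNI hp.1.1 hp.1.2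
    obtain ⟨M, hM⟩ := eventually_lower_bound hR hpR hlim
    rw [eventually_nhdsWithin_iff] at hM
    by_cases hre : 0 < p.re
    · let c : ℝ := ∑ i, ∑ j, ‖(p • G.at p) i j‖
      have hbd := abs_re_form_le (E := p • G.at p) (K := c) (fun i j =>
        (Finset.single_le_sum (f := fun j => ‖(p • G.at p) i j‖)
          (fun _ _ => norm_nonneg _) (Finset.mem_univ j)).trans
        (Finset.single_le_sum (f := fun i => ∑ j, ‖(p • G.at p) i j‖)
          (fun _ _ => Finset.sum_nonneg fun _ _ => norm_nonneg _) (Finset.mem_univ i)))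
      refine ⟨_, mem_nhdsWithin_of_mem_nhds hM, max M (c * Fintype.card (Fin m)),
        fun s hs hsre u => ?_⟩
      have hu := star_dotProduct_self_re_nonneg u
      by_cases hsp : s = p
      · subst hsp
        have h1 := (abs_le.1 (hbd u)).1
        rw [smul_mulVec] at h1
        have := mul_le_mul_of_nonneg_right (le_max_right M (c * Fintype.card (Fin m))) hu
        linarith
      · have h1 := hs hsp hsre u
        have := mul_le_mul_of_nonneg_right (le_max_left M (c * Fintype.card (Fin m))) hu
        linarith
    · refine ⟨_, mem_nhdsWithin_of_mem_nhds hM, M, fun s hs hsre u => hs ?_ hsre u⟩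
      rintro rfl
      exact hre hsre

end LowerBound

/-! ### Positivity of the storage matrices. -/

section Storage

variable {n m : ℕ} {S : StateSpace n m} {G : TransferMatrix m}
  {P Φ : Matrix (Fin n) (Fin n) ℝ}

theorem re_star_mulVec_symm {a : Type*} [Fintype a] {P : Matrix a a ℝ} (hP : Pᵀ = P) (x : a → ℂ) :
    (star (cx P *ᵥ x) ⬝ᵥ x).im = 0 := by
  have := im_form_cx_eq_zero hP x
  rwa [star_dotProduct_cx_mulVec, hP] at this

/-- With rate feedback `u = -ε s C x`, there is no nonzero closed-loop eigenvalue in the closed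
right half-plane. -/
theorem no_eigenvalue_rate_feedback (hmin : IsMinimalRealization S G) (hNI : IsNI G) (hD : S.D = 0)
    (hP : Pᵀ = P) (hΦ : ∀ x, x ⬝ᵥ (Φ *ᵥ x) ≤ 0) (hA : S.A = Φ * P) (hB : S.B = -(Φ * S.Cᵀ))
    {r M ε : ℝ} (hM : ∀ s : ℂ, 0 < s.re → 0 ≤ s.im → ‖s‖ ≤ r → ∀ u : Fin m → ℂ,
      -(M * (star u ⬝ᵥ u).re) ≤ (star u ⬝ᵥ (s • (G.at s *ᵥ u))).re)
    (hε : 0 < ε) (hεM : ε * M < 1) {s : ℂ} {x : Fin n → ℂ} (hx : x ≠ 0) (hs0 : s ≠ 0)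
    (hre : 0 ≤ s.re) (him : 0 ≤ s.im) (hsr : ‖s‖ ≤ r)
    (h : cx S.A *ᵥ x = s • (x + (ε : ℂ) • (cx S.B *ᵥ (cx S.C *ᵥ x)))) : False := by
  set v := cx S.C *ᵥ x with hv
  set u : Fin m → ℂ := -((ε * s) • v) with hu
  have hε0 : (ε : ℂ) ≠ 0 := by exact_mod_cast hε.ne'
  have hxu : s • x = cx S.A *ᵥ x + cx S.B *ᵥ u := by
    rw [h, hu, mulVec_neg, mulVec_smul]; module
  have hsv : s • v = -((ε : ℂ)⁻¹ • u) := by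
    rw [hu, smul_neg, neg_neg, smul_smul, ← mul_assoc, inv_mul_cancel₀ hε0, one_mul]
  have hv0 : u = 0 → v = 0 := by
    intro h0
    rw [h0, smul_zero, neg_zero] at hsv
    exact (smul_eq_zero.1 hsv).resolve_left hs0
  have hfin : u = 0 → False := by
    intro h0
    have hAx : cx S.A *ᵥ x = s • x := by rw [hxu, h0, mulVec_zero, add_zero]
    exact hx (hmin.observable.eq_zero_of_eigenvector hAx (hv0 h0))
  have hform : (star u ⬝ᵥ (s • v)).re = -(ε⁻¹ * (star u ⬝ᵥ u).re) := by
    rw [hsv, dotProduct_neg, dotProduct_smul, smul_eq_mul, Complex.neg_re, ← Complex.ofReal_inv,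
      Complex.re_ofReal_mul]
  have huu := star_dotProduct_self_re_nonneg u
  rcases hre.eq_or_lt with hre | hre
  -- On the imaginary axis the stored energy does not contribute, and dissipation gives `ε⁻¹ ‖u‖² ≤
  -- 0`.
  · set e : Fin n → ℂ := cx P *ᵥ x - cx S.Cᵀ *ᵥ u with he
    have hΦe : cx Φ *ᵥ e = s • x := by
      rw [hxu, hA, hB, he, mulVec_sub, cx_neg, cx_mul, cx_mul, neg_mulVec, ← mulVec_mulVec,
        ← mulVec_mulVec, sub_eq_add_neg]
    have h1 := re_form_nonpos hΦ e
    rw [hΦe] at h1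
    have h2 : (star e ⬝ᵥ (s • x)).re = -(star u ⬝ᵥ (s • v)).re := by
      have e1 : star (cx S.Cᵀ *ᵥ u) ⬝ᵥ x = star u ⬝ᵥ v := by
        rw [hv, star_dotProduct_cx_mulVec]
      have e2 : (s * (star (cx P *ᵥ x) ⬝ᵥ x)).re = 0 := by
        rw [Complex.mul_re, re_star_mulVec_symm hP, ← hre]; simp
      rw [dotProduct_smul, dotProduct_smul, he, star_sub, sub_dotProduct, e1, smul_eq_mul,
        smul_eq_mul, mul_sub, Complex.sub_re, e2, zero_sub]
    rw [h2, hform, neg_neg] at h1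
    have h3 : 0 ≤ ε⁻¹ * (star u ⬝ᵥ u).re := mul_nonneg (inv_nonneg.2 hε.le) huu
    have h4 : (star u ⬝ᵥ u).re = 0 :=
      (mul_eq_zero.1 (le_antisymm h1 h3)).resolve_left (inv_ne_zero hε.ne')
    exact hfin (star_dotProduct_self_re_eq_zero h4)
  -- In the open half-plane `C x = G(s) u`, so the lower bound reads `ε⁻¹ ‖u‖² ≤ M ‖u‖²`, which `ε M
  -- < 1` allows only for `u = 0`.
  · have hreg := isReg_of_not_isPole hmin (hNI.no_pole s hre)
    have hGv : G.at s *ᵥ u = v := by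
      rw [at_mulVec hmin.1 hreg, hD, cx_zero, zero_mulVec, add_zero, ← eq_res_mulVec hreg hxu]
    have h1 := hM s hre him hsr u
    rw [hGv, hform, neg_le_neg_iff, inv_mul_le_iff₀ hε] at h1
    have h4 : (star u ⬝ᵥ u).re = 0 := by
      by_contra hne
      have hpos : 0 < (star u ⬝ᵥ u).re := lt_of_le_of_ne huu (Ne.symm hne)
      nlinarith
    exact hfin (star_dotProduct_self_re_eq_zero h4)

/-- The storage matrix of a negative imaginary system is positive semidefinite. -/
theorem storage_posSemidef (hmin : IsMinimalRealization S G) (hNI : IsNI G) (hD : S.D = 0)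
    (hP : Pᵀ = P) (hΦdet : Φ.det ≠ 0) (hΦ : ∀ x, x ⬝ᵥ (Φ *ᵥ x) ≤ 0) (hA : S.A = Φ * P)
    (hB : S.B = -(Φ * S.Cᵀ)) : P.PosSemidef := by
  obtain ⟨a, ha0, ha⟩ := exists_mulVec_bound (cx S.A)
  obtain ⟨k, hk0, hk⟩ := exists_mulVec_bound (cx (S.B * S.C))
  obtain ⟨M, hM⟩ := exists_lower_bound hNI (2 * a)
  -- The bound `ε k < 1/2` keeps the eigenvalues of the modified matrix in the disc of radius `2 a`
  -- where `M` is valid, so `M` can be fixed before `ε`.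
  obtain ⟨ε, hε, hεM, hεk, hεdet⟩ : ∃ ε : ℝ, 0 < ε ∧ ε * M < 1 ∧ ε * k < 1 / 2 ∧
      (1 + ε • (S.B * S.C)).det ≠ 0 := by
    have h1 : ∀ᶠ ε : ℝ in 𝓝[>] 0, ε * M < 1 :=
      ((Continuous.tendsto (by fun_prop : Continuous fun ε : ℝ => ε * M) 0).mono_left
        nhdsWithin_le_nhds).eventually_lt_const (by norm_num)
    have h2 : ∀ᶠ ε : ℝ in 𝓝[>] 0, ε * k < 1 / 2 :=
      ((Continuous.tendsto (by fun_prop : Continuous fun ε : ℝ => ε * k) 0).mono_left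
        nhdsWithin_le_nhds).eventually_lt_const (by norm_num)
    have hc : Continuous fun ε : ℝ => (1 + ε • (S.B * S.C)).det :=
      Continuous.matrix_det (by fun_prop)
    have h3 : ∀ᶠ ε : ℝ in 𝓝[>] 0, (1 + ε • (S.B * S.C)).det ≠ 0 :=
      ((hc.tendsto 0).mono_left nhdsWithin_le_nhds).eventually_ne (by simp)
    obtain ⟨ε, ⟨⟨h1, h2⟩, h3⟩, h4⟩ := (((h1.and h2).and h3).and self_mem_nhdsWithin).exists
    exact ⟨ε, h4, h1, h2, h3⟩
  set N : Matrix (Fin n) (Fin n) ℝ := 1 + ε • (S.B * S.C) with hN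
  set Aε := N⁻¹ * S.A with hAε
  have hNA : N * Aε = S.A := by
    rw [hAε, ← Matrix.mul_assoc, mul_nonsing_inv _ (isUnit_iff_ne_zero.2 hεdet), Matrix.one_mul]
  obtain ⟨Y, hY⟩ := exists_generalized_inverse P
  -- A projection onto `ker P`. Subtracting it moves the remaining zero eigenvalues of `Aε` to `-1`
  -- without changing the energy balance, as `P Q = 0`.
  set Q : Matrix (Fin n) (Fin n) ℝ := 1 - Y * P with hQ
  have hPQ : P * Q = 0 := by
    rw [hQ, Matrix.mul_sub, Matrix.mul_one, ← Matrix.mul_assoc, hY, sub_self]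
  have hAQ : Aε * Q = 0 := by
    rw [hAε, hA, Matrix.mul_assoc, Matrix.mul_assoc Φ, hPQ]; simp
  have hQfix : ∀ x : Fin n → ℂ, cx P *ᵥ x = 0 → cx Q *ᵥ x = x := by
    intro x hx
    rw [hQ, cx_sub, cx_one, cx_mul, sub_mulVec, one_mulVec, ← mulVec_mulVec, hx, mulVec_zero,
      sub_zero]
  have hcxN : ∀ y : Fin n → ℂ, cx N *ᵥ y = y + (ε : ℂ) • (cx S.B *ᵥ (cx S.C *ᵥ y)) := by
    intro y
    rw [hN, cx_add, cx_one, cx_smul, add_mulVec, one_mulVec, smul_mulVec, cx_mul, mulVec_mulVec]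
  have hnoeig : ∀ (z : ℂ) (x : Fin n → ℂ), x ≠ 0 → z ≠ 0 → 0 ≤ z.re →
      cx Aε *ᵥ x = z • x → False := by
    have key : ∀ (z : ℂ) (x : Fin n → ℂ), x ≠ 0 → z ≠ 0 → 0 ≤ z.re → 0 ≤ z.im →
        cx Aε *ᵥ x = z • x → False := by
      intro z x hx hz hre him h
      have h1 : cx S.A *ᵥ x = z • (x + (ε : ℂ) • (cx S.B *ᵥ (cx S.C *ᵥ x))) := by
        rw [← hNA, cx_mul, ← mulVec_mulVec, h, mulVec_smul, hcxN]
      have hnorm : ‖z‖ ≤ 2 * a := by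
        have h2 : z • x = cx S.A *ᵥ x - (ε : ℂ) • (cx (S.B * S.C) *ᵥ (z • x)) := by
          rw [h1, cx_mul, ← mulVec_mulVec, mulVec_smul, mulVec_smul]; module
        have h3 : ‖z • x‖ ≤ a * ‖x‖ + ε * (k * ‖z • x‖) := by
          nth_rewrite 1 [h2]
          refine (norm_sub_le _ _).trans (add_le_add (ha x) ?_)
          rw [norm_smul, Complex.norm_real, Real.norm_of_nonneg hε.le]
          exact mul_le_mul_of_nonneg_left (hk _) hε.le
        have h4 : ε * (k * ‖z • x‖) ≤ 1 / 2 * ‖z • x‖ := by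
          rw [← mul_assoc]; exact mul_le_mul_of_nonneg_right hεk.le (norm_nonneg _)
        have h5 : ‖z • x‖ ≤ 2 * a * ‖x‖ := by linarith
        rw [norm_smul] at h5
        exact le_of_mul_le_mul_right h5 (norm_pos_iff.2 hx)
      exact no_eigenvalue_rate_feedback hmin hNI hD hP hΦ hA hB hM hε hεM hx hz hre him hnorm h1
    intro z x hx hz hre h
    rcases le_total 0 z.im with him | him
    · exact key z x hx hz hre him h
    · refine key (star z) (star x) (star_ne_zero.2 hx) (star_ne_zero.2 hz) (by simpa using hre)
        (by simpa using him) ?_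
      rw [star_cx_mulVec, h, star_smul]
  have hNΦ : ∀ x y : Fin n → ℂ, cx S.A *ᵥ x = cx N *ᵥ y →
      y = cx Φ *ᵥ (cx P *ᵥ x + (ε : ℂ) • (cx S.Cᵀ *ᵥ (cx S.C *ᵥ y))) := by
    intro x y h
    rw [hcxN, hA, hB, cx_mul, cx_neg, cx_mul, neg_mulVec, smul_neg, ← mulVec_mulVec] at h
    rw [mulVec_add, mulVec_smul, h, mulVec_mulVec _ (cx Φ)]
    module
  have hker : ∀ x : Fin n → ℂ, cx S.A *ᵥ x = 0 → cx P *ᵥ x = 0 := by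
    intro x h
    rw [hA, cx_mul, ← mulVec_mulVec] at h
    have hu : (cx Φ).det ≠ 0 := by rw [det_cx]; exact_mod_cast hΦdet
    exact eq_zero_of_mulVec_eq_zero hu h
  have hHur : IsHurwitz (Aε - Q) := by
    rw [isHurwitz_iff]
    intro z x hx hz
    by_contra! hre
    rw [cx_sub, sub_mulVec] at hz
    set κ := cx Q *ᵥ x with hκ
    have hPκ : cx P *ᵥ κ = 0 := by rw [hκ, mulVec_mulVec, ← cx_mul, hPQ, cx_zero, zero_mulVec]
    have hAκ : cx Aε *ᵥ κ = 0 := by rw [hκ, mulVec_mulVec, ← cx_mul, hAQ, cx_zero, zero_mulVec]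
    have hQκ := hQfix κ hPκ
    rw [sub_eq_iff_eq_add] at hz
    -- For `z = 0`, `Aε x = κ` would be a Jordan chain at zero; the rate feedback excludes it, since
    -- dissipation gives `ε ‖C κ‖² ≤ 0` and observability then `κ = 0`. For `z ≠ 0`, `x + z⁻¹ κ` is
    -- an eigenvector of `Aε` unless it vanishes, and it can vanish only if `z = -1` or `κ = 0`.
    by_cases hz0 : z = 0
    · subst hz0
      rw [zero_smul, zero_add] at hz
      have h1 : cx S.A *ᵥ x = cx N *ᵥ κ := by rw [← hNA, cx_mul, ← mulVec_mulVec, hz]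
      have h2 := hNΦ x κ h1
      set e := cx P *ᵥ x + (ε : ℂ) • (cx S.Cᵀ *ᵥ (cx S.C *ᵥ κ)) with he
      have h3 := re_form_nonpos hΦ e
      rw [← h2] at h3
      have e1 : star (cx P *ᵥ x) ⬝ᵥ κ = 0 := by
        have := star_dotProduct_cx_mulVec P x κ
        rw [hPκ, dotProduct_zero, hP] at this
        exact this.symm
      have e2 : star ((ε : ℂ) • (cx S.Cᵀ *ᵥ (cx S.C *ᵥ κ))) ⬝ᵥ κ
          = (ε : ℂ) * (star (cx S.C *ᵥ κ) ⬝ᵥ (cx S.C *ᵥ κ)) := by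
        rw [star_smul, smul_dotProduct, star_dotProduct_cx_mulVec S.C, smul_eq_mul]
        simp
      rw [he, star_add, add_dotProduct, e1, e2, zero_add, Complex.re_ofReal_mul] at h3
      have h4 := star_dotProduct_self_re_nonneg (cx S.C *ᵥ κ)
      have h5 : (star (cx S.C *ᵥ κ) ⬝ᵥ (cx S.C *ᵥ κ)).re = 0 := by nlinarith
      have h6 := star_dotProduct_self_re_eq_zero h5
      have hSAκ : cx S.A *ᵥ κ = (0 : ℂ) • κ := by
        rw [hA, cx_mul, ← mulVec_mulVec, hPκ, mulVec_zero, zero_smul]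
      have hκ0 := hmin.observable.eq_zero_of_eigenvector hSAκ h6
      rw [hκ0, mulVec_zero] at h1
      have := hQfix x (hker x h1)
      apply hx
      rw [← this, ← hκ, hκ0]
    · have h1 : cx Aε *ᵥ (x + z⁻¹ • κ) = z • (x + z⁻¹ • κ) := by
        rw [mulVec_add, mulVec_smul, hAκ, smul_zero, add_zero, hz, smul_add, smul_smul,
          mul_inv_cancel₀ hz0, one_smul]
      refine hnoeig z _ ?_ hz0 hre h1
      intro h2
      have h3 : κ = -(z⁻¹ • κ) := by
        have hxx : x = -(z⁻¹ • κ) := eq_neg_of_add_eq_zero_left h2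
        have := congrArg (fun y => cx Q *ᵥ y) hxx
        simp only [mulVec_neg, mulVec_smul, hQκ] at this
        rw [← hκ] at this
        exact this
      have h4 : (1 + z⁻¹) • κ = 0 := by
        rw [add_smul, one_smul]; nth_rewrite 1 [h3]; simp
      rcases smul_eq_zero.1 h4 with h5 | h5
      · have : z = -1 := by
          have h6 : z⁻¹ = -1 := by linear_combination h5
          rw [← inv_inv z, h6]; norm_num
        rw [this] at hre
        norm_num at hre
      · rw [h5, smul_zero, add_zero] at h2
        exact hx h2
  refine posSemidef_of_lyapunov hHur hP fun x => ?_
  have h1 : (P *ᵥ x) ⬝ᵥ (Q *ᵥ x) = 0 := by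
    have := dotProduct_mulVec_transpose P x (Q *ᵥ x)
    rw [hP, mulVec_mulVec, hPQ, zero_mulVec, dotProduct_zero] at this
    exact this.symm
  rw [sub_mulVec, dotProduct_sub, h1, sub_zero]
  set y := Aε *ᵥ x with hy
  have h2 : Φ *ᵥ (P *ᵥ x + ε • (S.Cᵀ *ᵥ (S.C *ᵥ y))) = y := by
    have h3 : N *ᵥ y = S.A *ᵥ x := by rw [hy, mulVec_mulVec, hNA]
    rw [hN, add_mulVec, one_mulVec, smul_mulVec, ← mulVec_mulVec, hA, hB, neg_mulVec,
      ← mulVec_mulVec, ← mulVec_mulVec] at h3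
    rw [mulVec_add, mulVec_smul, ← h3]
    module
  have h4 := hΦ (P *ᵥ x + ε • (S.Cᵀ *ᵥ (S.C *ᵥ y)))
  rw [h2, add_dotProduct, smul_dotProduct, ← dotProduct_mulVec_transpose] at h4
  have h5 := dotProduct_self_nonneg_real (S.C *ᵥ y)
  have : 0 ≤ ε • ((S.C *ᵥ y) ⬝ᵥ (S.C *ᵥ y)) := mul_nonneg hε.le h5
  linarith

theorem IsSNI.isHurwitz (hSNI : IsSNI G) (hmin : IsMinimalRealization S G) : IsHurwitz S.A := by
  rw [isHurwitz_iff]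
  intro z x hx hz
  by_contra! hre
  have hreg := isReg_of_not_isPole hmin (hSNI.no_pole z hre)
  apply hreg
  refine exists_mulVec_eq_zero_iff.1 ⟨x, hx, ?_⟩
  rw [sub_mulVec, smul_mulVec, one_mulVec, hz, sub_self]

theorem IsHurwitz.det_ne_zero {a : Type*} [Fintype a] [DecidableEq a] {A : Matrix a a ℝ}
    (h : IsHurwitz A) : A.det ≠ 0 := by
  intro h0
  have h1 : (cx A).det = 0 := by rw [det_cx, h0, Complex.ofReal_zero]
  obtain ⟨x, hx, h2⟩ := exists_mulVec_eq_zero_iff.2 h1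
  have := (isHurwitz_iff A).1 h 0 x hx (by rw [h2, zero_smul])
  simp at this

theorem PosSemidef_posDef_of_det {a : Type*} [Fintype a] [DecidableEq a] {P : Matrix a a ℝ}
    (h : P.PosSemidef) (hdet : P.det ≠ 0) : P.PosDef := by
  rw [posDef_real_iff]
  refine ⟨(posSemidef_real_iff.1 h).1, fun x hx => ?_⟩
  refine lt_of_le_of_ne ((posSemidef_real_iff.1 h).2 x) fun h0 => hx ?_
  exact eq_zero_of_mulVec_eq_zero hdet (PosSemidef_mulVec_eq_zero h h0.symm)

/-- Dissipativity of `Φ` is the Lyapunov inequality for `P` along `A = Φ P`; a singular `P` would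
make `A` singular. -/
theorem storage_posDef_of_hurwitz {a : Type*} [Fintype a] [DecidableEq a] {A P Φ : Matrix a a ℝ}
    (hA : IsHurwitz A) (hP : Pᵀ = P) (hΦ : ∀ x, x ⬝ᵥ (Φ *ᵥ x) ≤ 0) (h : A = Φ * P) :
    P.PosDef := by
  refine PosSemidef_posDef_of_det (posSemidef_of_lyapunov hA hP fun x => ?_) fun h0 => ?_
  · rw [h, ← mulVec_mulVec]; exact hΦ _
  · apply hA.det_ne_zero
    rw [h, det_mul, h0, mul_zero]

end Storage

/-! ### Stability of the loop as positivity of a storage matrix. -/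

section ClosedLoop

theorem star_form_re_pos {a : Type*} [Fintype a] {P : Matrix a a ℝ} (hP : P.PosDef) {x : a → ℂ}
    (hx : x ≠ 0) : 0 < (star x ⬝ᵥ (cx P *ᵥ x)).re := by
  rw [posDef_real_iff] at hP
  have key : ∀ v : a → ℝ, 0 ≤ v ⬝ᵥ (P *ᵥ v) := by
    intro v
    rcases eq_or_ne v 0 with rfl | hv
    · simp
    · exact (hP.2 v hv).le
  rw [re_star_dotProduct, vre_mulVec, vim_mulVec]
  by_cases h : vre x = 0
  · have h2 : vim x ≠ 0 := fun h2 => hx ((vec_eq_zero_iff x).2 ⟨h, h2⟩)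
    linarith [key (vre x), hP.2 _ h2]
  · linarith [key (vim x), hP.2 _ h]

/-- The storage matrix of the positive feedback interconnection of two port-Hamiltonian systems,
the first one being strictly proper. -/
noncomputable def loopStorage {n n' m : ℕ} (S : StateSpace n m) (T : StateSpace n' m)
    (P : Matrix (Fin n) (Fin n) ℝ) (P' : Matrix (Fin n') (Fin n') ℝ) :
    Matrix (Fin n ⊕ Fin n') (Fin n ⊕ Fin n') ℝ :=
  fromBlocks (P - S.Cᵀ * T.D * S.C) (-(S.Cᵀ * T.C)) (-(T.Cᵀ * S.C)) P'

variable {n n' m : ℕ} {S : StateSpace n m} {T : StateSpace n' m} {G Gbar : TransferMatrix m}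
  {P Φ : Matrix (Fin n) (Fin n) ℝ} {P' Φ' : Matrix (Fin n') (Fin n') ℝ}

theorem closedLoop_of_D_eq_zero (hD : S.D = 0) : closedLoop S T =
    fromBlocks (S.A + S.B * T.D * S.C) (S.B * T.C) (T.B * S.C) T.A := by
  simp [closedLoop, hD]

theorem closedLoop_eq_mul_loopStorage (hD : S.D = 0) (hA : S.A = Φ * P) (hB : S.B = -(Φ * S.Cᵀ))
    (hA' : T.A = Φ' * P') (hB' : T.B = -(Φ' * T.Cᵀ)) :
    closedLoop S T = fromBlocks Φ 0 0 Φ' * loopStorage S T P P' := by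
  rw [closedLoop_of_D_eq_zero hD, loopStorage, fromBlocks_multiply, hA, hB, hA', hB']
  simp [Matrix.mul_add, Matrix.mul_assoc, sub_eq_add_neg]

theorem loopStorage_transpose (hP : Pᵀ = P) (hP' : P'ᵀ = P') (hDs : T.Dᵀ = T.D) :
    (loopStorage S T P P')ᵀ = loopStorage S T P P' := by
  simp [loopStorage, fromBlocks_transpose, transpose_mul, hP, hP', hDs, Matrix.mul_assoc]

/-- Schur complement with respect to `P'`: the factorization of the second system gives `Ḡ(0) = D +
C P'⁻¹ Cᵀ`, so completing the square in its state leaves `P - Cᵀ Ḡ(0) C`. -/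
theorem posDef_loopStorage_iff (hT : T.transfer = Gbar) (hP : Pᵀ = P) (hP' : P'.PosDef)
    (hDs : T.Dᵀ = T.D) (hΦ' : Φ'.det ≠ 0) (hA' : T.A = Φ' * P') (hB' : T.B = -(Φ' * T.Cᵀ)) :
    (loopStorage S T P P').PosDef ↔ (P - S.Cᵀ * dcGain Gbar * S.C).PosDef := by
  have hP's := (posDef_real_iff.1 hP').1
  have hdetP' : P'.det ≠ 0 := hP'.det_pos.ne'
  have hN : dcGain Gbar = T.D + T.C * P'⁻¹ * T.Cᵀ := by
    rw [dcGain_eq hT (by rw [hA', det_mul]; exact mul_ne_zero hΦ' hdetP'), hA', hB',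
      Matrix.mul_inv_rev]
    simp only [Matrix.mul_neg, sub_neg_eq_add, ← Matrix.mul_assoc]
    rw [Matrix.mul_assoc (T.C * P'⁻¹), nonsing_inv_mul _ (isUnit_iff_ne_zero.2 hΦ'),
      Matrix.mul_one]
  have hNs : (dcGain Gbar)ᵀ = dcGain Gbar := by
    rw [hN]; simp [transpose_mul, hDs, transpose_nonsing_inv, hP's, Matrix.mul_assoc]
  have hQs : (P - S.Cᵀ * dcGain Gbar * S.C)ᵀ = P - S.Cᵀ * dcGain Gbar * S.C := by
    simp [transpose_mul, hNs, hP, Matrix.mul_assoc]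
  have hform : ∀ (w : Fin n ⊕ Fin n' → ℝ), w ⬝ᵥ (loopStorage S T P P' *ᵥ w) =
      (w ∘ Sum.inl) ⬝ᵥ ((P - S.Cᵀ * dcGain Gbar * S.C) *ᵥ (w ∘ Sum.inl)) +
      (w ∘ Sum.inr - P'⁻¹ *ᵥ (T.Cᵀ *ᵥ (S.C *ᵥ (w ∘ Sum.inl)))) ⬝ᵥ
        (P' *ᵥ (w ∘ Sum.inr - P'⁻¹ *ᵥ (T.Cᵀ *ᵥ (S.C *ᵥ (w ∘ Sum.inl))))) := by
    intro w
    set x := w ∘ Sum.inl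
    set y := w ∘ Sum.inr
    set v := S.C *ᵥ x with hv
    set q := T.Cᵀ *ᵥ v with hq
    have e1 : P' *ᵥ (P'⁻¹ *ᵥ q) = q := by
      rw [mulVec_mulVec, mul_nonsing_inv _ (isUnit_iff_ne_zero.2 hdetP'), one_mulVec]
    have e2 : (P'⁻¹ *ᵥ q) ⬝ᵥ (P' *ᵥ y) = q ⬝ᵥ y := by
      rw [dotProduct_mulVec_transpose, hP's, e1]
    have e3 : x ⬝ᵥ (S.Cᵀ *ᵥ (T.C *ᵥ y)) = q ⬝ᵥ y := by
      rw [dotProduct_mulVec_transpose, transpose_transpose, ← hv, dotProduct_mulVec_transpose, hq]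
    have e4 : x ⬝ᵥ (S.Cᵀ *ᵥ (dcGain Gbar *ᵥ v)) = v ⬝ᵥ (T.D *ᵥ v) + q ⬝ᵥ (P'⁻¹ *ᵥ q) := by
      rw [dotProduct_mulVec_transpose, transpose_transpose, ← hv, hN, add_mulVec, dotProduct_add,
        ← mulVec_mulVec, ← hq, ← mulVec_mulVec, dotProduct_mulVec_transpose T.C, ← hq]
    have e5 : x ⬝ᵥ (S.Cᵀ *ᵥ (T.D *ᵥ v)) = v ⬝ᵥ (T.D *ᵥ v) := by
      rw [dotProduct_mulVec_transpose, transpose_transpose, ← hv]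
    rw [loopStorage, fromBlocks_mulVec, dotProduct_block]
    simp only [Function.comp_def, Sum.elim_inl, Sum.elim_inr]
    change x ⬝ᵥ ((P - S.Cᵀ * T.D * S.C) *ᵥ x + (-(S.Cᵀ * T.C)) *ᵥ y) +
      y ⬝ᵥ ((-(T.Cᵀ * S.C)) *ᵥ x + P' *ᵥ y) = _
    simp only [sub_mulVec, neg_mulVec, ← mulVec_mulVec, mulVec_sub, dotProduct_add, dotProduct_sub,
      dotProduct_neg, sub_dotProduct, e1, ← hv, ← hq, e2, e3, e4, e5, dotProduct_comm y q,
      dotProduct_comm (P'⁻¹ *ᵥ q) q]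
    ring
  have hP'nn : ∀ y, 0 ≤ y ⬝ᵥ (P' *ᵥ y) := (posSemidef_real_iff.1 hP'.posSemidef).2
  rw [posDef_real_iff, posDef_real_iff]
  refine ⟨fun h => ⟨hQs, fun x hx => ?_⟩,
    fun h => ⟨loopStorage_transpose hP hP's hDs, fun w hw => ?_⟩⟩
  · set w : Fin n ⊕ Fin n' → ℝ := Sum.elim x (P'⁻¹ *ᵥ (T.Cᵀ *ᵥ (S.C *ᵥ x))) with hw
    have hl : w ∘ Sum.inl = x := by rw [hw, Sum.elim_comp_inl]
    have hr : w ∘ Sum.inr = P'⁻¹ *ᵥ (T.Cᵀ *ᵥ (S.C *ᵥ x)) := by rw [hw, Sum.elim_comp_inr]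
    have := h.2 w fun h0 => hx (by rw [← hl, h0]; rfl)
    rwa [hform, hl, hr, sub_self, mulVec_zero, dotProduct_zero, add_zero] at this
  · rw [hform]
    by_cases hx : w ∘ Sum.inl = 0
    · have hy : w ∘ Sum.inr ≠ 0 := by
        intro hy
        apply hw
        rw [← Sum.elim_comp_inl_inr w, hx, hy]
        ext (i | i) <;> rfl
      rw [hx]
      simp only [mulVec_zero, dotProduct_zero, sub_zero, zero_add]
      exact (posDef_real_iff.1 hP').2 _ hy
    · exact add_pos_of_pos_of_nonneg (h.2 _ hx) (hP'nn _)

/-- The closed loop is again a dissipative matrix times a symmetric one, so the Lyapunov argument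
applies to the whole loop. -/
theorem posDef_loopStorage_of_internallyStable (hD : S.D = 0) (hDs : T.Dᵀ = T.D) (hP : Pᵀ = P)
    (hP' : P'ᵀ = P') (hΦ : ∀ x, x ⬝ᵥ (Φ *ᵥ x) ≤ 0) (hΦ' : ∀ x, x ⬝ᵥ (Φ' *ᵥ x) ≤ 0)
    (hA : S.A = Φ * P) (hB : S.B = -(Φ * S.Cᵀ)) (hA' : T.A = Φ' * P')
    (hB' : T.B = -(Φ' * T.Cᵀ)) (h : InternallyStable S T) : (loopStorage S T P P').PosDef := by
  refine storage_posDef_of_hurwitz h.2 (loopStorage_transpose hP hP' hDs) (fun x => ?_)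
    (closedLoop_eq_mul_loopStorage hD hA hB hA' hB')
  rw [fromBlocks_mulVec, dotProduct_block]
  simp only [zero_mulVec, add_zero, zero_add, Sum.elim_comp_inl, Sum.elim_comp_inr]
  linarith [hΦ (x ∘ Sum.inl), hΦ' (x ∘ Sum.inr)]

/-- A positive definite loop storage matrix excludes closed-loop eigenvalues in the closed upper
right quadrant. -/
theorem re_neg_of_posDef_loopStorage (hS : IsMinimalRealization S G)
    (hT : IsMinimalRealization T Gbar) (hSNI : IsSNI Gbar) (hDs : T.Dᵀ = T.D)
    (hΦdet : Φ.det ≠ 0) (hΦdet' : Φ'.det ≠ 0)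
    (hΦ : ∀ x, x ⬝ᵥ (Φ *ᵥ x) ≤ 0) (hΦ' : ∀ x, x ⬝ᵥ (Φ' *ᵥ x) ≤ 0)
    (hP : Pᵀ = P) (hP' : P'ᵀ = P')
    (hA : S.A = Φ * P) (hB : S.B = -(Φ * S.Cᵀ)) (hA' : T.A = Φ' * P')
    (hB' : T.B = -(Φ' * T.Cᵀ)) (h : (loopStorage S T P P').PosDef) {z : ℂ} (hz : 0 ≤ z.im)
    {x : Fin n → ℂ} {y : Fin n' → ℂ} (hxy : x = 0 → y ≠ 0)
    (hx : cx S.A *ᵥ x + cx S.B *ᵥ (cx T.D *ᵥ (cx S.C *ᵥ x) + cx T.C *ᵥ y) = z • x)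
    (hy : cx T.A *ᵥ y + cx T.B *ᵥ (cx S.C *ᵥ x) = z • y) : z.re < 0 := by
  set v := cx S.C *ᵥ x with hv
  set u := cx T.D *ᵥ v + cx T.C *ᵥ y with hu
  set e := cx P *ᵥ x - cx S.Cᵀ *ᵥ u with he
  set e' := cx P' *ᵥ y - cx T.Cᵀ *ᵥ v with he'
  have hΦe : cx Φ *ᵥ e = z • x := by
    rw [← hx, hA, hB, he, mulVec_sub, cx_neg, cx_mul, cx_mul, neg_mulVec, ← mulVec_mulVec,
      ← mulVec_mulVec, sub_eq_add_neg]
  have hΦe' : cx Φ' *ᵥ e' = z • y := by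
    rw [← hy, hA', hB', he', mulVec_sub, cx_neg, cx_mul, cx_mul, neg_mulVec, ← mulVec_mulVec,
      ← mulVec_mulVec, sub_eq_add_neg]
  have h1 := re_form_nonpos hΦ e
  have h2 := re_form_nonpos hΦ' e'
  rw [hΦe, dotProduct_smul, smul_eq_mul] at h1
  rw [hΦe', dotProduct_smul, smul_eq_mul] at h2
  have eT : star (cx T.Cᵀ *ᵥ v) ⬝ᵥ y = star v ⬝ᵥ (cx T.C *ᵥ y) := by
    rw [star_dotProduct_cx_mulVec T.C]
  -- The coupling terms of the two subsystems have opposite imaginary parts. Adding the two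
  -- dissipation inequalities cancels them and leaves `z.re` times the positive loop energy.
  have him : (star e' ⬝ᵥ y).im = -(star v ⬝ᵥ (cx T.C *ᵥ y)).im := by
    rw [he', star_sub, sub_dotProduct, Complex.sub_im, re_star_mulVec_symm hP', eT, zero_sub]
  have hD0 : (star v ⬝ᵥ (cx T.D *ᵥ v)).im = 0 := im_form_cx_eq_zero hDs v
  have him' : (star e ⬝ᵥ x).im = (star v ⬝ᵥ (cx T.C *ᵥ y)).im := by
    have e1 : star (cx S.Cᵀ *ᵥ u) ⬝ᵥ x = star u ⬝ᵥ v := by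
      rw [hv, star_dotProduct_cx_mulVec]
    rw [he, star_sub, sub_dotProduct, Complex.sub_im, re_star_mulVec_symm hP, e1, zero_sub,
      star_dotProduct_comm, Complex.star_def, Complex.conj_im, neg_neg, hu, dotProduct_add,
      Complex.add_im, hD0, zero_add]
  have hpos : 0 < (star e ⬝ᵥ x).re + (star e' ⬝ᵥ y).re := by
    set w : Fin n ⊕ Fin n' → ℂ := Sum.elim x y with hw
    have hw0 : w ≠ 0 := by
      intro h0
      refine hxy ?_ ?_
      · rw [← Sum.elim_comp_inl x y, ← hw, h0]; rfl
      · rw [← Sum.elim_comp_inr x y, ← hw, h0]; rfl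
    have h3 := star_form_re_pos h hw0
    have h4 : cx (loopStorage S T P P') *ᵥ w = Sum.elim e e' := by
      rw [loopStorage, cx, fromBlocks_map, fromBlocks_mulVec, hw, Sum.elim_comp_inl,
        Sum.elim_comp_inr]
      change Sum.elim (cx (P - S.Cᵀ * T.D * S.C) *ᵥ x + cx (-(S.Cᵀ * T.C)) *ᵥ y)
        (cx (-(T.Cᵀ * S.C)) *ᵥ x + cx P' *ᵥ y) = _
      congr 1
      · simp only [cx_sub, cx_neg, cx_mul, sub_mulVec, neg_mulVec, ← mulVec_mulVec, ← hv]
        rw [he, hu, mulVec_add]; abel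
      · simp only [cx_neg, cx_mul, neg_mulVec, ← mulVec_mulVec, ← hv]
        rw [he']; abel
    rw [re_star_dotProduct_comm, h4, dotProduct_block, Complex.add_re] at h3
    have h5 : star (Sum.elim e e') ∘ Sum.inl = star e := rfl
    have h6 : star (Sum.elim e e') ∘ Sum.inr = star e' := rfl
    rwa [h5, h6, hw, Sum.elim_comp_inl, Sum.elim_comp_inr] at h3
  rw [Complex.mul_re] at h1 h2
  rw [him'] at h1
  rw [him] at h2
  set t := (star v ⬝ᵥ (cx T.C *ᵥ y)).im with ht
  -- Only `z.re = 0` is left. At `z = 0` invertibility of `Φ` and `Φ'` gives `e = e' = 0`, against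
  -- `hpos`; at `z ≠ 0` the coupling term vanishes, the strict inequality for `Ḡ` forces `v = 0`,
  -- and observability ends the argument.
  by_contra! hre
  have hre0 : z.re = 0 := by
    by_contra hne
    have : 0 < z.re := lt_of_le_of_ne hre (Ne.symm hne)
    nlinarith
  rw [hre0] at h1 h2
  have hzt : z.im * t = 0 := by linarith
  by_cases hz0 : z = 0
  · rw [hz0, zero_smul] at hΦe hΦe'
    have q1 : e = 0 := eq_zero_of_mulVec_eq_zero (by rw [det_cx]; exact_mod_cast hΦdet) hΦe
    have q2 : e' = 0 := eq_zero_of_mulVec_eq_zero (by rw [det_cx]; exact_mod_cast hΦdet') hΦe'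
    rw [q1, q2] at hpos
    simp at hpos
  have hzim : z.im ≠ 0 := fun h0 => hz0 (Complex.ext hre0 h0)
  have ht0 : t = 0 := (mul_eq_zero.1 hzt).resolve_left hzim
  have hzeq : z = Complex.I * (z.im : ℂ) := by
    apply Complex.ext <;> simp [hre0]
  have hreg : IsReg T.A z := isReg_of_not_isPole hT (hSNI.no_pole z hre)
  have hyres : y = res T.A z *ᵥ (cx T.B *ᵥ v) := eq_res_mulVec hreg hy.symm
  have hGv : Gbar.at z *ᵥ v = cx T.C *ᵥ y + cx T.D *ᵥ v := by
    rw [at_mulVec hT.1 hreg, ← hyres]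
  have hv0 : v = 0 := by
    by_contra hv0
    have h3 := im_form_neg (hSNI.freq z.im (lt_of_le_of_ne hz (Ne.symm hzim))) hv0
    rw [← hzeq, hGv, dotProduct_add, Complex.add_im, hD0, ← ht, ht0, add_zero] at h3
    exact lt_irrefl _ h3
  have hy0 : y = 0 := by rw [hyres, hv0, mulVec_zero, mulVec_zero]
  refine hxy ?_ hy0
  refine hS.observable.eq_zero_of_eigenvector (z := z) ?_ hv0
  rw [← hx, hu, hv0, hy0]; simp

theorem internallyStable_of_posDef_loopStorage (hS : IsMinimalRealization S G)
    (hT : IsMinimalRealization T Gbar) (hSNI : IsSNI Gbar) (hD : S.D = 0) (hDs : T.Dᵀ = T.D)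
    (hΦdet : Φ.det ≠ 0) (hΦdet' : Φ'.det ≠ 0)
    (hΦ : ∀ x, x ⬝ᵥ (Φ *ᵥ x) ≤ 0) (hΦ' : ∀ x, x ⬝ᵥ (Φ' *ᵥ x) ≤ 0)
    (hP : Pᵀ = P) (hP' : P'ᵀ = P')
    (hA : S.A = Φ * P) (hB : S.B = -(Φ * S.Cᵀ)) (hA' : T.A = Φ' * P')
    (hB' : T.B = -(Φ' * T.Cᵀ)) (h : (loopStorage S T P P').PosDef) : InternallyStable S T := by
  refine ⟨by simp [hD], ?_⟩
  rw [isHurwitz_iff, closedLoop_of_D_eq_zero hD]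
  have key : ∀ (z : ℂ) (w : Fin n ⊕ Fin n' → ℂ), w ≠ 0 → 0 ≤ z.im →
      cx (fromBlocks (S.A + S.B * T.D * S.C) (S.B * T.C) (T.B * S.C) T.A) *ᵥ w = z • w →
      z.re < 0 := by
    intro z w hw hz hzw
    have h4 : cx (fromBlocks (S.A + S.B * T.D * S.C) (S.B * T.C) (T.B * S.C) T.A) *ᵥ w =
        Sum.elim (cx (S.A + S.B * T.D * S.C) *ᵥ (w ∘ Sum.inl) + cx (S.B * T.C) *ᵥ (w ∘ Sum.inr))
          (cx (T.B * S.C) *ᵥ (w ∘ Sum.inl) + cx T.A *ᵥ (w ∘ Sum.inr)) := by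
      rw [cx, fromBlocks_map, fromBlocks_mulVec]; rfl
    rw [h4] at hzw
    have h5 := congrArg (fun f => f ∘ Sum.inl) hzw
    have h6 := congrArg (fun f => f ∘ Sum.inr) hzw
    simp only [Sum.elim_comp_inl, Sum.elim_comp_inr] at h5 h6
    refine re_neg_of_posDef_loopStorage hS hT hSNI hDs hΦdet hΦdet' hΦ hΦ' hP hP' hA hB hA' hB' h hz
      (x := w ∘ Sum.inl) (y := w ∘ Sum.inr) (fun hx hy => hw ?_) ?_ ?_
    · rw [← Sum.elim_comp_inl_inr w, hx, hy]
      ext (i | i) <;> rfl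
    · change _ = (z • w) ∘ Sum.inl
      rw [← h5]
      simp only [cx_add, cx_mul, add_mulVec, ← mulVec_mulVec, mulVec_add]
      abel
    · change _ = (z • w) ∘ Sum.inr
      rw [← h6]
      simp only [cx_mul, ← mulVec_mulVec]
      abel
  intro z w hw hzw
  rcases le_total 0 z.im with him | him
  · exact key z w hw him hzw
  · have := key (star z) (star w) (star_ne_zero.2 hw) (by simpa using him)
      (by rw [star_cx_mulVec, hzw, star_smul])
    simpa using this

/-- The interconnection is internally stable exactly when `P - Cᵀ Ḡ(0) C` is positive definite. -/
theorem internallyStable_iff (hS : IsMinimalRealization S G) (hT : IsMinimalRealization T Gbar)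
    (hSNI : IsSNI Gbar) (hD : S.D = 0) (hΦdet : Φ.det ≠ 0) (hΦ : ∀ x, x ⬝ᵥ (Φ *ᵥ x) ≤ 0)
    (hP : Pᵀ = P) (hA : S.A = Φ * P) (hB : S.B = -(Φ * S.Cᵀ)) :
    InternallyStable S T ↔ (P - S.Cᵀ * dcGain Gbar * S.C).PosDef := by
  have hDs := hSNI.D_symm hT.1
  obtain ⟨P', Φ', hP', hΦdet', hΦ', hA', hB'⟩ := exists_port_hamiltonian hT.controllable
    hT.observable (hSNI.im_form_nonpos hT.1 hDs)
  have hP'pos := storage_posDef_of_hurwitz (hSNI.isHurwitz hT) hP' hΦ' hA'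
  rw [← posDef_loopStorage_iff hT.1 hP hP'pos hDs hΦdet' hA' hB']
  exact ⟨posDef_loopStorage_of_internallyStable hD hDs hP hP' hΦ hΦ' hA hB hA' hB',
    internallyStable_of_posDef_loopStorage hS hT hSNI hD hDs hΦdet hΦdet' hΦ hΦ' hP hP'
      hA hB hA' hB'⟩

theorem IsSNI.dcGain_transpose (hSNI : IsSNI Gbar) (hT : IsMinimalRealization T Gbar) :
    (dcGain Gbar)ᵀ = dcGain Gbar := by
  have hDs := hSNI.D_symm hT.1
  obtain ⟨P', Φ', hP', hΦdet', -, hA', hB'⟩ := exists_port_hamiltonian hT.controllable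
    hT.observable (hSNI.im_form_nonpos hT.1 hDs)
  have hdet := (hSNI.isHurwitz hT).det_ne_zero
  rw [dcGain_eq hT.1 hdet, hA', hB', Matrix.mul_inv_rev]
  simp only [Matrix.mul_neg, sub_neg_eq_add, ← Matrix.mul_assoc]
  rw [Matrix.mul_assoc (T.C * P'⁻¹), nonsing_inv_mul _ (isUnit_iff_ne_zero.2 hΦdet'),
    Matrix.mul_one]
  simp [transpose_mul, hDs, transpose_nonsing_inv, hP', Matrix.mul_assoc]

end ClosedLoop

/-! ### Structure of `A` at the eigenvalue zero and the origin expansion. -/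

section Origin

/-- By rank–nullity, the inclusion of kernels makes the ranges of `M N` and `M` equal. -/
theorem exists_mul_mulVec_eq {a : Type*} [Fintype a] {M N : Matrix a a ℝ}
    (h : ∀ x, (M * N) *ᵥ x = 0 → M *ᵥ x = 0) (x : a → ℝ) : ∃ y, M *ᵥ x = (M * N) *ᵥ y := by
  have hle : LinearMap.range (M * N).mulVecLin ≤ LinearMap.range M.mulVecLin := by
    rintro _ ⟨y, rfl⟩
    exact ⟨N *ᵥ y, by simp⟩
  have hker : LinearMap.ker (M * N).mulVecLin ≤ LinearMap.ker M.mulVecLin := by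
    intro y hy
    simp only [LinearMap.mem_ker, mulVecLin_apply] at hy ⊢
    exact h y hy
  have h1 := LinearMap.finrank_range_add_finrank_ker (M * N).mulVecLin
  have h2 := LinearMap.finrank_range_add_finrank_ker M.mulVecLin
  have h3 := Submodule.finrank_mono hker
  have h4 := Submodule.eq_of_le_of_finrank_le hle (by omega)
  have h5 : M *ᵥ x ∈ LinearMap.range (M * N).mulVecLin := by
    rw [h4]; exact ⟨x, rfl⟩
  obtain ⟨y, hy⟩ := h5
  exact ⟨y, hy.symm⟩

variable {n m : ℕ} {S : StateSpace n m} {G : TransferMatrix m}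
  {P Φ : Matrix (Fin n) (Fin n) ℝ} {G₀ G₁ G₂ : Matrix (Fin m) (Fin m) ℝ}

/-- A strictly proper port-Hamiltonian form with positive semidefinite storage. -/
structure IsPortHamiltonian (S : StateSpace n m) (P Φ : Matrix (Fin n) (Fin n) ℝ) : Prop where
  posSemidef : P.PosSemidef
  det_ne_zero : Φ.det ≠ 0
  form_nonpos : ∀ x, x ⬝ᵥ (Φ *ᵥ x) ≤ 0
  A_eq : S.A = Φ * P
  B_eq : S.B = -(Φ * S.Cᵀ)

namespace IsPortHamiltonian

theorem symm (h : IsPortHamiltonian S P Φ) : Pᵀ = P := (posSemidef_real_iff.1 h.posSemidef).1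

theorem symm_form (h : IsPortHamiltonian S P Φ) (x y : Fin n → ℝ) :
    x ⬝ᵥ (P *ᵥ y) = y ⬝ᵥ (P *ᵥ x) := by
  rw [dotProduct_mulVec_transpose, h.symm, dotProduct_comm]

theorem A_mulVec (h : IsPortHamiltonian S P Φ) (x : Fin n → ℝ) : S.A *ᵥ x = Φ *ᵥ (P *ᵥ x) := by
  rw [h.A_eq, mulVec_mulVec]

theorem B_mulVec (h : IsPortHamiltonian S P Φ) (u : Fin m → ℝ) :
    S.B *ᵥ u = -(Φ *ᵥ (S.Cᵀ *ᵥ u)) := by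
  rw [h.B_eq, mulVec_mulVec, neg_mulVec]

theorem A_mulVec_eq_zero_iff (h : IsPortHamiltonian S P Φ) {x : Fin n → ℝ} :
    S.A *ᵥ x = 0 ↔ P *ᵥ x = 0 := by
  rw [h.A_mulVec]
  refine ⟨fun h1 => eq_zero_of_mulVec_eq_zero h.det_ne_zero h1, fun h1 => by rw [h1, mulVec_zero]⟩

/-- On the generalized kernel the dissipation vanishes, `(P x) · Φ (P x) = x · P (A x) = 0`, so the
symmetric part of `Φ` annihilates `P x` and `Φ` acts there as a skew matrix. -/
theorem transpose_mulVec (h : IsPortHamiltonian S P Φ) {x : Fin n → ℝ}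
    (hx : S.A *ᵥ (S.A *ᵥ x) = 0) : Φᵀ *ᵥ (P *ᵥ x) = -(S.A *ᵥ x) := by
  have h1 : (P *ᵥ x) ⬝ᵥ (Φ *ᵥ (P *ᵥ x)) = 0 := by
    rw [← h.A_mulVec, ← h.symm, ← dotProduct_mulVec_transpose, h.A_mulVec_eq_zero_iff.1 hx,
      dotProduct_zero]
  have h2 := add_transpose_mulVec_eq_zero h.form_nonpos h1
  rw [add_mulVec, ← h.A_mulVec] at h2
  exact eq_neg_of_add_eq_zero_right h2

/-- Jordan blocks at zero have size at most two: the energy of `A x` equals `-(P x) · (A² x)`, which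
vanishes as `P A² x = 0`; since `P ≥ 0`, this gives `P A x = 0`. -/
theorem A_sq_eq_zero_of_cube (h : IsPortHamiltonian S P Φ) {x : Fin n → ℝ}
    (hx : S.A *ᵥ (S.A *ᵥ (S.A *ᵥ x)) = 0) : S.A *ᵥ (S.A *ᵥ x) = 0 := by
  have h1 := h.transpose_mulVec hx
  have h2 := h.A_mulVec_eq_zero_iff.1 hx
  rw [h.A_mulVec_eq_zero_iff]
  apply PosSemidef_mulVec_eq_zero h.posSemidef
  have h3 : (P *ᵥ x) ⬝ᵥ (Φᵀ *ᵥ (P *ᵥ (S.A *ᵥ x))) = 0 := by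
    rw [h1, dotProduct_neg, ← h.symm, ← dotProduct_mulVec_transpose, h2, dotProduct_zero, neg_zero]
  rwa [dotProduct_mulVec_transpose, transpose_transpose, ← h.A_mulVec] at h3

theorem A_sq_eq_zero_of_pow (h : IsPortHamiltonian S P Φ) (k : ℕ) {x : Fin n → ℝ}
    (hx : (S.A ^ (k + 2)) *ᵥ x = 0) : S.A *ᵥ (S.A *ᵥ x) = 0 := by
  induction k generalizing x with
  | zero => rwa [zero_add, sq, ← mulVec_mulVec] at hx
  | succ k ih =>
    rw [pow_succ, ← mulVec_mulVec] at hx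
    exact h.A_sq_eq_zero_of_cube (ih hx)

/-- Fitting decomposition of the state space at the eigenvalue zero. -/
theorem exists_decomposition (h : IsPortHamiltonian S P Φ) (x : Fin n → ℝ) :
    ∃ x₀ y, S.A *ᵥ (S.A *ᵥ x₀) = 0 ∧ x = x₀ + (S.A ^ 4) *ᵥ y := by
  -- `A²` would suffice for a Fitting decomposition; the fourth power leaves room to cancel the
  -- double pole of the resolvent.
  obtain ⟨y, hy⟩ := exists_mul_mulVec_eq (M := S.A ^ 2) (N := S.A ^ 4) (fun x hx => by
    rw [← pow_add] at hx
    rw [sq, ← mulVec_mulVec]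
    exact h.A_sq_eq_zero_of_pow 4 hx) x
  refine ⟨x - (S.A ^ 4) *ᵥ y, y, ?_, by abel⟩
  rw [mulVec_mulVec, ← sq, mulVec_sub, mulVec_mulVec, ← hy, sub_self]

/-- The range of `A` is `P`-orthogonal to the generalized kernel: the adjoint of `Φ` carries `P x₀`
to `-A x₀`, which lies in `ker P`. -/
theorem form_A_eq_zero (h : IsPortHamiltonian S P Φ) {x₀ : Fin n → ℝ}
    (hx : S.A *ᵥ (S.A *ᵥ x₀) = 0) (w : Fin n → ℝ) : (S.A *ᵥ w) ⬝ᵥ (P *ᵥ x₀) = 0 := by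
  have h1 := h.transpose_mulVec hx
  have h2 := h.A_mulVec_eq_zero_iff.1 hx
  rw [h.A_mulVec]
  have h3 : (Φ *ᵥ (P *ᵥ w)) ⬝ᵥ (P *ᵥ x₀) = (P *ᵥ w) ⬝ᵥ (Φᵀ *ᵥ (P *ᵥ x₀)) := by
    rw [dotProduct_mulVec_transpose Φᵀ, transpose_transpose]
  rw [h3, h1, dotProduct_neg, ← h.symm, ← dotProduct_mulVec_transpose, h2, dotProduct_zero,
    neg_zero]

theorem dotProduct_output (h : IsPortHamiltonian S P Φ) {x₀ : Fin n → ℝ}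
    (hx : S.A *ᵥ (S.A *ᵥ x₀) = 0) (u : Fin m → ℝ) :
    u ⬝ᵥ (S.C *ᵥ (S.A *ᵥ x₀)) = (S.B *ᵥ u) ⬝ᵥ (P *ᵥ x₀) := by
  rw [h.B_mulVec, neg_dotProduct, dotProduct_mulVec_transpose S.C]
  have h3 : (Φ *ᵥ (S.Cᵀ *ᵥ u)) ⬝ᵥ (P *ᵥ x₀) = (S.Cᵀ *ᵥ u) ⬝ᵥ (Φᵀ *ᵥ (P *ᵥ x₀)) := by
    rw [dotProduct_mulVec_transpose Φᵀ, transpose_transpose]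
  rw [h3, h.transpose_mulVec hx, dotProduct_neg, neg_neg]

end IsPortHamiltonian

theorem tendsto_cx_mulVec {a b : Type*} [Fintype a] [Fintype b] {l : Filter ℂ} {f : ℂ → a → ℂ}
    {y : a → ℂ} (M : Matrix b a ℝ) (h : Tendsto f l (𝓝 y)) :
    Tendsto (fun s => cx M *ᵥ f s) l (𝓝 (cx M *ᵥ y)) :=
  ((by fun_prop : Continuous fun x : a → ℂ => cx M *ᵥ x).tendsto y).comp h

theorem tendsto_mulVec_const {a b : Type*} [Fintype a] [Fintype b] {l : Filter ℂ}
    {f : ℂ → Matrix b a ℂ} {Y : Matrix b a ℂ} (h : Tendsto f l (𝓝 Y)) (u : a → ℂ) :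
    Tendsto (fun s => f s *ᵥ u) l (𝓝 (Y *ᵥ u)) :=
  ((by fun_prop : Continuous fun M : Matrix b a ℂ => M *ᵥ u).tendsto Y).comp h

theorem vcx_injective {a : Type*} : Function.Injective (vcx : (a → ℝ) → a → ℂ) := by
  intro x y h
  funext i
  exact Complex.ofReal_injective (congrFun h i)

/-- Expanding `(s - A)⁻¹ A⁴ y` by the resolvent identity gives `s⁴ (s - A)⁻¹ y - A³ y` and terms
vanishing with `s`; since `s² (s - A)⁻¹ y` is bounded, only `-A³ y` survives. -/
theorem tendsto_res_pow_four (hmin : IsMinimalRealization S G)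
    (hexp : IsOriginExpansion G G₀ G₁ G₂) (y : Fin n → ℝ) :
    Tendsto (fun s => res S.A s *ᵥ vcx ((S.A ^ 4) *ᵥ y)) (𝓝[≠] 0)
      (𝓝 (-vcx ((S.A ^ 3) *ᵥ y))) := by
  have hO := isBigO_res_of_isBigO_at hmin 2 0 (fun u => by
    have := isBigO_one_of_tendsto (tendsto_mulVec_const hexp.two u)
    simpa only [sub_zero, smul_mulVec] using this) (vcx y)
  have h1 : Tendsto (fun s : ℂ => s ^ 2 • ((s - 0) ^ 2 • (res S.A s *ᵥ vcx y)) +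
      (-vcx ((S.A ^ 3) *ᵥ y) - s • vcx ((S.A ^ 2) *ᵥ y) - s ^ 2 • vcx (S.A *ᵥ y) - s ^ 3 • vcx y))
      (𝓝[≠] 0) (𝓝 (0 + (-vcx ((S.A ^ 3) *ᵥ y) - (0 : ℂ) • vcx ((S.A ^ 2) *ᵥ y)
        - (0 : ℂ) ^ 2 • vcx (S.A *ᵥ y) - (0 : ℂ) ^ 3 • vcx y))) := by
    refine (tendsto_smul_zero_of_isBigO (by fun_prop) (by simp) hO).add ?_
    refine ((by fun_prop : Continuous fun s : ℂ => (-vcx ((S.A ^ 3) *ᵥ y) - s • vcx ((S.A ^ 2) *ᵥ y)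
      - s ^ 2 • vcx (S.A *ᵥ y) - s ^ 3 • vcx y)).tendsto 0).mono_left nhdsWithin_le_nhds
  have h2 : (0 : Fin n → ℂ) + (-vcx ((S.A ^ 3) *ᵥ y) - (0 : ℂ) • vcx ((S.A ^ 2) *ᵥ y)
      - (0 : ℂ) ^ 2 • vcx (S.A *ᵥ y) - (0 : ℂ) ^ 3 • vcx y) = -vcx ((S.A ^ 3) *ᵥ y) := by
    simp
  rw [h2] at h1
  refine h1.congr' ?_
  filter_upwards [eventually_isReg_nhdsNE S.A 0] with s hs
  have key : ∀ z : Fin n → ℝ, res S.A s *ᵥ vcx (S.A *ᵥ z) = s • (res S.A s *ᵥ vcx z) - vcx z :=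
    fun z => by rw [← vcx_mulVec, res_mulVec_cx hs]
  have e4 : (S.A ^ 4) *ᵥ y = S.A *ᵥ (S.A *ᵥ (S.A *ᵥ (S.A *ᵥ y))) := by
    simp only [mulVec_mulVec]; congr 1; noncomm_ring
  have e3 : (S.A ^ 3) *ᵥ y = S.A *ᵥ (S.A *ᵥ (S.A *ᵥ y)) := by
    simp only [mulVec_mulVec]; congr 1; noncomm_ring
  have e2 : (S.A ^ 2) *ᵥ y = S.A *ᵥ (S.A *ᵥ y) := by
    simp only [mulVec_mulVec]; congr 1; noncomm_ring
  rw [e4, e3, e2, key, key, key, key, sub_zero]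
  module

/-- The origin expansion, read off from the Fitting decomposition of the input vector. -/
theorem origin_expansion_mulVec (hmin : IsMinimalRealization S G) (hD : S.D = 0)
    (hexp : IsOriginExpansion G G₀ G₁ G₂) {u : Fin m → ℝ} {x₀ y : Fin n → ℝ}
    (hx : S.A *ᵥ (S.A *ᵥ x₀) = 0) (hu : S.B *ᵥ u = x₀ + (S.A ^ 4) *ᵥ y) :
    G₂ *ᵥ u = S.C *ᵥ (S.A *ᵥ x₀) ∧ G₁ *ᵥ u = S.C *ᵥ x₀ ∧
      G₀ *ᵥ u = -(S.C *ᵥ ((S.A ^ 3) *ᵥ y)) := by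
  set R : ℂ → Fin n → ℂ := fun s => res S.A s *ᵥ vcx ((S.A ^ 4) *ᵥ y) with hR
  have hlim : Tendsto (fun s => cx S.C *ᵥ R s) (𝓝[≠] 0) (𝓝 (vcx (-(S.C *ᵥ ((S.A ^ 3) *ᵥ y))))) := by
    have := tendsto_cx_mulVec S.C (tendsto_res_pow_four hmin hexp y)
    rw [mulVec_neg, vcx_mulVec] at this
    convert this using 2
    funext i; simp [vcx]
  have hid : Tendsto (fun s : ℂ => s) (𝓝[≠] 0) (𝓝 0) := nhdsWithin_le_nhds
  have hG : ∀ᶠ s in 𝓝[≠] (0 : ℂ), s ≠ 0 ∧ G.at s *ᵥ vcx u =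
      s⁻¹ • vcx (S.C *ᵥ x₀) + (s ^ 2)⁻¹ • vcx (S.C *ᵥ (S.A *ᵥ x₀)) + cx S.C *ᵥ R s := by
    filter_upwards [eventually_isReg_nhdsNE S.A 0, self_mem_nhdsWithin] with s hs hs0
    have hs0 : s ≠ 0 := hs0
    refine ⟨hs0, ?_⟩
    have key : ∀ z : Fin n → ℝ, s • (res S.A s *ᵥ vcx z) = vcx z + res S.A s *ᵥ vcx (S.A *ᵥ z) :=
      fun z => by rw [← vcx_mulVec, res_mulVec_cx hs]; abel
    have k1 := key (S.A *ᵥ x₀)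
    have v0 : vcx (0 : Fin n → ℝ) = 0 := by funext i; simp [vcx]
    rw [hx, v0, mulVec_zero, add_zero] at k1
    have k2 : res S.A s *ᵥ vcx x₀ = s⁻¹ • vcx x₀ + (s ^ 2)⁻¹ • vcx (S.A *ᵥ x₀) := by
      have e : ∀ z : Fin n → ℂ, z = s⁻¹ • (s • z) := fun z => by
        rw [smul_smul, inv_mul_cancel₀ hs0, one_smul]
      rw [e (res S.A s *ᵥ vcx x₀), key x₀, e (res S.A s *ᵥ vcx (S.A *ᵥ x₀)), k1, smul_add, smul_smul,
        sq, mul_inv]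
    have hv : vcx (S.B *ᵥ u) = vcx x₀ + vcx ((S.A ^ 4) *ᵥ y) := by
      rw [hu]; funext i; simp [vcx]
    rw [at_mulVec hmin.1 hs, hD, cx_zero, zero_mulVec, add_zero, vcx_mulVec, hv, mulVec_add, k2,
      mulVec_add, mulVec_add, mulVec_smul, mulVec_smul, vcx_mulVec, vcx_mulVec]
  have h2 : G₂ *ᵥ u = S.C *ᵥ (S.A *ᵥ x₀) := by
    apply vcx_injective
    have l1 := tendsto_mulVec_const hexp.two (vcx u)
    have l2 : Tendsto (fun s : ℂ => s • vcx (S.C *ᵥ x₀) + vcx (S.C *ᵥ (S.A *ᵥ x₀)) +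
        s ^ 2 • (cx S.C *ᵥ R s)) (𝓝[≠] 0) (𝓝 ((0 : ℂ) • vcx (S.C *ᵥ x₀) +
          vcx (S.C *ᵥ (S.A *ᵥ x₀)) + (0 : ℂ) ^ 2 • vcx (-(S.C *ᵥ ((S.A ^ 3) *ᵥ y))))) :=
      ((hid.smul_const _).add tendsto_const_nhds).add ((hid.pow 2).smul hlim)
    have l3 := tendsto_nhds_unique (l1.congr' ?_) l2
    · change cx G₂ *ᵥ vcx u = _ at l3
      rw [← vcx_mulVec, l3]; simp
    · filter_upwards [hG] with s ⟨hs0, hs⟩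
      rw [smul_mulVec, hs, smul_add, smul_add, smul_smul, smul_smul,
        mul_inv_cancel₀ (pow_ne_zero 2 hs0), one_smul, sq, mul_assoc, mul_inv_cancel₀ hs0, mul_one]
  have h1 : G₁ *ᵥ u = S.C *ᵥ x₀ := by
    apply vcx_injective
    have l1 := tendsto_mulVec_const hexp.one (vcx u)
    have l2 : Tendsto (fun s : ℂ => vcx (S.C *ᵥ x₀) + s • (cx S.C *ᵥ R s)) (𝓝[≠] 0)
        (𝓝 (vcx (S.C *ᵥ x₀) + (0 : ℂ) • vcx (-(S.C *ᵥ ((S.A ^ 3) *ᵥ y))))) :=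
      tendsto_const_nhds.add (hid.smul hlim)
    have l3 := tendsto_nhds_unique (l1.congr' ?_) l2
    · change cx G₁ *ᵥ vcx u = _ at l3
      rw [← vcx_mulVec, l3]; simp
    · filter_upwards [hG] with s ⟨hs0, hs⟩
      change (s • (G.at s - (s ^ 2)⁻¹ • cx G₂)) *ᵥ vcx u = _
      rw [smul_mulVec, sub_mulVec, hs, smul_mulVec, vcx_mulVec, h2, add_sub_right_comm,
        add_sub_cancel_right, smul_add, smul_smul, mul_inv_cancel₀ hs0, one_smul]
  refine ⟨h2, h1, ?_⟩
  apply vcx_injective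
  have l1 := tendsto_mulVec_const hexp.zero (vcx u)
  have l3 := tendsto_nhds_unique (l1.congr' ?_) hlim
  · change cx G₀ *ᵥ vcx u = _ at l3
    rw [← vcx_mulVec, l3]
  · filter_upwards [hG] with s ⟨hs0, hs⟩
    change (G.at s - (s ^ 2)⁻¹ • cx G₂ - s⁻¹ • cx G₁) *ᵥ vcx u = _
    rw [sub_mulVec, sub_mulVec, hs, smul_mulVec, smul_mulVec, vcx_mulVec, vcx_mulVec, h2, h1]
    abel

end Origin

/-! ### The Hankel range and the storage form in terms of the origin data. -/

section Hankel

variable {n m : ℕ} {S : StateSpace n m} {G : TransferMatrix m}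
  {P Φ : Matrix (Fin n) (Fin n) ℝ} {G₀ G₁ G₂ : Matrix (Fin m) (Fin m) ℝ}

namespace IsPortHamiltonian

theorem eq_zero_of_eq_pow (h : IsPortHamiltonian S P Φ) {x y : Fin n → ℝ}
    (hx : S.A *ᵥ (S.A *ᵥ x) = 0) (hxy : x = (S.A ^ 4) *ᵥ y) : x = 0 := by
  have h1 : (S.A ^ (4 + 2)) *ᵥ y = 0 := by
    rw [mulVec_mulVec, ← sq] at hx
    rw [add_comm, pow_add, ← mulVec_mulVec, ← hxy, hx]
  have h2 := h.A_sq_eq_zero_of_pow 4 h1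
  rw [hxy, show 4 = 2 + 2 from rfl, pow_add, ← mulVec_mulVec, sq, ← mulVec_mulVec,
    ← mulVec_mulVec, h2, mulVec_zero, mulVec_zero]

theorem pow_four_mulVec (A : Matrix (Fin n) (Fin n) ℝ) (y : Fin n → ℝ) :
    (A ^ 4) *ᵥ y = A *ᵥ ((A ^ 3) *ᵥ y) := by
  rw [mulVec_mulVec, ← pow_succ']

/-- The component in the generalized kernel of a decomposition `ξ = A z + B a`: the system
restricted to that subspace is controllable. -/
theorem exists_input (h : IsPortHamiltonian S P Φ) (hc : Controllable S.A S.B) {ξ : Fin n → ℝ}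
    (hξ : S.A *ᵥ (S.A *ᵥ ξ) = 0) : ∃ a a₀ z y, S.A *ᵥ (S.A *ᵥ a₀) = 0 ∧ S.A *ᵥ (S.A *ᵥ z) = 0 ∧
      S.B *ᵥ a = a₀ + (S.A ^ 4) *ᵥ y ∧ ξ = a₀ + S.A *ᵥ z := by
  obtain ⟨z, a, hza⟩ := hc.exists_eq_add ξ
  obtain ⟨z₀, w, hz₀, hz⟩ := h.exists_decomposition z
  obtain ⟨a₀, y, ha₀, ha⟩ := h.exists_decomposition (S.B *ᵥ a)
  refine ⟨a, a₀, z₀, y, ha₀, hz₀, ha, ?_⟩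
  have hcomm : S.A *ᵥ ((S.A ^ 4) *ᵥ w) = (S.A ^ 4) *ᵥ (S.A *ᵥ w) := by
    rw [mulVec_mulVec, mulVec_mulVec, ← pow_succ, ← pow_succ']
  have h1 : ξ - (a₀ + S.A *ᵥ z₀) = (S.A ^ 4) *ᵥ (S.A *ᵥ w + y) := by
    rw [hza, ha, hz, mulVec_add, mulVec_add, hcomm]; abel
  refine sub_eq_zero.1 (h.eq_zero_of_eq_pow ?_ h1)
  simp only [mulVec_sub, mulVec_add, hξ, ha₀, hz₀, mulVec_zero]
  simp


/-- Two applications of `exists_input` write `ξ = a₀ + A b₀`, because `A²` vanishes on the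
generalized kernel. With `exists_hankel_state` this identifies the range of the Hankel matrix with
the pairs `(C ξ, C A ξ)`. -/
theorem exists_hankel_input (h : IsPortHamiltonian S P Φ) (hmin : IsMinimalRealization S G)
    (hD : S.D = 0) (hexp : IsOriginExpansion G G₀ G₁ G₂) {ξ : Fin n → ℝ}
    (hξ : S.A *ᵥ (S.A *ᵥ ξ) = 0) :
    ∃ a b, G₁ *ᵥ a + G₂ *ᵥ b = S.C *ᵥ ξ ∧ G₂ *ᵥ a = S.C *ᵥ (S.A *ᵥ ξ) := by
  obtain ⟨a, a₀, z, y, ha₀, hz, ha, hξa⟩ := h.exists_input hmin.controllable hξ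
  obtain ⟨b, b₀, z', y', hb₀, hz', hb, hzb⟩ := h.exists_input hmin.controllable hz
  obtain ⟨ea2, ea1, -⟩ := origin_expansion_mulVec hmin hD hexp ha₀ ha
  obtain ⟨eb2, -, -⟩ := origin_expansion_mulVec hmin hD hexp hb₀ hb
  refine ⟨a, b, ?_, ?_⟩
  · rw [ea1, eb2, hξa, hzb, mulVec_add S.A, hz', add_zero, mulVec_add]
  · rw [ea2, hξa, mulVec_add S.A, hz, add_zero]

theorem exists_hankel_state (h : IsPortHamiltonian S P Φ) (hmin : IsMinimalRealization S G)
    (hD : S.D = 0) (hexp : IsOriginExpansion G G₀ G₁ G₂) (a b : Fin m → ℝ) :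
    ∃ ξ, S.A *ᵥ (S.A *ᵥ ξ) = 0 ∧
      G₁ *ᵥ a + G₂ *ᵥ b = S.C *ᵥ ξ ∧ G₂ *ᵥ a = S.C *ᵥ (S.A *ᵥ ξ) := by
  obtain ⟨a₀, y, ha₀, ha⟩ := h.exists_decomposition (S.B *ᵥ a)
  obtain ⟨b₀, y', hb₀, hb⟩ := h.exists_decomposition (S.B *ᵥ b)
  obtain ⟨ea2, ea1, -⟩ := origin_expansion_mulVec hmin hD hexp ha₀ ha
  obtain ⟨eb2, -, -⟩ := origin_expansion_mulVec hmin hD hexp hb₀ hb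
  refine ⟨a₀ + S.A *ᵥ b₀, ?_, ?_, ?_⟩
  · simp [mulVec_add, ha₀, hb₀]
  · rw [ea1, eb2, mulVec_add]
  · rw [ea2, mulVec_add S.A, hb₀, add_zero]

/-- The symmetric part of the residue `G₁` is positive semidefinite. -/
theorem G₁_form_nonneg (h : IsPortHamiltonian S P Φ) (hmin : IsMinimalRealization S G)
    (hD : S.D = 0) (hexp : IsOriginExpansion G G₀ G₁ G₂) (a : Fin m → ℝ) :
    0 ≤ a ⬝ᵥ (G₁ *ᵥ a) := by
  obtain ⟨a₀, y, ha₀, ha⟩ := h.exists_decomposition (S.B *ᵥ a)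
  obtain ⟨-, e1, -⟩ := origin_expansion_mulVec hmin hD hexp ha₀ ha
  -- The vector is chosen so that `Φ` carries it to `-a₀`, removing the nonsingular part of `B a`.
  have h1 := h.form_nonpos (S.Cᵀ *ᵥ a + P *ᵥ ((S.A ^ 3) *ᵥ y))
  have h2 : Φ *ᵥ (S.Cᵀ *ᵥ a + P *ᵥ ((S.A ^ 3) *ᵥ y)) = -a₀ := by
    rw [mulVec_add, ← h.A_mulVec, ← pow_four_mulVec, ← neg_neg (Φ *ᵥ (S.Cᵀ *ᵥ a)), ← h.B_mulVec, ha]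
    abel
  have h3 : (P *ᵥ ((S.A ^ 3) *ᵥ y)) ⬝ᵥ a₀ = 0 := by
    rw [dotProduct_comm, h.symm_form, pow_succ', ← mulVec_mulVec, h.form_A_eq_zero ha₀]
  rw [h2, dotProduct_neg, add_dotProduct, h3, add_zero] at h1
  rw [e1, dotProduct_mulVec_transpose]
  linarith

/-- The decomposition data of a static output injection `P x = Cᵀ u`. -/
theorem exists_of_storage_eq (h : IsPortHamiltonian S P Φ) (hmin : IsMinimalRealization S G)
    (hD : S.D = 0) (hexp : IsOriginExpansion G G₀ G₁ G₂) {u : Fin m → ℝ} {x : Fin n → ℝ}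
    (hux : P *ᵥ x = S.Cᵀ *ᵥ u) :
    ∃ x₀ w η, S.A *ᵥ (S.A *ᵥ x₀) = 0 ∧ x = x₀ + S.A *ᵥ w ∧ G₀ *ᵥ u = S.C *ᵥ x - S.C *ᵥ x₀ ∧
      G₁ᵀ *ᵥ u = G₂ *ᵥ η ∧ G₂ *ᵥ η = S.C *ᵥ (S.A *ᵥ x₀) ∧
      ∀ x₀', S.A *ᵥ (S.A *ᵥ x₀') = 0 → η ⬝ᵥ (S.C *ᵥ (S.A *ᵥ x₀')) = x₀ ⬝ᵥ (P *ᵥ x₀') := by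
  obtain ⟨x₀, y, hx₀, hx⟩ := h.exists_decomposition x
  have hBu : S.B *ᵥ u = -(S.A *ᵥ x) := by rw [h.B_mulVec, ← hux, h.A_mulVec]
  have hBu' : S.B *ᵥ u = -(S.A *ᵥ x₀) + (S.A ^ 4) *ᵥ (-(S.A *ᵥ y)) := by
    have hcomm : S.A *ᵥ ((S.A ^ 4) *ᵥ y) = (S.A ^ 4) *ᵥ (S.A *ᵥ y) := by
      rw [mulVec_mulVec, mulVec_mulVec, ← pow_succ, ← pow_succ']
    rw [hBu, hx, mulVec_add, hcomm, mulVec_neg]; abel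
  obtain ⟨-, e1, e0⟩ := origin_expansion_mulVec hmin hD hexp
    (by rw [mulVec_neg, mulVec_neg, hx₀]; simp) hBu'
  obtain ⟨η, η₀, z, y', hη₀, hz, hη, hxη⟩ := h.exists_input hmin.controllable hx₀
  obtain ⟨eη, -, -⟩ := origin_expansion_mulVec hmin hD hexp hη₀ hη
  have hGη : G₂ *ᵥ η = S.C *ᵥ (S.A *ᵥ x₀) := by rw [eη, hxη, mulVec_add S.A, hz, add_zero]
  refine ⟨x₀, (S.A ^ 3) *ᵥ y, η, hx₀, by rw [← pow_four_mulVec, hx], ?_, ?_, hGη, ?_⟩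
  · have h3 : (S.A ^ 3) *ᵥ (S.A *ᵥ y) = (S.A ^ 4) *ᵥ y := by rw [mulVec_mulVec, ← pow_succ]
    rw [e0, mulVec_neg, mulVec_neg, neg_neg, h3, ← mulVec_sub, hx, add_sub_cancel_left]
  -- A zero of the nonnegative form of `G₁` is annihilated by its symmetric part, hence `G₁ᵀ u = -G₁
  -- u`.
  · have h1 : u ⬝ᵥ ((-G₁) *ᵥ u) = 0 := by
      rw [neg_mulVec, e1, mulVec_neg, neg_neg, h.dotProduct_output hx₀, hBu, neg_dotProduct,
        h.form_A_eq_zero hx₀, neg_zero]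
    have h2 := add_transpose_mulVec_eq_zero (M := -G₁) (fun a => by
      rw [neg_mulVec, dotProduct_neg]
      linarith [h.G₁_form_nonneg hmin hD hexp a]) h1
    rw [add_mulVec, transpose_neg, neg_mulVec, neg_mulVec, e1, mulVec_neg, neg_neg,
      ← sub_eq_add_neg, sub_eq_zero] at h2
    rw [hGη, ← h2]
  · intro x₀' hx₀'
    rw [h.dotProduct_output hx₀', hη, hxη, add_dotProduct, add_dotProduct,
      h.form_A_eq_zero hx₀', pow_four_mulVec, h.form_A_eq_zero hx₀']

/-- The origin data of the transfer function matrix reproduce the storage form. -/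
theorem origin_form_eq (h : IsPortHamiltonian S P Φ) (hmin : IsMinimalRealization S G)
    (hD : S.D = 0) (hexp : IsOriginExpansion G G₀ G₁ G₂) {l : ℕ} {J : Matrix (Fin m) (Fin l) ℝ}
    (hJ : G₂ = J * Jᵀ) (hJdet : (Jᵀ * J).det ≠ 0) {u u' : Fin m → ℝ} {x x' : Fin n → ℝ}
    (hux : P *ᵥ x = S.Cᵀ *ᵥ u) (hux' : P *ᵥ x' = S.Cᵀ *ᵥ u') :
    u' ⬝ᵥ ((G₀ + G₁ * J * ((Jᵀ * J) ^ 2)⁻¹ * Jᵀ * G₁ᵀ) *ᵥ u) = x' ⬝ᵥ (P *ᵥ x) := by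
  obtain ⟨x₀, w, η, hx₀, hxw, hG₀, hη, hGη, -⟩ := h.exists_of_storage_eq hmin hD hexp hux
  obtain ⟨x₀', w', η', hx₀', hxw', -, hη', -, hform'⟩ := h.exists_of_storage_eq hmin hD hexp hux'
  have hC : ∀ z, u' ⬝ᵥ (S.C *ᵥ z) = x' ⬝ᵥ (P *ᵥ z) := by
    intro z
    rw [dotProduct_mulVec_transpose, ← hux', dotProduct_comm, h.symm_form]
  have hunit : IsUnit (Jᵀ * J).det := isUnit_iff_ne_zero.2 hJdet
  -- This makes `J (Jᵀ J)⁻² Jᵀ` a generalized inverse of `G₂ = J Jᵀ`.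
  have hK : (Jᵀ * J) * (((Jᵀ * J) ^ 2)⁻¹ * (Jᵀ * J)) = 1 := by
    generalize Jᵀ * J = Q at hunit
    rw [sq, Matrix.mul_inv_rev, Matrix.mul_assoc, nonsing_inv_mul _ hunit, Matrix.mul_one,
      mul_nonsing_inv _ hunit]
  have h2 : u' ⬝ᵥ ((G₁ * J * ((Jᵀ * J) ^ 2)⁻¹ * Jᵀ * G₁ᵀ) *ᵥ u) = η' ⬝ᵥ (G₂ *ᵥ η) := by
    rw [← mulVec_mulVec, hη]
    simp only [Matrix.mul_assoc]
    rw [← mulVec_mulVec, dotProduct_mulVec_transpose, hη', mulVec_mulVec]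
    have hs : G₂ᵀ = G₂ := by rw [hJ, transpose_mul, transpose_transpose]
    nth_rewrite 1 [← hs]
    rw [← dotProduct_mulVec_transpose, mulVec_mulVec]
    congr 2
    rw [hJ]
    calc J * Jᵀ * (J * (((Jᵀ * J) ^ 2)⁻¹ * Jᵀ) * (J * Jᵀ))
        = J * ((Jᵀ * J) * (((Jᵀ * J) ^ 2)⁻¹ * (Jᵀ * J))) * Jᵀ := by
          simp only [Matrix.mul_assoc]
      _ = J * Jᵀ := by rw [hK, Matrix.mul_one]
  have h3 : η' ⬝ᵥ (G₂ *ᵥ η) = x₀' ⬝ᵥ (P *ᵥ x₀) := by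
    rw [hGη, hform' x₀ hx₀]
  rw [add_mulVec, dotProduct_add, h2, h3, hG₀, dotProduct_sub, hC, hC]
  -- `G₀` accounts for the energy without the generalized-kernel part; the correction term restores
  -- exactly that part.
  have h5 : x' ⬝ᵥ (P *ᵥ x₀) = x₀' ⬝ᵥ (P *ᵥ x₀) := by
    rw [hxw', add_dotProduct, h.form_A_eq_zero hx₀, add_zero]
  rw [h5]; ring

end IsPortHamiltonian

end Hankel

/-! ### The factor `F` as the output of the kernel of `A`. -/

section HankelFactor

namespace IsSVD

variable {a b : Type*} [Fintype a] [DecidableEq a] [Fintype b] [DecidableEq b]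
    {p q r : ℕ} {M : Matrix a b ℝ} {H₁ : Matrix a (Fin p) ℝ} {H₂ : Matrix a (Fin q) ℝ}
    {σ : Fin p → ℝ} {V₁ : Matrix b (Fin p) ℝ} {V₂ : Matrix b (Fin r) ℝ}

theorem eq_reduced (h : IsSVD M H₁ H₂ σ V₁ V₂) : M = H₁ * diagonal σ * V₁ᵀ := by
  rw [h.eq, transpose_fromCols, fromCols_mul_fromBlocks, fromCols_mul_fromRows]
  simp

theorem right_mul_transpose (h : IsSVD M H₁ H₂ σ V₁ V₂) : V₁ * V₁ᵀ + V₂ * V₂ᵀ = 1 := by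
  rw [← h.right_orth', transpose_fromCols, fromCols_mul_fromRows]

theorem right_transpose_mul (h : IsSVD M H₁ H₂ σ V₁ V₂) : V₁ᵀ * V₁ = 1 ∧ V₁ᵀ * V₂ = 0 := by
  have := h.right_orth
  rw [transpose_fromCols, fromRows_mul_fromCols, ← fromBlocks_one, fromBlocks_inj] at this
  exact ⟨this.1, this.2.1⟩

theorem left_transpose_mul (h : IsSVD M H₁ H₂ σ V₁ V₂) : H₁ᵀ * H₁ = 1 := by
  have := h.left_orth
  rw [transpose_fromCols, fromRows_mul_fromCols, ← fromBlocks_one, fromBlocks_inj] at this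
  exact this.1

theorem mul_right_null (h : IsSVD M H₁ H₂ σ V₁ V₂) : M * V₂ = 0 := by
  rw [h.eq_reduced, Matrix.mul_assoc, h.right_transpose_mul.2, Matrix.mul_zero]

theorem exists_of_mulVec_eq_zero (h : IsSVD M H₁ H₂ σ V₁ V₂) {x : b → ℝ} (hx : M *ᵥ x = 0) :
    ∃ y, x = V₂ *ᵥ y := by
  have h1 : diagonal σ *ᵥ (V₁ᵀ *ᵥ x) = 0 := by
    have : H₁ᵀ *ᵥ (M *ᵥ x) = 0 := by rw [hx, mulVec_zero]
    rw [h.eq_reduced, mulVec_mulVec, Matrix.mul_assoc, ← Matrix.mul_assoc,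
      h.left_transpose_mul, Matrix.one_mul, ← mulVec_mulVec] at this
    exact this
  have h2 : V₁ᵀ *ᵥ x = 0 := by
    refine eq_zero_of_mulVec_eq_zero ?_ h1
    rw [det_diagonal]
    exact Finset.prod_ne_zero_iff.2 fun i _ => (h.pos i).ne'
  refine ⟨V₂ᵀ *ᵥ x, ?_⟩
  have h3 := congrArg (fun N => N *ᵥ x) h.right_mul_transpose
  simp only [add_mulVec, one_mulVec, ← mulVec_mulVec, h2, mulVec_zero, zero_add] at h3
  exact h3.symm

end IsSVD

variable {n m c : ℕ} {S : StateSpace n m} {G : TransferMatrix m}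
  {P Φ : Matrix (Fin n) (Fin n) ℝ} {G₀ G₁ G₂ : Matrix (Fin m) (Fin m) ℝ}

theorem toRows₁_mulVec {a b d : Type*} [Fintype d] (U : Matrix (a ⊕ b) d ℝ) (x : d → ℝ) :
    U.toRows₁ *ᵥ x = (U *ᵥ x) ∘ Sum.inl := rfl

theorem toRows₂_mulVec {a b d : Type*} [Fintype d] (U : Matrix (a ⊕ b) d ℝ) (x : d → ℝ) :
    U.toRows₂ *ᵥ x = (U *ᵥ x) ∘ Sum.inr := rfl

theorem ext_mulVec {a b : Type*} [Fintype b] {M N : Matrix a b ℝ}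
    (h : ∀ x, M *ᵥ x = N *ᵥ x) : M = N := by
  classical
  exact Matrix.ext_of_mulVec_single fun i => h _

/-- The Hankel factor is the output image of a basis-like parametrization of `ker A`. -/
theorem IsPortHamiltonian.exists_kernel_parametrization (h : IsPortHamiltonian S P Φ)
    (hmin : IsMinimalRealization S G) (hD : S.D = 0) (hexp : IsOriginExpansion G G₀ G₁ G₂)
    {F : Matrix (Fin m) (Fin c) ℝ} (hF : IsHankelFactor G₁ G₂ F) :
    ∃ K : Matrix (Fin n) (Fin c) ℝ, F = S.C * K ∧ S.A * K = 0 ∧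
      ∀ x, S.A *ᵥ x = 0 → ∃ γ, x = K *ᵥ γ := by
  obtain ⟨p, q, q', H₁, H₂, σ, V₁, V₂, U, p₁, c', K₁, K₂, τ, W₁, W₂, hΓ, hU, hM, rfl⟩ := hF
  have hΓV : hankel G₁ G₂ * V₁ = U := by
    rw [hΓ.eq_reduced, Matrix.mul_assoc, hΓ.right_transpose_mul.1, Matrix.mul_one, hU]
  have hhankel : ∀ v, hankel G₁ G₂ *ᵥ v = Sum.elim
      (G₁ *ᵥ (v ∘ Sum.inl) + G₂ *ᵥ (v ∘ Sum.inr)) (G₂ *ᵥ (v ∘ Sum.inl)) := by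
    intro v
    rw [hankel, fromBlocks_mulVec, zero_mulVec, add_zero]
  -- `Ξ` lifts the columns of `U` to the generalized kernel, so that `U₁ = C Ξ` and `U₂ = C A Ξ`.
  obtain ⟨Ξ, hΞ0, hΞ1, hΞ2⟩ : ∃ Ξ : Matrix (Fin n) (Fin p) ℝ, (∀ α, S.A *ᵥ (S.A *ᵥ (Ξ *ᵥ α)) = 0) ∧
      (∀ α, U.toRows₁ *ᵥ α = S.C *ᵥ (Ξ *ᵥ α)) ∧
      ∀ α, U.toRows₂ *ᵥ α = S.C *ᵥ (S.A *ᵥ (Ξ *ᵥ α)) := by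
    have hcol : ∀ j : Fin p, ∃ ξ, S.A *ᵥ (S.A *ᵥ ξ) = 0 ∧
        U.toRows₁ *ᵥ Pi.single j 1 = S.C *ᵥ ξ ∧
        U.toRows₂ *ᵥ Pi.single j 1 = S.C *ᵥ (S.A *ᵥ ξ) := by
      intro j
      obtain ⟨ξ, h0, h1, h2⟩ := h.exists_hankel_state hmin hD hexp
        ((V₁ *ᵥ Pi.single j 1) ∘ Sum.inl) ((V₁ *ᵥ Pi.single j 1) ∘ Sum.inr)
      have e : U *ᵥ Pi.single j 1 = hankel G₁ G₂ *ᵥ (V₁ *ᵥ Pi.single j 1) := by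
        rw [mulVec_mulVec, hΓV]
      rw [hhankel] at e
      refine ⟨ξ, h0, ?_, ?_⟩
      · rw [toRows₁_mulVec, e, Sum.elim_comp_inl, h1]
      · rw [toRows₂_mulVec, e, Sum.elim_comp_inr, h2]
    choose ξ h0 h1 h2 using hcol
    have hcolξ : ∀ j, (of fun i j => ξ j i) *ᵥ Pi.single j 1 = ξ j := by
      intro j; funext i; simp
    refine ⟨of fun i j => ξ j i, ?_, ?_, ?_⟩
    · have : S.A * (S.A * of fun i j => ξ j i) = 0 := Matrix.ext_of_mulVec_single fun j => by
        rw [← mulVec_mulVec, ← mulVec_mulVec, hcolξ, h0, zero_mulVec]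
      intro α
      rw [mulVec_mulVec, mulVec_mulVec, Matrix.mul_assoc, this, zero_mulVec]
    · have : U.toRows₁ = S.C * of fun i j => ξ j i := Matrix.ext_of_mulVec_single fun j => by
        rw [← mulVec_mulVec, hcolξ, h1]
      intro α
      rw [this, mulVec_mulVec]
    · have : U.toRows₂ = S.C * (S.A * of fun i j => ξ j i) :=
        Matrix.ext_of_mulVec_single fun j => by
          rw [← mulVec_mulVec, ← mulVec_mulVec, hcolξ, h2]
      intro α
      rw [this, mulVec_mulVec, mulVec_mulVec, Matrix.mul_assoc]
  have hsurj : ∀ ξ, S.A *ᵥ (S.A *ᵥ ξ) = 0 → ∃ α, ξ = Ξ *ᵥ α := by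
    intro ξ hξ
    obtain ⟨a, b, h1, h2⟩ := h.exists_hankel_input hmin hD hexp hξ
    set α := V₁ᵀ *ᵥ (Sum.elim a b) with hα
    have e : U *ᵥ α = Sum.elim (S.C *ᵥ ξ) (S.C *ᵥ (S.A *ᵥ ξ)) := by
      rw [hα, mulVec_mulVec, hU, ← hΓ.eq_reduced, hhankel, Sum.elim_comp_inl, Sum.elim_comp_inr,
        h1, h2]
    have e1 : S.C *ᵥ (Ξ *ᵥ α) = S.C *ᵥ ξ := by
      rw [← hΞ1, toRows₁_mulVec, e, Sum.elim_comp_inl]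
    have e2 : S.C *ᵥ (S.A *ᵥ (Ξ *ᵥ α)) = S.C *ᵥ (S.A *ᵥ ξ) := by
      rw [← hΞ2, toRows₂_mulVec, e, Sum.elim_comp_inr]
    -- Observability twice: `C A` determines `A ξ`, which lies in `ker A`, and then `C` determines
    -- `ξ`.
    refine ⟨α, sub_eq_zero.1 (hmin.observable.eq_zero_of_kernel ?_ ?_)⟩
    · refine hmin.observable.eq_zero_of_kernel ?_ ?_
      · rw [mulVec_sub, mulVec_sub, hξ, hΞ0, sub_zero]
      · rw [mulVec_sub, mulVec_sub, e2, sub_self]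
    · rw [mulVec_sub, e1, sub_self]
  refine ⟨Ξ * W₂, ?_, ?_, ?_⟩
  · refine ext_mulVec fun γ => ?_
    rw [← mulVec_mulVec, hΞ1, mulVec_mulVec, mulVec_mulVec, Matrix.mul_assoc]
  · refine ext_mulVec fun γ => ?_
    rw [zero_mulVec, ← mulVec_mulVec, ← mulVec_mulVec]
    set ξ := Ξ *ᵥ (W₂ *ᵥ γ) with hξ
    have hξ0 : S.A *ᵥ (S.A *ᵥ ξ) = 0 := hΞ0 _
    obtain ⟨β, hβ⟩ := hsurj (S.A *ᵥ ξ) (by rw [hξ0, mulVec_zero])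
    refine hmin.observable.eq_zero_of_kernel hξ0 ?_
    -- `C A ξ` is orthogonal to the output of the whole generalized kernel. As `A ξ` itself belongs
    -- to it, `C A ξ` is orthogonal to itself.
    have h1 : U.toRows₁ᵀ *ᵥ (S.C *ᵥ (S.A *ᵥ ξ)) = 0 := by
      rw [hξ, ← hΞ2, mulVec_mulVec, mulVec_mulVec, hM.mul_right_null, zero_mulVec]
    have h2 : (S.C *ᵥ (S.A *ᵥ ξ)) ⬝ᵥ (S.C *ᵥ (S.A *ᵥ ξ)) = 0 := by
      nth_rewrite 2 [hβ]
      rw [← hΞ1, dotProduct_mulVec_transpose, h1, zero_dotProduct]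
    exact dotProduct_self_eq_zero.1 h2
  · intro x hx
    obtain ⟨α, hα⟩ := hsurj x (by rw [hx, mulVec_zero])
    have h1 : (U.toRows₁ᵀ * U.toRows₂) *ᵥ α = 0 := by
      rw [← mulVec_mulVec, hΞ2, ← hα, hx, mulVec_zero, mulVec_zero]
    obtain ⟨γ, hγ⟩ := hM.exists_of_mulVec_eq_zero h1
    exact ⟨γ, by rw [hα, hγ, mulVec_mulVec]⟩

end HankelFactor

/-! ### From the storage criterion to the stated matrix conditions. -/

section Criterion

variable {n m c : ℕ} {P : Matrix (Fin n) (Fin n) ℝ} {C : Matrix (Fin m) (Fin n) ℝ}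
  {N : Matrix (Fin m) (Fin m) ℝ} {F : Matrix (Fin m) (Fin c) ℝ} {K : Matrix (Fin n) (Fin c) ℝ}

theorem schurP_mul (hdet : (Fᵀ * N * F).det ≠ 0) : schurP N F * F = 0 := by
  have hE := isUnit_iff_ne_zero.2 hdet
  have h1 : N * F * (Fᵀ * N * F)⁻¹ * Fᵀ * N * F = N * F * ((Fᵀ * N * F)⁻¹ * (Fᵀ * N * F)) := by
    simp only [Matrix.mul_assoc]
  rw [schurP, Matrix.sub_mul, h1, nonsing_inv_mul _ hE, Matrix.mul_one, sub_self]

/-- Completion of the square with respect to the Schur complement. -/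
theorem schurP_form (hN : Nᵀ = N) (hdet : (Fᵀ * N * F).det ≠ 0) (y : Fin m → ℝ) (γ : Fin c → ℝ) :
    (y + F *ᵥ γ) ⬝ᵥ (N *ᵥ (y + F *ᵥ γ)) = y ⬝ᵥ (schurP N F *ᵥ y) +
      (γ + (Fᵀ * N * F)⁻¹ *ᵥ (Fᵀ *ᵥ (N *ᵥ y))) ⬝ᵥ
        ((Fᵀ * N * F) *ᵥ (γ + (Fᵀ * N * F)⁻¹ *ᵥ (Fᵀ *ᵥ (N *ᵥ y)))) := by
  have hE := isUnit_iff_ne_zero.2 hdet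
  have hEs : (Fᵀ * N * F)ᵀ = Fᵀ * N * F := by
    simp [transpose_mul, hN, Matrix.mul_assoc]
  have hEform : ∀ α β : Fin c → ℝ, (F *ᵥ α) ⬝ᵥ (N *ᵥ (F *ᵥ β)) = α ⬝ᵥ ((Fᵀ * N * F) *ᵥ β) := by
    intro α β
    rw [← mulVec_mulVec, ← mulVec_mulVec, dotProduct_mulVec_transpose Fᵀ, transpose_transpose]
  have hS : y ⬝ᵥ (schurP N F *ᵥ y) = y ⬝ᵥ (N *ᵥ y) -
      (Fᵀ *ᵥ (N *ᵥ y)) ⬝ᵥ ((Fᵀ * N * F)⁻¹ *ᵥ (Fᵀ *ᵥ (N *ᵥ y))) := by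
    rw [schurP, sub_mulVec, dotProduct_sub]
    simp only [← mulVec_mulVec]
    congr 1
    rw [dotProduct_mulVec_transpose N y, hN, dotProduct_mulVec_transpose F]
  generalize hEE : Fᵀ * N * F = E at *
  set r := Fᵀ *ᵥ (N *ᵥ y) with hr
  have h1 : E *ᵥ (E⁻¹ *ᵥ r) = r := by
    rw [mulVec_mulVec, mul_nonsing_inv _ hE, one_mulVec]
  have h2 : y ⬝ᵥ (N *ᵥ (F *ᵥ γ)) = r ⬝ᵥ γ := by
    rw [dotProduct_mulVec_transpose N, hN, dotProduct_mulVec_transpose F]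
  have h3 : (F *ᵥ γ) ⬝ᵥ (N *ᵥ y) = r ⬝ᵥ γ := by
    rw [dotProduct_mulVec_transpose N, hN, dotProduct_comm, h2]
  have h4 : (E⁻¹ *ᵥ r) ⬝ᵥ (E *ᵥ γ) = r ⬝ᵥ γ := by
    rw [dotProduct_mulVec_transpose E, hEs, h1]
  rw [hS]
  simp only [mulVec_add, dotProduct_add, add_dotProduct, h1, h2, h3, h4, hEform,
    dotProduct_comm γ r, dotProduct_comm (E⁻¹ *ᵥ r) r]
  ring

/-- The loop criterion splits along the kernel of the storage matrix. -/
theorem posDef_sub_iff (hP : P.PosSemidef) (hN : Nᵀ = N) (hFK : F = C * K) (hPK : P * K = 0)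
    (hK : ∀ x, P *ᵥ x = 0 → ∃ γ, x = K *ᵥ γ) (hdet : (Fᵀ * N * F).det ≠ 0) :
    (P - Cᵀ * N * C).PosDef ↔ (-(Fᵀ * N * F)).PosDef ∧
      ∀ x, P *ᵥ x ≠ 0 → (C *ᵥ x) ⬝ᵥ (schurP N F *ᵥ (C *ᵥ x)) < x ⬝ᵥ (P *ᵥ x) := by
  obtain ⟨hPs, hPnn⟩ := posSemidef_real_iff.1 hP
  have hEs : (Fᵀ * N * F)ᵀ = Fᵀ * N * F := by
    simp [transpose_mul, hN, Matrix.mul_assoc]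
  have hPKγ : ∀ γ, P *ᵥ (K *ᵥ γ) = 0 := fun γ => by rw [mulVec_mulVec, hPK, zero_mulVec]
  have hform : ∀ x γ, (x + K *ᵥ γ) ⬝ᵥ ((P - Cᵀ * N * C) *ᵥ (x + K *ᵥ γ)) =
      x ⬝ᵥ (P *ᵥ x) - (C *ᵥ x + F *ᵥ γ) ⬝ᵥ (N *ᵥ (C *ᵥ x + F *ᵥ γ)) := by
    intro x γ
    have e1 : C *ᵥ (x + K *ᵥ γ) = C *ᵥ x + F *ᵥ γ := by rw [mulVec_add, hFK, mulVec_mulVec]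
    have e2 : (x + K *ᵥ γ) ⬝ᵥ (P *ᵥ (x + K *ᵥ γ)) = x ⬝ᵥ (P *ᵥ x) := by
      rw [mulVec_add, hPKγ, add_zero, add_dotProduct, dotProduct_mulVec_transpose P (K *ᵥ γ), hPs,
        hPKγ, zero_dotProduct, add_zero]
    rw [sub_mulVec, dotProduct_sub, e2, ← mulVec_mulVec, ← mulVec_mulVec,
      dotProduct_mulVec_transpose Cᵀ, transpose_transpose, e1]
  have hform0 : ∀ γ, (K *ᵥ γ) ⬝ᵥ ((P - Cᵀ * N * C) *ᵥ (K *ᵥ γ)) =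
      γ ⬝ᵥ ((-(Fᵀ * N * F)) *ᵥ γ) := by
    intro γ
    have h1 := hform 0 γ
    rw [zero_add, zero_dotProduct, mulVec_zero, zero_add] at h1
    rw [h1, neg_mulVec, dotProduct_neg, ← mulVec_mulVec, ← mulVec_mulVec,
      dotProduct_mulVec_transpose Fᵀ, transpose_transpose, zero_sub]
  rw [posDef_real_iff, posDef_real_iff]
  constructor
  · rintro ⟨-, hQ⟩
    refine ⟨⟨by rw [transpose_neg, hEs], fun γ hγ => ?_⟩, fun x hx => ?_⟩
    · rw [← hform0]
      refine hQ _ fun h0 => hγ ?_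
      refine eq_zero_of_mulVec_eq_zero hdet ?_
      have h1 : F *ᵥ γ = 0 := by rw [hFK, ← mulVec_mulVec, h0, mulVec_zero]
      rw [← mulVec_mulVec, h1, mulVec_zero]
    -- The shift along `ker P` at which the completed square in `schurP_form` vanishes.
    · have h1 := hQ (x + K *ᵥ (-((Fᵀ * N * F)⁻¹ *ᵥ (Fᵀ *ᵥ (N *ᵥ (C *ᵥ x)))))) (fun h0 => hx (by
        have := congrArg (fun w => P *ᵥ w) h0
        simpa only [mulVec_add, hPKγ, add_zero, mulVec_zero] using this))
      rw [hform, schurP_form hN hdet, neg_add_cancel, zero_dotProduct, add_zero] at h1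
      linarith
  · rintro ⟨⟨-, hE⟩, hS⟩
    refine ⟨by simp [transpose_mul, hN, hPs, Matrix.mul_assoc], fun w hw => ?_⟩
    by_cases hPw : P *ᵥ w = 0
    · obtain ⟨γ, rfl⟩ := hK w hPw
      rw [hform0]
      exact hE γ fun h0 => hw (by rw [h0, mulVec_zero])
    · have h1 := hform w 0
      rw [schurP_form hN hdet, mulVec_zero, add_zero, zero_add] at h1
      rw [h1]
      set δ := (Fᵀ * N * F)⁻¹ *ᵥ (Fᵀ *ᵥ (N *ᵥ (C *ᵥ w)))
      have h2 : δ ⬝ᵥ ((Fᵀ * N * F) *ᵥ δ) ≤ 0 := by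
        rcases eq_or_ne δ 0 with h0 | h0
        · rw [h0, zero_dotProduct]
        · have := hE δ h0
          rw [neg_mulVec, dotProduct_neg] at this
          linarith
      linarith [hS w hPw]

theorem form_pos_of_mulVec_ne_zero (hP : P.PosSemidef) {x : Fin n → ℝ} (hx : P *ᵥ x ≠ 0) :
    0 < x ⬝ᵥ (P *ᵥ x) :=
  lt_of_le_of_ne ((posSemidef_real_iff.1 hP).2 x) fun h =>
    hx (PosSemidef_mulVec_eq_zero hP h.symm)

/-- Both sides say that `√P X` has norm less than one, the right side through its adjoint `Xᵀ √P`.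
Cauchy–Schwarz for the form of `P` gives one direction, and expanding `‖v - z‖² ≥ 0` with `z = Xᵀ P
X v` the other. -/
theorem posDef_one_sub_iff {X : Matrix (Fin n) (Fin m) ℝ} (hP : P.PosSemidef) :
    (1 - Xᵀ * P * X).PosDef ↔
      ∀ x, P *ᵥ x ≠ 0 → (Xᵀ *ᵥ (P *ᵥ x)) ⬝ᵥ (Xᵀ *ᵥ (P *ᵥ x)) < x ⬝ᵥ (P *ᵥ x) := by
  obtain ⟨hPs, hPnn⟩ := posSemidef_real_iff.1 hP
  have hq : ∀ v y, v ⬝ᵥ (Xᵀ *ᵥ (P *ᵥ y)) = (X *ᵥ v) ⬝ᵥ (P *ᵥ y) := fun v y => by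
    rw [dotProduct_mulVec_transpose, transpose_transpose]
  have hform : ∀ v, v ⬝ᵥ ((1 - Xᵀ * P * X) *ᵥ v) = v ⬝ᵥ v - (X *ᵥ v) ⬝ᵥ (P *ᵥ (X *ᵥ v)) := by
    intro v
    rw [sub_mulVec, one_mulVec, dotProduct_sub, ← mulVec_mulVec, ← mulVec_mulVec, hq]
  rw [posDef_real_iff]
  constructor
  · rintro ⟨-, h⟩ x hx
    have hp := form_pos_of_mulVec_ne_zero hP hx
    set v := Xᵀ *ᵥ (P *ᵥ x) with hv
    by_cases hv0 : v = 0
    · rwa [hv0, zero_dotProduct]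
    have h1 := h v hv0
    rw [hform] at h1
    have h2 := PosSemidef_cauchy_schwarz hP (X *ᵥ v) x
    rw [← hq, ← hv] at h2
    have h3 := hPnn (X *ᵥ v)
    by_contra! h4
    have h5 : 0 < v ⬝ᵥ v := by linarith
    nlinarith [mul_le_mul_of_nonneg_left h4 h3]
  · refine fun h => ⟨by simp [transpose_mul, hPs, Matrix.mul_assoc], fun v hv => ?_⟩
    rw [hform]
    have hvv : 0 < v ⬝ᵥ v :=
      lt_of_le_of_ne (dotProduct_self_nonneg_real v) fun h0 => hv (dotProduct_self_eq_zero.1 h0.symm)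
    by_cases h0 : P *ᵥ (X *ᵥ v) = 0
    · rw [h0, dotProduct_zero, sub_zero]; exact hvv
    · have h1 := h _ h0
      rw [← hq v] at h1 ⊢
      set z := Xᵀ *ᵥ (P *ᵥ (X *ᵥ v))
      have h2 := dotProduct_self_nonneg_real (v - z)
      rw [sub_dotProduct, dotProduct_sub, dotProduct_sub, dotProduct_comm z v] at h2
      linarith

theorem mul_eq_zero_of_mul_self_mul {M : Matrix (Fin m) (Fin m) ℝ} (hM : Mᵀ = M)
    (h : M * M * F = 0) : M * F = 0 := by
  refine ext_mulVec fun γ => ?_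
  rw [zero_mulVec, ← mulVec_mulVec]
  apply dotProduct_self_eq_zero.1
  rw [dotProduct_mulVec_transpose M, hM, mulVec_mulVec, mulVec_mulVec, h, zero_mulVec,
    zero_dotProduct]

theorem det_transpose_mul_self_ne_zero {l : ℕ} {J : Matrix (Fin m) (Fin l) ℝ} (hJ : J.rank = l) :
    (Jᵀ * J).det ≠ 0 := by
  intro h0
  obtain ⟨x, hx, h1⟩ := exists_mulVec_eq_zero_iff.2 h0
  have h2 : J *ᵥ x = 0 := by
    apply dotProduct_self_eq_zero.1
    rw [dotProduct_mulVec_transpose J, mulVec_mulVec, h1, zero_dotProduct]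
  have h3 := LinearMap.finrank_range_add_finrank_ker J.mulVecLin
  rw [Matrix.rank] at hJ
  rw [hJ, Module.finrank_fin_fun] at h3
  have h4 : LinearMap.ker J.mulVecLin = ⊥ := Submodule.finrank_eq_zero.1 (by omega)
  have h5 : x ∈ LinearMap.ker J.mulVecLin := by simpa using h2
  rw [h4] at h5
  exact hx (by simpa using h5)

/-- The matrix of origin data, seen through a weight annihilating the Hankel factor, is a
congruence of the storage matrix. -/
theorem IsPortHamiltonian.exists_weighted_storage {S : StateSpace n m} {G : TransferMatrix m}
    {Φ : Matrix (Fin n) (Fin n) ℝ} {G₀ G₁ G₂ : Matrix (Fin m) (Fin m) ℝ}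
    (h : IsPortHamiltonian S P Φ) (hmin : IsMinimalRealization S G) (hD : S.D = 0)
    (hexp : IsOriginExpansion G G₀ G₁ G₂) {l : ℕ} {J : Matrix (Fin m) (Fin l) ℝ}
    (hJ : G₂ = J * Jᵀ) (hJdet : (Jᵀ * J).det ≠ 0) (hFK : F = S.C * K)
    (hK : ∀ x, P *ᵥ x = 0 → ∃ γ, x = K *ᵥ γ) {M : Matrix (Fin m) (Fin m) ℝ} (hM : Mᵀ = M)
    (hMF : M * F = 0) :
    ∃ X : Matrix (Fin n) (Fin m) ℝ, Xᵀ * P = M * S.C ∧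
      M * G₀ * M + M * G₁ * J * ((Jᵀ * J) ^ 2)⁻¹ * Jᵀ * G₁ᵀ * M = Xᵀ * P * X := by
  -- `M C` vanishes on `ker P`, since `C K = F` and `M F = 0`; hence each `Cᵀ M v` has the form `P
  -- x` required by `origin_form_eq`.
  obtain ⟨Y, hY⟩ := eq_mul_of_kernel_le (L₁ := P) (L₂ := M * S.C) (fun w hw => by
    obtain ⟨γ, rfl⟩ := hK w hw
    rw [mulVec_mulVec, Matrix.mul_assoc, ← hFK, hMF, zero_mulVec])
  have hYt : P * Yᵀ = S.Cᵀ * M := by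
    have := congrArg transpose hY
    rwa [transpose_mul, transpose_mul, hM, h.symm] at this
  refine ⟨Yᵀ, by rw [transpose_transpose, hY], ?_⟩
  have hPX : ∀ v, P *ᵥ (Yᵀ *ᵥ v) = S.Cᵀ *ᵥ (M *ᵥ v) := fun v => by
    rw [mulVec_mulVec, hYt, mulVec_mulVec]
  have hfac : M * G₀ * M + M * G₁ * J * ((Jᵀ * J) ^ 2)⁻¹ * Jᵀ * G₁ᵀ * M =
      M * (G₀ + G₁ * J * ((Jᵀ * J) ^ 2)⁻¹ * Jᵀ * G₁ᵀ) * M := by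
    simp only [Matrix.mul_add, Matrix.add_mul, Matrix.mul_assoc]
  rw [hfac]
  refine ext_mulVec fun v => ?_
  refine dotProduct_eq _ _ fun v' => ?_
  have h1 := h.origin_form_eq hmin hD hexp hJ hJdet (hPX v) (hPX v')
  rw [dotProduct_comm, ← mulVec_mulVec, ← mulVec_mulVec, dotProduct_mulVec_transpose M, hM, h1,
    transpose_transpose, dotProduct_comm _ v', ← mulVec_mulVec, ← mulVec_mulVec,
    dotProduct_mulVec_transpose Y]

end Criterion

end NegImag

/-! ### Assembly of the two cases. -/

theorem theorem1 {m n n' c l : ℕ}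
    (G Gbar : NegImag.TransferMatrix m)
    (S : NegImag.StateSpace n m) (T : NegImag.StateSpace n' m)
    (hS : NegImag.IsMinimalRealization S G) (hT : NegImag.IsMinimalRealization T Gbar)
    (hG : NegImag.IsStrictlyProper G) (hNI : NegImag.IsNI G) (hSNI : NegImag.IsSNI Gbar)
    (G₀ G₁ G₂ : Matrix (Fin m) (Fin m) ℝ) (hexp : NegImag.IsOriginExpansion G G₀ G₁ G₂)
    (hG₂ : G₂ ≠ 0)
    (J : Matrix (Fin m) (Fin l) ℝ) (hJ : G₂ = J * Jᵀ) (hJrank : J.rank = l)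
    (F : Matrix (Fin m) (Fin c) ℝ) (hF : NegImag.IsHankelFactor G₁ G₂ F)
    (hdet : (Fᵀ * NegImag.dcGain Gbar * F).det ≠ 0)
    (Nf : Matrix (Fin m) (Fin m) ℝ) (hNf : Nf = NegImag.schurP (NegImag.dcGain Gbar) F) :
    (Nf.PosSemidef →
      (NegImag.InternallyStable S T ↔
        (-(Fᵀ * NegImag.dcGain Gbar * F)).PosDef ∧
        (1 - NegImag.psdSqrt Nf * G₀ * NegImag.psdSqrt Nf
          - NegImag.psdSqrt Nf * G₁ * J * ((Jᵀ * J) ^ 2)⁻¹ * Jᵀ * G₁ᵀ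
            * NegImag.psdSqrt Nf).PosDef)) ∧
    ((-Nf).PosSemidef →
      (NegImag.InternallyStable S T ↔
        (-(Fᵀ * NegImag.dcGain Gbar * F)).PosDef ∧
        (1 + NegImag.psdSqrt (-Nf) * G₀ * NegImag.psdSqrt (-Nf)
          + NegImag.psdSqrt (-Nf) * G₁ * J * ((Jᵀ * J) ^ 2)⁻¹ * Jᵀ * G₁ᵀ
            * NegImag.psdSqrt (-Nf)).det ≠ 0)) := by
  have hD := NegImag.D_eq_zero hS.1 hG
  have hDs : S.Dᵀ = S.D := by rw [hD, Matrix.transpose_zero]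
  obtain ⟨P, Φ, hP, hΦdet, hΦ, hA, hB⟩ := NegImag.exists_port_hamiltonian hS.controllable
    hS.observable (hNI.im_form_nonpos hS.1 hDs)
  have hPH : NegImag.IsPortHamiltonian S P Φ :=
    ⟨NegImag.storage_posSemidef hS hNI hD hP hΦdet hΦ hA hB, hΦdet, hΦ, hA, hB⟩
  obtain ⟨K, hFK, hAK, hK⟩ := hPH.exists_kernel_parametrization hS hD hexp hF
  have hPK : P * K = 0 := NegImag.ext_mulVec fun γ => by
    rw [zero_mulVec, ← mulVec_mulVec, ← hPH.A_mulVec_eq_zero_iff, mulVec_mulVec, hAK, zero_mulVec]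
  have hK' : ∀ x, P *ᵥ x = 0 → ∃ γ, x = K *ᵥ γ := fun x hx => hK x (hPH.A_mulVec_eq_zero_iff.2 hx)
  have hJdet := NegImag.det_transpose_mul_self_ne_zero hJrank
  have hNfF : Nf * F = 0 := by rw [hNf, NegImag.schurP_mul hdet]
  have hiff : NegImag.InternallyStable S T ↔ (-(Fᵀ * NegImag.dcGain Gbar * F)).PosDef ∧
      ∀ x, P *ᵥ x ≠ 0 → (S.C *ᵥ x) ⬝ᵥ (Nf *ᵥ (S.C *ᵥ x)) < x ⬝ᵥ (P *ᵥ x) := by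
    rw [NegImag.internallyStable_iff hS hT hSNI hD hΦdet hΦ hP hA hB,
      NegImag.posDef_sub_iff hPH.posSemidef (hSNI.dcGain_transpose hT) hFK hPK hK' hdet, hNf]
  refine ⟨fun hpos => ?_, fun hneg => ?_⟩
  · obtain ⟨hMM, hMs⟩ := NegImag.sqrt_facts hpos
    change NegImag.psdSqrt Nf * NegImag.psdSqrt Nf = Nf at hMM
    change (NegImag.psdSqrt Nf)ᵀ = NegImag.psdSqrt Nf at hMs
    generalize NegImag.psdSqrt Nf = M at hMM hMs
    obtain ⟨X, hX, hZ⟩ := hPH.exists_weighted_storage hS hD hexp hJ hJdet hFK hK' hMs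
      (NegImag.mul_eq_zero_of_mul_self_mul hMs (by rw [hMM, hNfF]))
    rw [hiff, sub_sub, hZ, NegImag.posDef_one_sub_iff hPH.posSemidef]
    -- With `N_f = M²` and `M C = Xᵀ P`, both left sides are `‖M C x‖²`.
    refine and_congr_right fun _ => forall₂_congr fun x _ => ?_
    rw [← hMM, ← mulVec_mulVec, NegImag.dotProduct_mulVec_transpose M, hMs,
      mulVec_mulVec _ Xᵀ, hX, mulVec_mulVec]
  · obtain ⟨hMM, hMs⟩ := NegImag.sqrt_facts hneg
    change NegImag.psdSqrt (-Nf) * NegImag.psdSqrt (-Nf) = -Nf at hMM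
    change (NegImag.psdSqrt (-Nf))ᵀ = NegImag.psdSqrt (-Nf) at hMs
    generalize NegImag.psdSqrt (-Nf) = M at hMM hMs
    obtain ⟨X, hX, hZ⟩ := hPH.exists_weighted_storage hS hD hexp hJ hJdet hFK hK' hMs
      (NegImag.mul_eq_zero_of_mul_self_mul hMs (by rw [hMM, Matrix.neg_mul, hNfF, neg_zero]))
    rw [hiff, add_assoc, hZ]
    -- Both second conditions are automatic: the form of `N_f` is nonpositive while `x · P x > 0`,
    -- and `1 + Xᵀ P X` is positive definite.
    refine and_congr_right fun _ => iff_of_true (fun x hx => ?_) ?_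
    · have h1 := (NegImag.posSemidef_real_iff.1 hneg).2 (S.C *ᵥ x)
      rw [neg_mulVec, dotProduct_neg] at h1
      linarith [NegImag.form_pos_of_mulVec_ne_zero hPH.posSemidef hx]
    · have h1 : (Xᵀ * P * X).PosSemidef := by
        have := hPH.posSemidef.conjTranspose_mul_mul_same X
        rwa [conjTranspose_eq_transpose_of_trivial] at this
      exact (PosDef.one.add_posSemidef h1).det_pos.ne'
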